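/- Let $d\in\{1,2,3\}$, let $\Omega\subset\mathbb R^d$ be open (for instance a bounded domain with $C^{1,1}$ boundary, or a convex domain), and let $T>0$, $\gamma>0$. Let $\mathcal U\subset L_2(\Omega)$ be closed and convex with $0\in\mathcal U$, and let $L_2(0,T;\mathcal U)$ be the set of all $u\in L_2(0,T;L_2(\Omega))$ with $u(t)\in\mathcal U$ for a.e. $t$. For measurable $\omega\subset\Omega$, $u\in L_2(0,T;\mathcal U)$ and $f\in H^1_0(\Omega)$ let $y=y^{u,f,\omega}\in W(0,T)=\{y\in L_2(0,T;H^1_0(\Omega)):\partial_t y\in L_2(0,T;H^{-1}(\Omega))\}$ be the weak solution of $$\partial_t y-\Delta y=\chi_\omega u\ \text{ in }\Omega\times(0,T],\qquad y=0\ \text{ on }\partial\Omega\times(0,T],\qquad y(0)=f\ \text{ in }\Omega,$$ that is, $y(0)=f$ and, for all $\varphi\in H^1_0(\Omega)$ and a.e. $t\in(0,T)$, $\langle\partial_t y,\varphi\rangle_{H^{-1},H^1_0}+\int_\Omega\nabla y\cdot\nabla\varphi\,dx=\int_\Omega\chi_\omega u\varphi\,dx$. Put $$J(\omega,u,f)=\int_0^T\|y^{u,f,\omega}(t)\|_{L_2(\Omega)}^2+\gamma\|u(t)\|_{L_2(\Omega)}^2\,dt,\qquad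 \mathcal J_1(\omega,f)=\inf_{u\in L_2(0,T;\mathcal U)}J(\omega,u,f),$$ and let $\bar u^{f,\omega}$ denote the minimiser of $J(\omega,\cdot,f)$. For $\eta_0\in\Omega\setminus\partial\omega$ the topological derivative of $\mathcal J_1(\cdot,f)$ at $\omega$ in $\eta_0$ is the limit $$\mathcal T\mathcal J_1(\omega,f)(\eta_0)=\begin{cases}\displaystyle\lim_{\varepsilon\searrow0}\frac{\mathcal J_1(\omega\setminus\bar B_\varepsilon(\eta_0),f)-\mathcal J_1(\omega,f)}{|\bar B_\varepsilon(\eta_0)|}&\text{if }\eta_0\in\omega,\\[2ex]\displaystyle\lim_{\varepsilon\searrow0}\frac{\mathcal J_1(\omega\cup B_\varepsilon(\eta_0),f)-\mathcal J_1(\omega,f)}{|B_\varepsilon(\eta_0)|}&\text{if }\eta_0\in\Omega\setminus\bar\omega.\end{cases}$$ Assume that $v\in\mathcal U$ implies $-v\in\mathcal U$. Let $\omega\subset\Omega$ be measurable, $\eta_0\in\Omega\setminus\partial\omega$ and $f\in H^1_0(\Omega)$. (i) $\mathcal T\mathcal J_1(\omega,-f)(\eta_0)$ exists if and only if $\mathcal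 T\mathcal J_1(\omega,f)(\eta_0)$ exists, and then $$\mathcal T\mathcal J_1(\omega,-f)(\eta_0)=\mathcal T\mathcal J_1(\omega,f)(\eta_0).$$ (ii) Suppose moreover that there is $\delta>0$ with $\bar B_\delta(\eta_0)\subset\Omega$ such that, for all $g\in H^1_0(\Omega)$ and measurable $\omega'\subset\Omega$, the optimal control $\bar u^{g,\omega'}$ restricted to $\bar B_\delta(\eta_0)$ belongs to $L_1(0,T;C(\bar B_\delta(\eta_0)))$, and such that $\|\bar u^{g_n,\omega_n}-\bar u^{g,\omega'}\|_{L_1(0,T;C(\bar B_\delta(\eta_0)))}\to0$ whenever $g_n\rightharpoonup g$ weakly in $H^1_0(\Omega)$ and $\chi_{\omega_n}\to\chi_{\omega'}$ in $L_1(\Omega)$, with $\omega_n,\omega'\subset\Omega$ measurable. Then both topological derivatives in (i) exist, and they are equal. -/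

import Mathlib

open MeasureTheory Set Filter Topology
open scoped Gradient

namespace ActuatorDesign

section Smooth

open scoped ContDiff

/-- The Euclidean space `ℝ^d`. -/
abbrev E (d : ℕ) : Type := EuclideanSpace ℝ (Fin d)

/-- `L₂(Ω)`. -/
abbrev L2 {d : ℕ} (Ω : Set (E d)) : Type := Lp ℝ 2 (volume.restrict Ω)

/-- `L₂(Ω; ℝ^d)`. -/
abbrev L2Vec {d : ℕ} (Ω : Set (E d)) : Type := Lp (E d) 2 (volume.restrict Ω)

/-- `L₂(Ω) × L₂(Ω; ℝ^d)` as a Hilbert space; a Sobolev function `v` is recorded as `(v, ∇v)`, so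
that the norm of this space is the `H¹`-norm. -/
abbrev L2Pair {d : ℕ} (Ω : Set (E d)) : Type := WithLp 2 (L2 Ω × L2Vec Ω)

/-- The pairs `(φ, ∇φ)` with `φ ∈ C_c^∞(Ω)`. -/
noncomputable def testPairs {d : ℕ} (Ω : Set (E d)) : Submodule ℝ (L2Pair Ω) where
  carrier := {v | ∃ φ : E d → ℝ, ContDiff ℝ ∞ φ ∧ HasCompactSupport φ ∧ tsupport φ ⊆ Ω ∧
    v.fst =ᵐ[volume.restrict Ω] φ ∧ v.snd =ᵐ[volume.restrict Ω] ∇ φ}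
  zero_mem' := by
    refine ⟨0, contDiff_const, HasCompactSupport.zero, ?_, ?_, ?_⟩
    · simp [tsupport]
    · exact Lp.coeFn_zero _ _ _
    · filter_upwards [Lp.coeFn_zero (E d) 2 (volume.restrict Ω)] with x hx
      have h0 : ∇ (0 : E d → ℝ) x = 0 := (hasGradientAt_const x (0 : ℝ)).gradient
      rw [h0]
      exact hx
  add_mem' := by
    rintro v w ⟨φ, hφ, hφc, hφs, hv, hv'⟩ ⟨ψ, hψ, hψc, hψs, hw, hw'⟩
    refine ⟨φ + ψ, hφ.add hψ, hφc.add hψc, ?_, ?_, ?_⟩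
    · exact (tsupport_add φ ψ).trans (union_subset hφs hψs)
    · exact (Lp.coeFn_add v.fst w.fst).trans (hv.add hw)
    · refine (Lp.coeFn_add v.snd w.snd).trans ((hv'.add hw').trans ?_)
      refine Eventually.of_forall fun x => ?_
      have h1 := hφ.differentiable (by simp) x
      have h2 := hψ.differentiable (by simp) x
      simp [gradient, fderiv_add h1 h2]
  smul_mem' := by
    rintro c v ⟨φ, hφ, hφc, hφs, hv, hv'⟩
    refine ⟨c • φ, hφ.const_smul c, hφc.smul_left (f := fun _ => c), ?_, ?_, ?_⟩
    · exact (tsupport_smul_subset_right (fun _ => c) φ).trans hφs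
    · exact (Lp.coeFn_smul c v.fst).trans (hv.const_smul c)
    · refine (Lp.coeFn_smul c v.snd).trans ((hv'.const_smul c).trans ?_)
      refine Eventually.of_forall fun x => ?_
      have h1 := hφ.differentiable (by simp) x
      simp [gradient, fderiv_const_smul h1]

/-- `H¹₀(Ω)`: the closure of `C_c^∞(Ω)` in the `H¹`-norm, with `v.1.fst` the function and
`v.1.snd` its weak gradient. -/
noncomputable def H10 {d : ℕ} (Ω : Set (E d)) : Submodule ℝ (L2Pair Ω) := (testPairs Ω).topologicalClosure

/-- The function in `L₂(Ω)` underlying an element of `H¹₀(Ω)`. -/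
noncomputable def H10.val {d : ℕ} {Ω : Set (E d)} : H10 Ω →L[ℝ] L2 Ω :=
  (WithLp.fstL 2 ℝ (L2 Ω) (L2Vec Ω)).comp (H10 Ω).subtypeL

/-- The weak gradient of an element of `H¹₀(Ω)`. -/
noncomputable def H10.grad {d : ℕ} {Ω : Set (E d)} : H10 Ω →L[ℝ] L2Vec Ω :=
  (WithLp.sndL 2 ℝ (L2 Ω) (L2Vec Ω)).comp (H10 Ω).subtypeL

/-- `H⁻¹(Ω)`, the dual of `H¹₀(Ω)`. -/
abbrev Hneg1 {d : ℕ} (Ω : Set (E d)) : Type := StrongDual ℝ (H10 Ω)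

/-- The embedding `H¹₀(Ω) → H⁻¹(Ω)`, `v ↦ (w ↦ (v, w)_{L₂(Ω)})`. -/
noncomputable def toHneg1 {d : ℕ} {Ω : Set (E d)} : H10 Ω →L[ℝ] Hneg1 Ω :=
  (innerSL ℝ : L2 Ω →L[ℝ] L2 Ω →L[ℝ] ℝ).bilinearComp H10.val H10.val

/-- The time interval `(0, T)` with Lebesgue measure. -/
noncomputable abbrev timeMeasure (T : ℝ) : Measure ℝ := volume.restrict (Ioo 0 T)

/-- `y' ∈ L₂(0,T;H⁻¹(Ω))` is the weak time derivative of `y ∈ L₂(0,T;H¹₀(Ω))`; in other words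
`y ∈ W(0,T)` with `∂ₜ y = y'`. -/
def IsWeakTimeDeriv {d : ℕ} {Ω : Set (E d)} {T : ℝ}
    (y : Lp (H10 Ω) 2 (timeMeasure T)) (y' : Lp (Hneg1 Ω) 2 (timeMeasure T)) : Prop :=
  ∀ φ : ℝ → ℝ, ContDiff ℝ ∞ φ → HasCompactSupport φ → tsupport φ ⊆ Ioo 0 T →
    ∫ t in Ioo 0 T, deriv φ t • toHneg1 (y t) = - ∫ t in Ioo 0 T, φ t • y' t

end Smooth

/-- `y(0) = f`, read through the representative of `y` in `C([0,T];L₂(Ω))`. -/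
def HasInitialValue {d : ℕ} {Ω : Set (E d)} {T : ℝ}
    (y : Lp (H10 Ω) 2 (timeMeasure T)) (f : L2 Ω) : Prop :=
  ∃ w : ℝ → L2 Ω, ContinuousOn w (Icc 0 T) ∧
    (∀ᵐ t ∂(timeMeasure T), w t = H10.val (y t)) ∧ w 0 = f

/-- `y` is the weak solution `y^{u,f,ω} ∈ W(0,T)` of `∂ₜ y - Δ y = χ_ω u` in `Ω × (0,T]`, `y = 0` on
`∂Ω × (0,T]`, `y(0) = f` in `Ω`. -/
def IsWeakSolution {d : ℕ} (Ω : Set (E d)) (T : ℝ) (ω : Set (E d))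
    (u : Lp (L2 Ω) 2 (timeMeasure T)) (f : H10 Ω) (y : Lp (H10 Ω) 2 (timeMeasure T)) : Prop :=
  ∃ y' : Lp (Hneg1 Ω) 2 (timeMeasure T), IsWeakTimeDeriv y y' ∧
    (∀ φ : H10 Ω, ∀ᵐ t ∂(timeMeasure T),
      y' t φ + inner ℝ (H10.grad (y t)) (H10.grad φ)
        = ∫ x in Ω, ω.indicator (fun _ => (1 : ℝ)) x * u t x * H10.val φ x) ∧
    HasInitialValue y (H10.val f)

/-- The space of controls `L₂(0,T;𝒰)`. -/
def controls {d : ℕ} {Ω : Set (E d)} (T : ℝ) (U : Set (L2 Ω)) :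
    Set (Lp (L2 Ω) 2 (timeMeasure T)) :=
  {u | ∀ᵐ t ∂(timeMeasure T), u t ∈ U}

/-- `∫₀ᵀ ‖y(t)‖² + γ ‖u(t)‖² dt` with the norms of `L₂(Ω)`. -/
noncomputable def cost {d : ℕ} {Ω : Set (E d)} {T : ℝ} (γ : ℝ)
    (y : Lp (H10 Ω) 2 (timeMeasure T)) (u : Lp (L2 Ω) 2 (timeMeasure T)) : ℝ :=
  ∫ t in Ioo 0 T, (‖H10.val (y t)‖ ^ 2 + γ * ‖u t‖ ^ 2)

/-- `𝒥₁(ω,f) = inf_{u ∈ L₂(0,T;𝒰)} J(ω,u,f)`, where `J(ω,u,f)` is the cost of `u` and of the (unique)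
weak solution `y^{u,f,ω}`. -/
noncomputable def J1 {d : ℕ} (Ω : Set (E d)) (T γ : ℝ) (U : Set (L2 Ω)) (ω : Set (E d))
    (f : H10 Ω) : ℝ :=
  sInf {c : ℝ | ∃ u ∈ controls T U, ∃ y, IsWeakSolution Ω T ω u f y ∧ c = cost γ y u}

/-- `u` is the minimiser `ū^{f,ω}` of `J(ω,·,f)` over `L₂(0,T;𝒰)`. -/
def IsOptimalControl {d : ℕ} (Ω : Set (E d)) (T γ : ℝ) (U : Set (L2 Ω)) (ω : Set (E d))
    (f : H10 Ω) (u : Lp (L2 Ω) 2 (timeMeasure T)) : Prop :=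
  u ∈ controls T U ∧ ∃ y, IsWeakSolution Ω T ω u f y ∧ cost γ y u = J1 Ω T γ U ω f

/-- Convergence of actuators: `χ_{ω_n} → χ_ω` in `L₁(Ω)`. -/
def ActuatorTendsto {d : ℕ} (Ω : Set (E d)) (ωs : ℕ → Set (E d)) (ω : Set (E d)) : Prop :=
  Tendsto (fun n => eLpNorm
    (fun x => (ωs n).indicator (fun _ => (1 : ℝ)) x - ω.indicator (fun _ => (1 : ℝ)) x) 1
    (volume.restrict Ω)) atTop (𝓝 0)

/-- Weak convergence in `H¹₀(Ω)`. -/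
def WeakTendsto {d : ℕ} {Ω : Set (E d)} (fs : ℕ → H10 Ω) (f : H10 Ω) : Prop :=
  ∀ l : StrongDual ℝ (H10 Ω), Tendsto (fun n => l (fs n)) atTop (𝓝 (l f))

/-- The regularity assumption on optimal controls near `η₀`: on some closed ball
`B = B̄_δ(η₀) ⊆ Ω` every optimal control `ū^{f,ω}` is given by an element `ub f ω` of `L₁(0,T;C(B))`,
and `ub (f_n) (ω_n) → ub f ω` in `L₁(0,T;C(B))` if `f_n ⇀ f` in `H¹₀(Ω)` and `ω_n → ω`. -/
def ControlRegularity {d : ℕ} (Ω : Set (E d)) (T γ : ℝ) (U : Set (L2 Ω)) (η₀ : E d) : Prop :=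
  ∃ δ : ℝ, 0 < δ ∧ Metric.closedBall η₀ δ ⊆ Ω ∧
    ∃ ub : H10 Ω → Set (E d) → Lp C(Metric.closedBall η₀ δ, ℝ) 1 (timeMeasure T),
      (∀ (f : H10 Ω) (ω : Set (E d)), MeasurableSet ω → ω ⊆ Ω →
        ∀ u, IsOptimalControl Ω T γ U ω f u →
          ∀ᵐ t ∂(timeMeasure T), ∀ᵐ x ∂(volume.restrict (Metric.closedBall η₀ δ)),
            ∀ hx : x ∈ Metric.closedBall η₀ δ, u t x = ub f ω t ⟨x, hx⟩) ∧
      (∀ (fs : ℕ → H10 Ω) (f : H10 Ω) (ωs : ℕ → Set (E d)) (ω : Set (E d)),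
        (∀ n, MeasurableSet (ωs n) ∧ ωs n ⊆ Ω) → MeasurableSet ω → ω ⊆ Ω →
        WeakTendsto fs f → ActuatorTendsto Ω ωs ω →
          Tendsto (fun n => ‖ub (fs n) (ωs n) - ub f ω‖) atTop (𝓝 0))

/-- The topological derivative of the shape function `J` at `ω` in a point `η₀ ∉ ∂ω` exists and
equals `L`. -/
def HasTopologicalDeriv {d : ℕ} (J : Set (E d) → ℝ) (ω : Set (E d)) (η₀ : E d) (L : ℝ) : Prop :=
  (η₀ ∈ ω → Tendsto (fun ε : ℝ => (J (ω \ Metric.closedBall η₀ ε) - J ω) /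
    volume.real (Metric.closedBall η₀ ε)) (𝓝[>] 0) (𝓝 L)) ∧
  (η₀ ∉ closure ω → Tendsto (fun ε : ℝ => (J (ω ∪ Metric.ball η₀ ε) - J ω) /
    volume.real (Metric.ball η₀ ε)) (𝓝[>] 0) (𝓝 L))

end ActuatorDesign

/-!
The reflection `u ↦ -u` maps the admissible controls to themselves. By linearity the state for
`(-u, -f)` is the negative of the state for `(u, f)`, so both have the same cost. Hence `J1` takes the
same values at `f` and `-f` on all measurable sets (`J1_neg`), and so do its difference quotients.

The existence of the derivative rests on a formula for the variation of the cost. Weak solutions of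
the heat equation are the mild solutions `S(t) f + ∫₀ᵗ S(t - s) χ_ω u(s) ds`
(`exists_isWeakSolution`, `val_eq_of_isWeakSolution`), where `S` is the semigroup generated by the
Dirichlet Laplacian. On a general open set the Laplacian is only accessible through its resolvent
`G = (1 - Δ)⁻¹`, the composition of the embedding `H¹₀ → L₂` with its adjoint, and `S` is constructed
from `G` alone (`IsResolvent`, `ResolventSemigroup`). The state is now affine in the control, the cost
is a Tikhonov functional, and it has a minimiser from which it grows quadratically
(`exists_isOptimalControl`).

If the characteristic function of the actuator changes by `σ χ_B`, then the cost of a fixed control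
`u` changes by `σ ∫₀ᵀ ∫_B u p dx dt` with an adjoint state `p` (`reducedCost_sub`). For the minimisers
`u` and `ū` of the perturbed and the unperturbed problem, this shows with quadratic growth that
`u → ū` as `B` shrinks, and the change of `J1` is squeezed between the changes of the cost of `u` and
of `ū` (`exists_tendsto_J1_quotient`). It remains to see that averages of `∫₀ᵀ u p dt` over `B`
converge to a value at the centre. By hypothesis the controls converge in `L₁(0,T;C)` near the centre.
The adjoint state equals `G k` for a function `k` of time that is bounded with values in `L₂` and
depends continuously on the data (`adjointState_mild`), and in dimension at most three `G` maps
`L₂(Ω)` boundedly into the continuous functions on closed balls inside `Ω`: after multiplication by a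
cutoff function, `G h` is a square integrable function on the whole space whose Laplacian is square
integrable, so that its Fourier transform is integrable (`exists_continuous_of_laplacian`,
`exists_interiorEval`).
-/

namespace ActuatorDesign

/-! ### The contraction semigroup generated by `1 - G⁻¹` -/

section Semigroup

open scoped RealInnerProductSpace InnerProduct

variable {H : Type*} [NormedAddCommGroup H] [InnerProductSpace ℝ H] [CompleteSpace H]

/-- A bounded operator `G` on a real Hilbert space with `0 ≤ G ≤ 1` and trivial kernel. Such an
operator is the resolvent `(1 + A)⁻¹` of the nonnegative self-adjoint operator `A = G⁻¹ - 1`, and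
`A` only enters through `G`. -/
structure IsResolvent (G : H →L[ℝ] H) : Prop where
  pos : G.IsPositive
  compl_pos : (1 - G).IsPositive
  inj : Function.Injective G

namespace IsResolvent

variable {G : H →L[ℝ] H}

theorem inner_left (hG : IsResolvent G) (x y : H) : ⟪G x, y⟫ = ⟪x, G y⟫ :=
  hG.pos.inner_left_eq_inner_right x y

theorem isPositive_mul_mul {A B : H →L[ℝ] H} (hA : A.IsPositive) (hB : B.IsPositive) :
    (A * B * A).IsPositive := by
  have h := hB.conj_adjoint A
  rw [hA.isSelfAdjoint.adjoint_eq] at h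
  exact h

theorem isPositive_mul (hG : IsResolvent G) : (G * (1 - G)).IsPositive := by
  have h : G * (1 - G) = G * (1 - G) * G + (1 - G) * G * (1 - G) := by noncomm_ring
  rw [h]
  exact (isPositive_mul_mul hG.pos hG.compl_pos).add (isPositive_mul_mul hG.compl_pos hG.pos)

theorem commute_compl (G : H →L[ℝ] H) : Commute G (1 - G) :=
  (Commute.one_right G).sub_right (Commute.refl G)

/-- The polynomial `Gᵃ (1 - G)ᵇ` in `G`. -/
def monomial (G : H →L[ℝ] H) (a b : ℕ) : H →L[ℝ] H := G ^ a * (1 - G) ^ b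

theorem monomial_succ_right (G : H →L[ℝ] H) (a b : ℕ) :
    monomial G a (b + 1) = monomial G a b - monomial G (a + 1) b := by
  simp only [monomial]
  rw [pow_succ' (1 - G), pow_succ G]
  noncomm_ring

theorem inner_monomial_succ_right (G : H →L[ℝ] H) (a b : ℕ) (x : H) :
    ⟪monomial G a (b + 1) x, x⟫ = ⟪monomial G a b x, x⟫ - ⟪monomial G (a + 1) b x, x⟫ := by
  rw [monomial_succ_right, sub_apply, inner_sub_left]

/-- The quadratic forms of these monomials are nonnegative and satisfy the recursion
`inner_monomial_succ_right`; all the spectral estimates for `G` are derived from these two facts. -/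
theorem isPositive_monomial (hG : IsResolvent G) (a b : ℕ) : (monomial G a b).IsPositive := by
  have key : ∀ a b, Commute ((1 - G) ^ b) (G ^ a) := fun a b =>
    ((commute_compl G).pow_pow a b).symm
  induction a using Nat.twoStepInduction generalizing b with
  | zero =>
    induction b using Nat.twoStepInduction with
    | zero => simp [monomial]
    | one => simpa [monomial] using hG.compl_pos
    | more b ih _ =>
      convert isPositive_mul_mul hG.compl_pos ih using 1
      simp only [monomial, pow_zero, one_mul]
      rw [← pow_succ', ← pow_succ]
  | one =>
    induction b using Nat.twoStepInduction with
    | zero => simpa [monomial] using hG.pos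
    | one => simpa [monomial] using hG.isPositive_mul
    | more b ih _ =>
      convert isPositive_mul_mul hG.compl_pos ih using 1
      simp only [monomial]
      have h1 := (key 1 1).eq
      rw [pow_one (1 - G)] at h1
      rw [← mul_assoc (1 - G), h1, mul_assoc, mul_assoc, ← pow_succ, ← pow_succ']
  | more a ih _ =>
    convert isPositive_mul_mul hG.pos (ih b) using 1
    simp only [monomial]
    have h1 := (key 1 b).eq
    rw [pow_one] at h1
    rw [mul_assoc, mul_assoc, h1, ← mul_assoc, ← mul_assoc, ← pow_succ', ← pow_succ]

theorem inner_monomial_nonneg (hG : IsResolvent G) (a b : ℕ) (x : H) :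
    0 ≤ ⟪monomial G a b x, x⟫ := (hG.isPositive_monomial a b).inner_nonneg_left x

theorem norm_compl_sq (hG : IsResolvent G) (x : H) :
    ‖(1 - G) x‖ ^ 2 = ⟪monomial G 0 2 x, x⟫ := by
  rw [← real_inner_self_eq_norm_sq, ← hG.compl_pos.inner_left_eq_inner_right]
  simp [monomial, pow_two]

theorem norm_apply_sq (hG : IsResolvent G) (x : H) : ‖G x‖ ^ 2 = ⟪monomial G 2 0 x, x⟫ := by
  rw [← real_inner_self_eq_norm_sq, ← hG.inner_left]
  simp [monomial, pow_two]

theorem norm_sq_eq (G : H →L[ℝ] H) (x : H) : ‖x‖ ^ 2 = ⟪monomial G 0 0 x, x⟫ := by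
  simp [monomial]

theorem norm_compl_le (hG : IsResolvent G) (x : H) : ‖(1 - G) x‖ ≤ ‖x‖ := by
  have h1 := inner_monomial_succ_right G 0 1 x
  have h2 := inner_monomial_succ_right G 0 0 x
  refine (abs_le_of_sq_le_sq' ?_ (norm_nonneg _)).2
  rw [hG.norm_compl_sq, norm_sq_eq G]
  linarith [hG.inner_monomial_nonneg 1 1 x, hG.inner_monomial_nonneg 1 0 x]

theorem norm_compl_pow_le (hG : IsResolvent G) (n : ℕ) (x : H) : ‖((1 - G) ^ n) x‖ ≤ ‖x‖ := by
  induction n with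
  | zero => simp
  | succ n ih =>
    rw [pow_succ', mul_apply_eq_comp]
    exact (hG.norm_compl_le _).trans ih

theorem denseRange (hG : IsResolvent G) : DenseRange G := by
  have h : (LinearMap.range G.toLinearMap).topologicalClosure = ⊤ := by
    rw [Submodule.topologicalClosure_eq_top_iff]
    have := ContinuousLinearMap.orthogonal_range G
    rw [hG.pos.isSelfAdjoint.adjoint_eq, LinearMap.ker_eq_bot.mpr hG.inj] at this
    exact this
  intro x
  have hx : x ∈ (LinearMap.range G.toLinearMap).topologicalClosure := h ▸ Submodule.mem_top
  exact hx

/-- The quadratic form of `G (1 - G)ⁿ` is at most `1 / n`. -/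
theorem mul_inner_le (hG : IsResolvent G) (n : ℕ) (x : H) :
    n * ⟪monomial G 1 n x, x⟫ ≤ ‖x‖ ^ 2 := by
  have key : n * ⟪monomial G 1 n x, x⟫ + ⟪monomial G 0 n x, x⟫ ≤ ‖x‖ ^ 2 := by
    induction n with
    | zero => simp [monomial]
    | succ n ih =>
      rw [inner_monomial_succ_right, inner_monomial_succ_right]
      push_cast
      nlinarith [mul_nonneg (n.cast_nonneg : (0 : ℝ) ≤ n) (hG.inner_monomial_nonneg 2 n x),
        hG.inner_monomial_nonneg 2 n x]
  linarith [hG.inner_monomial_nonneg 0 n x]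

/-- Powers of `1 - G` decay strongly, since `1` is not an eigenvalue of `1 - G`. -/
theorem tendsto_compl_pow (hG : IsResolvent G) (x : H) :
    Tendsto (fun n : ℕ => ((1 - G) ^ n) x) atTop (𝓝 0) := by
  have hrange : ∀ z, Tendsto (fun n : ℕ => ((1 - G) ^ n) (G z)) atTop (𝓝 0) := by
    intro z
    have hb : ∀ n : ℕ, 1 ≤ n → ‖((1 - G) ^ n) (G z)‖ ^ 2 ≤ ‖z‖ ^ 2 / n := by
      intro n hn
      have hs : ((1 - G) ^ n).IsPositive := by
        simpa [monomial] using hG.isPositive_monomial 0 n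
      have e1 : ‖((1 - G) ^ n) (G z)‖ ^ 2 = ⟪monomial G 2 (2 * n) z, z⟫ := by
        rw [← real_inner_self_eq_norm_sq, ← hs.inner_left_eq_inner_right, ← hG.inner_left]
        have h1 : Commute G ((1 - G) ^ n) := (commute_compl G).pow_right n
        have : monomial G 2 (2 * n) = G * ((1 - G) ^ n * ((1 - G) ^ n * G)) := by
          rw [monomial, two_mul, pow_add, pow_two, ← h1.eq, ← mul_assoc ((1 - G) ^ n) G,
            ← h1.eq]
          simp only [mul_assoc]
        rw [this]; rfl
      have e2 := inner_monomial_succ_right G 1 (2 * n) z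
      have e3 := hG.mul_inner_le (2 * n) z
      have hn' : (0 : ℝ) < n := by exact_mod_cast hn
      rw [le_div_iff₀ hn', e1]
      push_cast at e3
      nlinarith [hG.inner_monomial_nonneg 1 (2 * n) z, hG.inner_monomial_nonneg 1 (2 * n + 1) z]
    have h2 : Tendsto (fun n : ℕ => ‖((1 - G) ^ n) (G z)‖ ^ 2) atTop (𝓝 0) := by
      refine squeeze_zero' (Eventually.of_forall fun n => by positivity)
        (eventually_atTop.2 ⟨1, hb⟩) (tendsto_const_div_atTop_nhds_zero_nat _)
    have h3 := (Real.continuous_sqrt.tendsto 0).comp h2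
    rw [Real.sqrt_zero] at h3
    refine tendsto_zero_iff_norm_tendsto_zero.2 (h3.congr fun n => ?_)
    simp [Real.sqrt_sq]
  rw [Metric.tendsto_atTop]
  intro ε hε
  obtain ⟨z, hz⟩ := hG.denseRange.exists_dist_lt x (half_pos hε)
  obtain ⟨N, hN⟩ := (Metric.tendsto_atTop.1 (hrange z)) (ε / 2) (half_pos hε)
  refine ⟨N, fun n hn => ?_⟩
  have h1 := hN n hn
  rw [dist_zero_right] at h1 ⊢
  have h2 : ((1 - G) ^ n) x = ((1 - G) ^ n) (x - G z) + ((1 - G) ^ n) (G z) := by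
    rw [map_sub]; abel
  rw [h2]
  have h3 := hG.norm_compl_pow_le n (x - G z)
  rw [dist_eq_norm] at hz
  linarith [norm_add_le (((1 - G) ^ n) (x - G z)) (((1 - G) ^ n) (G z))]

end IsResolvent

end Semigroup

section Semigroup

open scoped RealInnerProductSpace InnerProduct

variable {H : Type*} [NormedAddCommGroup H] [InnerProductSpace ℝ H] [CompleteSpace H]

namespace IsResolvent

variable {G : H →L[ℝ] H}

/-- The bounded approximations `Aₙ = ∑_{k=1}^n (1 - G)ᵏ` of `G⁻¹ - 1`. -/
def approxGen (G : H →L[ℝ] H) (n : ℕ) : H →L[ℝ] H := ∑ k ∈ Finset.range n, (1 - G) ^ (k + 1)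

theorem approxGen_mul (G : H →L[ℝ] H) (n : ℕ) :
    approxGen G n * G = (1 - G) - (1 - G) ^ (n + 1) := by
  induction n with
  | zero => simp [approxGen]
  | succ n ih =>
    rw [approxGen, Finset.sum_range_succ, add_mul, ← approxGen, ih, pow_succ (1 - G) (n + 1)]
    noncomm_ring

theorem approxGen_apply (G : H →L[ℝ] H) (n : ℕ) (z : H) :
    approxGen G n (G z) = (1 - G) z - ((1 - G) ^ (n + 1)) z := by
  rw [← mul_apply_eq_comp, approxGen_mul, sub_apply]

theorem approxGen_pos (hG : IsResolvent G) (n : ℕ) : (approxGen G n).IsPositive := by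
  induction n with
  | zero => simp [approxGen]
  | succ n ih =>
    rw [approxGen, Finset.sum_range_succ, ← approxGen]
    exact ih.add (by simpa [monomial] using hG.isPositive_monomial 0 (n + 1))

theorem approxGen_commute_of {B : H →L[ℝ] H} (hB : Commute G B) (n : ℕ) :
    Commute (approxGen G n) B :=
  Commute.sum_left _ _ _ fun _ _ => ((Commute.one_left B).sub_left hB).pow_left _

/-- The semigroup `exp (-t Aₙ)` generated by a bounded approximation. -/
noncomputable def approxSemigroup (G : H →L[ℝ] H) (n : ℕ) (t : ℝ) : H →L[ℝ] H :=
  NormedSpace.exp (t • (-approxGen G n))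

theorem approxSemigroup_zero (G : H →L[ℝ] H) (n : ℕ) : approxSemigroup G n 0 = 1 := by
  simp [approxSemigroup]

theorem approxSemigroup_add (G : H →L[ℝ] H) (n : ℕ) (s t : ℝ) :
    approxSemigroup G n (s + t) = approxSemigroup G n s * approxSemigroup G n t := by
  let +nondep : NormedAlgebra ℚ (H →L[ℝ] H) := NormedAlgebra.restrictScalars ℚ ℝ (H →L[ℝ] H)
  rw [approxSemigroup, add_smul, NormedSpace.exp_add_of_commute]
  · rfl
  · exact ((Commute.refl (-approxGen G n)).smul_left s).smul_right t

theorem commute_approxSemigroup {B : H →L[ℝ] H} (hB : Commute G B) (n : ℕ) (t : ℝ) :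
    Commute (approxSemigroup G n t) B := by
  let +nondep : NormedAlgebra ℚ (H →L[ℝ] H) := NormedAlgebra.restrictScalars ℚ ℝ (H →L[ℝ] H)
  exact (((approxGen_commute_of hB n).neg_left).smul_left t).exp_left

theorem hasDerivAt_approxSemigroup (G : H →L[ℝ] H) (n : ℕ) (t : ℝ) (x : H) :
    HasDerivAt (fun s => approxSemigroup G n s x) (-(approxSemigroup G n t (approxGen G n x))) t := by
  have h : HasDerivAt (fun s : ℝ => approxSemigroup G n s)
      (approxSemigroup G n t * (-approxGen G n)) t := hasDerivAt_exp_smul_const (-approxGen G n) t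
  have h2 := h.clm_apply (hasDerivAt_const t x)
  simpa using h2

theorem approxSemigroup_isSelfAdjoint (hG : IsResolvent G) (n : ℕ) (t : ℝ) :
    IsSelfAdjoint (approxSemigroup G n t) := by
  have h : IsSelfAdjoint (t • (-approxGen G n)) :=
    (IsSelfAdjoint.all t).smul (hG.approxGen_pos n).isSelfAdjoint.neg
  exact h.exp

theorem approxSemigroup_gen (G : H →L[ℝ] H) (n m : ℕ) (t : ℝ) (x : H) :
    approxSemigroup G n t (approxGen G m x) = approxGen G m (approxSemigroup G n t x) := by
  have h := (commute_approxSemigroup (approxGen_commute_of (Commute.refl G) m).symm n t).eq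
  exact congrArg (fun B : H →L[ℝ] H => B x) h

theorem norm_approxSemigroup_le (hG : IsResolvent G) (n : ℕ) {t : ℝ} (ht : 0 ≤ t) (x : H) :
    ‖approxSemigroup G n t x‖ ≤ ‖x‖ := by
  have hd : ∀ s, HasDerivAt (fun s => ‖approxSemigroup G n s x‖ ^ 2)
      (2 * ⟪approxSemigroup G n s x, -(approxSemigroup G n s (approxGen G n x))⟫) s := fun s =>
    (hasDerivAt_approxSemigroup G n s x).norm_sq
  have ha : Antitone (fun s => ‖approxSemigroup G n s x‖ ^ 2) := by
    refine antitone_of_deriv_nonpos (fun s => (hd s).differentiableAt) fun s => ?_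
    rw [(hd s).deriv, approxSemigroup_gen, inner_neg_right]
    linarith [(hG.approxGen_pos n).inner_nonneg_right (approxSemigroup G n s x)]
  have h := ha ht
  simp only [approxSemigroup_zero, one_apply_eq_self] at h
  exact (abs_le_of_sq_le_sq' h (norm_nonneg _)).2

theorem norm_approxSemigroup_sub_le (hG : IsResolvent G) (n m : ℕ) {t : ℝ} (ht : 0 ≤ t) (x : H) :
    ‖approxSemigroup G n t x - approxSemigroup G m t x‖ ≤
      t * ‖approxGen G n x - approxGen G m x‖ := by
  set D : ℝ → H := fun s => approxSemigroup G n (t - s) (approxSemigroup G m s x) with hD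
  have hd : ∀ s, HasDerivAt D
      (approxSemigroup G n (t - s) (approxSemigroup G m s (approxGen G n x - approxGen G m x))) s := by
    intro s
    have h1 : HasDerivAt (fun s : ℝ => approxSemigroup G n (t - s))
        ((-1 : ℝ) • (approxSemigroup G n (t - s) * (-approxGen G n))) s := by
      have h := hasDerivAt_exp_smul_const (-approxGen G n) (t - s)
      exact h.scomp s ((hasDerivAt_id s).const_sub t)
    have h2 := h1.clm_apply (hasDerivAt_approxSemigroup G m s x)
    convert h2 using 1
    simp only [map_sub, map_neg, neg_smul, one_smul, mul_apply_eq_comp, neg_apply,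
      neg_neg, approxSemigroup_gen]
    abel
  have h := norm_image_sub_le_of_norm_deriv_le_segment' (f := D) (a := 0) (b := t)
    (C := ‖approxGen G n x - approxGen G m x‖) (fun s _ => (hd s).hasDerivWithinAt) (fun s hs =>
      (hG.norm_approxSemigroup_le n (by linarith [hs.2]) _).trans
        (hG.norm_approxSemigroup_le m hs.1 _)) t ⟨ht, le_rfl⟩
  simp only [hD, sub_self, sub_zero, approxSemigroup_zero, one_apply_eq_self] at h
  rw [norm_sub_rev, mul_comm]
  exact h

theorem norm_approxSemigroup_sub_time_le (hG : IsResolvent G) (n : ℕ) {s t : ℝ} (hs : 0 ≤ s)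
    (ht : 0 ≤ t) (z : H) :
    ‖approxSemigroup G n t (G z) - approxSemigroup G n s (G z)‖ ≤ 2 * ‖z‖ * |t - s| := by
  have hb : ∀ r ∈ Ici (0 : ℝ), ‖-(approxSemigroup G n r (approxGen G n (G z)))‖ ≤ 2 * ‖z‖ := by
    intro r hr
    rw [norm_neg]
    refine (hG.norm_approxSemigroup_le n hr _).trans ?_
    rw [approxGen_apply]
    have h1 := hG.norm_compl_le z
    have h2 := hG.norm_compl_pow_le (n + 1) z
    linarith [norm_sub_le ((1 - G) z) (((1 - G) ^ (n + 1)) z)]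
  exact (convex_Ici (0 : ℝ)).norm_image_sub_le_of_norm_hasDerivWithin_le
    (fun r _ => (hasDerivAt_approxSemigroup G n r (G z)).hasDerivWithinAt) hb hs ht

theorem cauchySeq_approxSemigroup (hG : IsResolvent G) {t : ℝ} (ht : 0 ≤ t) (x : H) :
    CauchySeq fun n => approxSemigroup G n t x := by
  have hrange : ∀ z, CauchySeq fun n => approxSemigroup G n t (G z) := by
    intro z
    have h1 : CauchySeq fun n : ℕ => approxGen G n (G z) := by
      have h2 : Tendsto (fun n : ℕ => approxGen G n (G z)) atTop (𝓝 ((1 - G) z - 0)) := by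
        simp only [approxGen_apply]
        exact tendsto_const_nhds.sub ((hG.tendsto_compl_pow z).comp (tendsto_add_atTop_nat 1))
      exact h2.cauchySeq
    rw [Metric.cauchySeq_iff'] at h1 ⊢
    intro ε hε
    obtain ⟨N, hN⟩ := h1 (ε / (t + 1)) (by positivity)
    refine ⟨N, fun n hn => ?_⟩
    have h3 := hN n hn
    rw [dist_eq_norm] at h3 ⊢
    refine (hG.norm_approxSemigroup_sub_le n N ht _).trans_lt ?_
    rw [lt_div_iff₀ (by positivity)] at h3
    nlinarith [norm_nonneg (approxGen G n (G z) - approxGen G N (G z))]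
  rw [Metric.cauchySeq_iff']
  intro ε hε
  obtain ⟨z, hz⟩ := hG.denseRange.exists_dist_lt x (show 0 < ε / 3 by positivity)
  obtain ⟨N, hN⟩ := (Metric.cauchySeq_iff'.1 (hrange z)) (ε / 3) (by positivity)
  refine ⟨N, fun n hn => ?_⟩
  have h1 := hN n hn
  have h2 : ∀ k, dist (approxSemigroup G k t x) (approxSemigroup G k t (G z)) < ε / 3 := by
    intro k
    rw [dist_eq_norm, ← map_sub]
    rw [dist_eq_norm] at hz
    exact (hG.norm_approxSemigroup_le k ht _).trans_lt hz
  have h3 := dist_triangle4 (approxSemigroup G n t x) (approxSemigroup G n t (G z))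
    (approxSemigroup G N t (G z)) (approxSemigroup G N t x)
  have h4 := h2 N
  rw [dist_comm] at h4
  linarith [h2 n]

end IsResolvent

/-- A strongly continuous semigroup `S t` of symmetric contractions with generator `1 - G⁻¹`,
extended evenly to negative times, so that `t ↦ S t x` is continuous on all of `ℝ`. The generator is
described by the integrated equation `S t (G x) = G x - ∫₀ᵗ S s (x - G x) ds`. -/
structure ResolventSemigroup (G : H →L[ℝ] H) where
  /-- The operators of the semigroup. -/
  toFun : ℝ → H →L[ℝ] H
  abs' : ∀ t, toFun |t| = toFun t
  zero' : toFun 0 = 1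
  add' : ∀ s t, 0 ≤ s → 0 ≤ t → toFun (s + t) = toFun s * toFun t
  norm_le' : ∀ t x, ‖toFun t x‖ ≤ ‖x‖
  continuous' : ∀ x, Continuous fun t => toFun t x
  inner_left' : ∀ t x y, ⟪toFun t x, y⟫ = ⟪x, toFun t y⟫
  map_resolvent' : ∀ t x, toFun t (G x) = G (toFun t x)
  integral' : ∀ t x, 0 ≤ t → toFun t (G x) = G x - ∫ s in (0 : ℝ)..t, toFun s (x - G x)

/-- Every resolvent generates a contraction semigroup, the strong limit of `exp (-t Aₙ)`. -/
theorem IsResolvent.nonempty_semigroup {G : H →L[ℝ] H} (hG : IsResolvent G) :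
    Nonempty (ResolventSemigroup G) := by
  choose L hL using fun (t : ℝ) (x : H) =>
    cauchySeq_tendsto_of_complete (hG.cauchySeq_approxSemigroup (abs_nonneg t) x)
  set S : ℝ → H →L[ℝ] H := fun t =>
    continuousLinearMapOfTendsto (fun n => IsResolvent.approxSemigroup G n |t|)
      (f := L t) (tendsto_pi_nhds.2 (hL t)) with hS
  have hlim : ∀ t x, Tendsto (fun n => IsResolvent.approxSemigroup G n |t| x) atTop (𝓝 (S t x)) := hL
  have hlim' : ∀ t x, 0 ≤ t →
      Tendsto (fun n => IsResolvent.approxSemigroup G n t x) atTop (𝓝 (S t x)) := fun t x ht => by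
    simpa [abs_of_nonneg ht] using hlim t x
  have hnorm : ∀ t x, ‖S t x‖ ≤ ‖x‖ := fun t x =>
    le_of_tendsto (hlim t x).norm
      (Eventually.of_forall fun n => hG.norm_approxSemigroup_le n (abs_nonneg t) x)
  have hcontG : ∀ z, Continuous fun t => S t (G z) := by
    intro z
    have hl : LipschitzWith (2 * ‖z‖₊) fun t => S t (G z) := by
      refine LipschitzWith.of_dist_le_mul fun t s => ?_
      rw [dist_eq_norm, dist_eq_norm]
      refine (le_of_tendsto ((hlim t (G z)).sub (hlim s (G z))).norm
        (Eventually.of_forall fun n => hG.norm_approxSemigroup_sub_time_le n (abs_nonneg s)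
          (abs_nonneg t) z)).trans ?_
      simp only [NNReal.coe_mul, NNReal.coe_ofNat, coe_nnnorm]
      gcongr
      exact abs_abs_sub_abs_le_abs_sub t s
    exact hl.continuous
  have hcont : ∀ x, Continuous fun t => S t x := by
    intro x
    refine continuous_of_uniform_approx_of_continuous fun u hu => ?_
    obtain ⟨ε, hε, hεu⟩ := Metric.mem_uniformity_dist.1 hu
    obtain ⟨z, hz⟩ := hG.denseRange.exists_dist_lt x hε
    refine ⟨fun t => S t (G z), hcontG z, fun t => hεu ?_⟩
    rw [dist_eq_norm, ← map_sub]
    rw [dist_eq_norm] at hz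
    exact (hnorm t _).trans_lt hz
  refine ⟨⟨S, ?_, ?_, ?_, hnorm, hcont, ?_, ?_, ?_⟩⟩
  · intro t; ext x
    exact tendsto_nhds_unique (by simpa using hlim |t| x) (hlim t x)
  · ext x
    refine tendsto_nhds_unique (hlim 0 x) ?_
    simp [IsResolvent.approxSemigroup_zero]
  · intro s t hs ht
    ext x
    refine tendsto_nhds_unique (hlim' (s + t) x (by positivity)) ?_
    have h1 := hlim' s (S t x) hs
    have h2 : Tendsto (fun n => IsResolvent.approxSemigroup G n s
        (IsResolvent.approxSemigroup G n t x - S t x)) atTop (𝓝 0) := by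
      have h3 := ((hlim' t x ht).sub_const (S t x)).norm
      rw [sub_self, norm_zero] at h3
      exact squeeze_zero_norm (fun n => hG.norm_approxSemigroup_le n hs _) h3
    have h4 := h2.add h1
    rw [zero_add] at h4
    refine h4.congr fun n => ?_
    rw [IsResolvent.approxSemigroup_add, ← map_add, sub_add_cancel]
    rfl
  · intro t x y
    refine tendsto_nhds_unique ((hlim t x).inner tendsto_const_nhds)
      ((tendsto_const_nhds.inner (hlim t y)).congr fun n => ?_)
    have h := hG.approxSemigroup_isSelfAdjoint n |t|
    rw [← ContinuousLinearMap.adjoint_inner_left, h.adjoint_eq]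
  · intro t x
    refine tendsto_nhds_unique (hlim t (G x))
      (((G.continuous.tendsto _).comp (hlim t x)).congr fun n => ?_)
    have h := (IsResolvent.commute_approxSemigroup (Commute.refl G) n |t|).eq
    exact (congrArg (fun B : H →L[ℝ] H => B x) h).symm
  · intro t x ht
    refine tendsto_nhds_unique (hlim' t (G x) ht) ?_
    have e : ∀ n, IsResolvent.approxSemigroup G n t (G x) = G x -
        ∫ s in (0 : ℝ)..t, IsResolvent.approxSemigroup G n s ((x - G x) - ((1 - G) ^ (n + 1)) x) := by
      intro n
      have hc : Continuous fun s => IsResolvent.approxSemigroup G n s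
          (IsResolvent.approxGen G n (G x)) :=
        continuous_iff_continuousAt.2 fun s =>
          (IsResolvent.hasDerivAt_approxSemigroup G n s _).continuousAt
      have h := intervalIntegral.integral_eq_sub_of_hasDerivAt
        (fun s _ => IsResolvent.hasDerivAt_approxSemigroup G n s (G x)) (a := 0) (b := t)
        (hc.neg.intervalIntegrable _ _)
      rw [intervalIntegral.integral_neg, IsResolvent.approxSemigroup_zero] at h
      have e2 : IsResolvent.approxGen G n (G x) = (x - G x) - ((1 - G) ^ (n + 1)) x := by
        rw [IsResolvent.approxGen_apply]; rfl
      rw [← e2, sub_eq_add_neg, h]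
      simp
    simp only [e]
    refine tendsto_const_nhds.sub ?_
    refine intervalIntegral.tendsto_integral_filter_of_dominated_convergence
      (fun _ => ‖x - G x‖ + ‖x‖) ?_ ?_ (by simp) ?_
    · refine Eventually.of_forall fun n => ?_
      have hc : Continuous fun s => IsResolvent.approxSemigroup G n s
          ((x - G x) - ((1 - G) ^ (n + 1)) x) :=
        continuous_iff_continuousAt.2 fun s =>
          (IsResolvent.hasDerivAt_approxSemigroup G n s _).continuousAt
      exact hc.aestronglyMeasurable
    · refine Eventually.of_forall fun n => Eventually.of_forall fun s hs => ?_
      rw [uIoc_of_le ht] at hs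
      refine (hG.norm_approxSemigroup_le n hs.1.le _).trans ((norm_sub_le _ _).trans ?_)
      gcongr
      exact hG.norm_compl_pow_le _ _
    · refine Eventually.of_forall fun s hs => ?_
      rw [uIoc_of_le ht] at hs
      have h1 := hlim' s (x - G x) hs.1.le
      have h2 : Tendsto (fun n => IsResolvent.approxSemigroup G n s (((1 - G) ^ (n + 1)) x))
          atTop (𝓝 0) :=
        squeeze_zero_norm (fun n => hG.norm_approxSemigroup_le n hs.1.le _)
          (by simpa using ((hG.tendsto_compl_pow x).comp (tendsto_add_atTop_nat 1)).norm)
      have h3 := h1.sub h2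
      rw [sub_zero] at h3
      exact h3.congr fun n => (map_sub _ _ _).symm

end Semigroup

/-! ### Mild solutions -/

section Mild

open scoped RealInnerProductSpace InnerProduct BoundedContinuousFunction

variable {H : Type*} [NormedAddCommGroup H] [InnerProductSpace ℝ H] [CompleteSpace H]

/-- A family of contractions `c t s` on `H` that can serve as the kernel of an integral operator
`F ↦ ∫ c t s (F s) ds` with continuous values. -/
structure IsKernel (c : ℝ → ℝ → H →L[ℝ] H) : Prop where
  norm_le : ∀ t s x, ‖c t s x‖ ≤ ‖x‖
  meas : ∀ (t : ℝ) (μ : Measure ℝ) (F : ℝ → H), AEStronglyMeasurable F μ →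
    AEStronglyMeasurable (fun s => c t s (F s)) μ
  cont : ∀ t, ∀ᵐ s, ∀ x, ContinuousAt (fun t' => c t' s x) t

theorem integrable_of_L2 {X : Type*} [NormedAddCommGroup X] {T : ℝ}
    (F : Lp X 2 (timeMeasure T)) : Integrable F (timeMeasure T) :=
  (Lp.memLp F).integrable one_le_two

theorem exists_integral_norm_le (X : Type*) [NormedAddCommGroup X] (T : ℝ) :
    ∃ C, 0 ≤ C ∧ ∀ F : Lp X 2 (timeMeasure T), ∫ s, ‖F s‖ ∂(timeMeasure T) ≤ C * ‖F‖ := by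
  refine ⟨((timeMeasure T) univ ^ (1 / (1 : ENNReal).toReal - 1 / (2 : ENNReal).toReal)).toReal,
    ENNReal.toReal_nonneg, fun F => ?_⟩
  have h1 := eLpNorm_le_eLpNorm_mul_rpow_measure_univ (one_le_two : (1 : ENNReal) ≤ 2)
    (Lp.aestronglyMeasurable F)
  rw [integral_norm_eq_lintegral_enorm (Lp.aestronglyMeasurable F), ← eLpNorm_one_eq_lintegral_enorm,
    Lp.norm_def, mul_comm, ← ENNReal.toReal_mul]
  refine ENNReal.toReal_mono (ENNReal.mul_ne_top (Lp.eLpNorm_ne_top F) ?_) h1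
  refine ENNReal.rpow_ne_top_of_nonneg (by norm_num) (measure_ne_top _ _)

theorem IsKernel.integrable {c : ℝ → ℝ → H →L[ℝ] H} (hc : IsKernel c) (t : ℝ) {μ : Measure ℝ}
    {F : ℝ → H} (hF : Integrable F μ) : Integrable (fun s => c t s (F s)) μ :=
  hF.mono (hc.meas t μ F hF.1) (Eventually.of_forall fun s => hc.norm_le t s _)

theorem IsKernel.norm_integral_le {c : ℝ → ℝ → H →L[ℝ] H} (hc : IsKernel c) (t : ℝ)
    {μ : Measure ℝ} {F : ℝ → H} (hF : Integrable F μ) :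
    ‖∫ s, c t s (F s) ∂μ‖ ≤ ∫ s, ‖F s‖ ∂μ :=
  (norm_integral_le_integral_norm _).trans
    (integral_mono (hc.integrable t hF).norm hF.norm fun s => hc.norm_le t s _)

theorem IsKernel.continuous_integral {c : ℝ → ℝ → H →L[ℝ] H} (hc : IsKernel c) {T : ℝ}
    {F : ℝ → H} (hF : Integrable F (timeMeasure T)) :
    Continuous fun t => ∫ s, c t s (F s) ∂(timeMeasure T) := by
  refine continuous_iff_continuousAt.2 fun t => ?_
  refine continuousAt_of_dominated (bound := fun s => ‖F s‖)
    (Eventually.of_forall fun t' => hc.meas t' _ F hF.1)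
    (Eventually.of_forall fun t' => Eventually.of_forall fun s => hc.norm_le t' s _) hF.norm ?_
  filter_upwards [ae_restrict_of_ae (hc.cont t)] with s hs using hs _

/-- The integral operator `F ↦ ∫₀ᵀ c t s (F s) ds` from `L₂(0,T;H)` to bounded continuous
functions of `t`. -/
noncomputable def kernelOp (T : ℝ) {c : ℝ → ℝ → H →L[ℝ] H} (hc : IsKernel c) :
    Lp H 2 (timeMeasure T) →L[ℝ] (ℝ →ᵇ H) :=
  LinearMap.mkContinuousOfExistsBound
    { toFun := fun F => BoundedContinuousFunction.ofNormedAddCommGroup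
        (fun t => ∫ s, c t s (F s) ∂(timeMeasure T)) (hc.continuous_integral (integrable_of_L2 F))
        (∫ s, ‖F s‖ ∂(timeMeasure T)) fun t => hc.norm_integral_le t (integrable_of_L2 F)
      map_add' := fun F F' => by
        ext t
        simp only [BoundedContinuousFunction.coe_ofNormedAddCommGroup,
          BoundedContinuousFunction.add_apply]
        rw [← integral_add (hc.integrable t (integrable_of_L2 F))
          (hc.integrable t (integrable_of_L2 F'))]
        refine integral_congr_ae ?_
        filter_upwards [Lp.coeFn_add F F'] with s hs
        rw [hs, Pi.add_apply, map_add]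
      map_smul' := fun a F => by
        ext t
        simp only [BoundedContinuousFunction.coe_ofNormedAddCommGroup,
          BoundedContinuousFunction.smul_apply, RingHom.id_apply]
        rw [← integral_smul]
        refine integral_congr_ae ?_
        filter_upwards [Lp.coeFn_smul a F] with s hs
        rw [hs, Pi.smul_apply, map_smul] }
    (by
      obtain ⟨C, hC, h⟩ := exists_integral_norm_le H T
      exact ⟨C, fun F => (BoundedContinuousFunction.norm_le (by positivity)).2 fun t =>
        (hc.norm_integral_le t (integrable_of_L2 F)).trans (h F)⟩)

@[simp]
theorem kernelOp_apply (T : ℝ) {c : ℝ → ℝ → H →L[ℝ] H} (hc : IsKernel c)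
    (F : Lp H 2 (timeMeasure T)) (t : ℝ) :
    kernelOp T hc F t = ∫ s, c t s (F s) ∂(timeMeasure T) := rfl

namespace ResolventSemigroup

variable {G : H →L[ℝ] H} (S : ResolventSemigroup G)

instance : CoeFun (ResolventSemigroup G) fun _ => ℝ → H →L[ℝ] H := ⟨toFun⟩

theorem norm_le (t : ℝ) (x : H) : ‖S t x‖ ≤ ‖x‖ := S.norm_le' t x

theorem continuous_apply (x : H) : Continuous fun t => S t x := S.continuous' x

theorem continuous_uncurry : Continuous fun p : ℝ × H => S p.1 p.2 := by
  refine continuous_iff_continuousAt.2 fun ⟨t, x⟩ => ?_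
  have h1 : Tendsto (fun p : ℝ × H => S p.1 (p.2 - x)) (𝓝 (t, x)) (𝓝 0) := by
    refine squeeze_zero_norm (fun p => S.norm_le _ _) ?_
    have : Continuous fun p : ℝ × H => ‖p.2 - x‖ := by fun_prop
    simpa using this.tendsto (t, x)
  have h2 : Tendsto (fun p : ℝ × H => S p.1 x) (𝓝 (t, x)) (𝓝 (S t x)) :=
    ((S.continuous_apply x).comp continuous_fst).tendsto (t, x)
  have h3 := h1.add h2
  rw [zero_add] at h3
  refine h3.congr fun p => ?_
  rw [← map_add, sub_add_cancel]

theorem aestronglyMeasurable {α : Type*} [MeasurableSpace α] {μ : Measure α} {a : α → ℝ}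
    (ha : Measurable a) {F : α → H} (hF : AEStronglyMeasurable F μ) :
    AEStronglyMeasurable (fun p => S (a p) (F p)) μ :=
  S.continuous_uncurry.comp_aestronglyMeasurable
    (ha.aestronglyMeasurable.prodMk hF)

/-- The semigroup cut off to positive times. -/
noncomputable def causal (τ : ℝ) : H →L[ℝ] H := if 0 < τ then S τ else 0

theorem causal_of_pos {τ : ℝ} (h : 0 < τ) : S.causal τ = S τ := if_pos h

theorem causal_of_nonpos {τ : ℝ} (h : τ ≤ 0) : S.causal τ = 0 := if_neg (not_lt.2 h)

theorem norm_causal_le (t : ℝ) (x : H) : ‖S.causal t x‖ ≤ ‖x‖ := by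
  unfold causal
  split_ifs
  · exact S.norm_le t x
  · simp

theorem causal_inner_left (t : ℝ) (x y : H) : ⟪S.causal t x, y⟫ = ⟪x, S.causal t y⟫ := by
  unfold causal
  split_ifs
  · exact S.inner_left' t x y
  · simp

theorem causal_map (t : ℝ) (x : H) : S.causal t (G x) = G (S.causal t x) := by
  unfold causal
  split_ifs
  · exact S.map_resolvent' t x
  · simp

theorem causal_aestronglyMeasurable {α : Type*} [MeasurableSpace α] {μ : Measure α} {a : α → ℝ}
    (ha : Measurable a) {F : α → H} (hF : AEStronglyMeasurable F μ) :
    AEStronglyMeasurable (fun p => S.causal (a p) (F p)) μ := by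
  have h : (fun p => S.causal (a p) (F p)) = (a ⁻¹' Ioi 0).indicator fun p => S (a p) (F p) := by
    ext p
    by_cases hp : 0 < a p
    · rw [indicator_of_mem (by exact hp), S.causal_of_pos hp]
    · rw [indicator_of_notMem (by exact hp), S.causal_of_nonpos (not_lt.1 hp)]; rfl
  rw [h]
  exact (S.aestronglyMeasurable ha hF).indicator (ha measurableSet_Ioi)

theorem continuousAt_causal {τ : ℝ} (h : τ ≠ 0) (x : H) :
    ContinuousAt (fun t => S.causal t x) τ := by
  rcases lt_or_gt_of_ne h with h | h
  · refine (continuousAt_const (y := (0 : H))).congr ?_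
    filter_upwards [Iio_mem_nhds h] with t ht
    rw [S.causal_of_nonpos (le_of_lt ht)]; rfl
  · refine (S.continuous_apply x).continuousAt.congr ?_
    filter_upwards [Ioi_mem_nhds h] with t ht
    rw [S.causal_of_pos ht]

theorem isKernel_causal : IsKernel fun t s => S.causal (t - s) where
  norm_le t s x := S.norm_causal_le _ _
  meas t μ F hF := S.causal_aestronglyMeasurable (by fun_prop) hF
  cont t := by
    have h : ∀ᵐ s : ℝ, s ≠ t := by simp [ae_iff]
    filter_upwards [h] with s hs x
    exact ContinuousAt.comp (f := fun t' => t' - s) (S.continuousAt_causal (sub_ne_zero.2 hs.symm) x)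
      (by fun_prop)

theorem isKernel_anticausal : IsKernel fun t s => S.causal (s - t) where
  norm_le t s x := S.norm_causal_le _ _
  meas t μ F hF := S.causal_aestronglyMeasurable (by fun_prop) hF
  cont t := by
    have h : ∀ᵐ s : ℝ, s ≠ t := by simp [ae_iff]
    filter_upwards [h] with s hs x
    exact ContinuousAt.comp (f := fun t' => s - t') (S.continuousAt_causal (sub_ne_zero.2 hs) x)
      (by fun_prop)

theorem isKernel_difference : IsKernel fun t s => S (t - s) where
  norm_le t s x := S.norm_le _ _
  meas t μ F hF := S.aestronglyMeasurable (by fun_prop) hF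
  cont t := Eventually.of_forall fun s x =>
    ((S.continuous_apply x).comp (by fun_prop : Continuous fun t' => t' - s)).continuousAt

theorem isKernel_reflected (a : ℝ) : IsKernel fun t s => S (a - t - s) where
  norm_le t s x := S.norm_le _ _
  meas t μ F hF := S.aestronglyMeasurable (by fun_prop) hF
  cont t := Eventually.of_forall fun s x =>
    ((S.continuous_apply x).comp (by fun_prop : Continuous fun t' => a - t' - s)).continuousAt

/-- The trajectory `t ↦ S t f`. -/
noncomputable def hom : H →L[ℝ] (ℝ →ᵇ H) :=
  LinearMap.mkContinuous
    { toFun := fun f => BoundedContinuousFunction.ofNormedAddCommGroup (fun t => S t f)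
        (S.continuous_apply f) ‖f‖ fun t => S.norm_le t f
      map_add' := fun f g => by ext t; simp
      map_smul' := fun a f => by ext t; simp }
    1 fun f => by
      rw [one_mul]
      exact BoundedContinuousFunction.norm_ofNormedAddCommGroup_le _ (norm_nonneg _)
        fun t => S.norm_le t f

/-- The trajectory `t ↦ S (a - t) f`. -/
noncomputable def homReflected (a : ℝ) : H →L[ℝ] (ℝ →ᵇ H) :=
  LinearMap.mkContinuous
    { toFun := fun f => BoundedContinuousFunction.ofNormedAddCommGroup (fun t => S (a - t) f)
        ((S.continuous_apply f).comp (by fun_prop)) ‖f‖ fun t => S.norm_le (a - t) f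
      map_add' := fun f g => by ext t; simp
      map_smul' := fun a f => by ext t; simp }
    1 fun f => by
      rw [one_mul]
      exact BoundedContinuousFunction.norm_ofNormedAddCommGroup_le _ (norm_nonneg _)
        fun t => S.norm_le (a - t) f

/-- The mild solution `S t f + ∫₀ᵗ S (t - s) (F s) ds` of `w' + (G⁻¹ - 1) w = F`, `w 0 = f`. -/
noncomputable def mild (T : ℝ) : H × Lp H 2 (timeMeasure T) →L[ℝ] (ℝ →ᵇ H) :=
  S.hom.comp (ContinuousLinearMap.fst ℝ _ _) +
    (kernelOp T S.isKernel_causal).comp (ContinuousLinearMap.snd ℝ _ _)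

theorem mild_apply (T : ℝ) (f : H) (F : Lp H 2 (timeMeasure T)) (t : ℝ) :
    S.mild T (f, F) t = S t f + ∫ s, S.causal (t - s) (F s) ∂(timeMeasure T) := rfl

theorem mild_zero {T : ℝ} (f : H) (F : Lp H 2 (timeMeasure T)) : S.mild T (f, F) 0 = f := by
  rw [mild_apply, S.zero', integral_eq_zero_of_ae]
  · simp
  · filter_upwards [ae_restrict_mem measurableSet_Ioo] with s hs
    rw [S.causal_of_nonpos (by linarith [hs.1])]; rfl

/-- The adjoint state `∫ₜᵀ S (s - t) (g s) ds`. -/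
noncomputable def adjointState (T : ℝ) : Lp H 2 (timeMeasure T) →L[ℝ] (ℝ →ᵇ H) :=
  kernelOp T S.isKernel_anticausal

theorem intervalIntegrable_apply (x : H) (a b : ℝ) :
    IntervalIntegrable (fun s => S s x) volume a b := (S.continuous_apply x).intervalIntegrable _ _

/-- `∫ₐᵇ S s x ds` lies in the domain of the generator. -/
theorem integral_eq_map {a b : ℝ} (ha : 0 ≤ a) (hb : 0 ≤ b) (x : H) :
    ∫ s in a..b, S s x = G ((∫ s in a..b, S s x) + S a x - S b x) := by
  have h1 := S.integral' a x ha
  have h2 := S.integral' b x hb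
  have h3 : ∫ s in a..b, S s (x - G x) = (∫ s in a..b, S s x) - G (∫ s in a..b, S s x) := by
    rw [← ContinuousLinearMap.intervalIntegral_comp_comm G (S.intervalIntegrable_apply x a b),
      ← intervalIntegral.integral_sub (S.intervalIntegrable_apply x a b)
        ((G.continuous.comp' (S.continuous_apply x)).intervalIntegrable _ _)]
    simp only [map_sub, S.map_resolvent']
  have h4 := intervalIntegral.integral_interval_sub_left (S.intervalIntegrable_apply (x - G x) 0 b)
    (S.intervalIntegrable_apply (x - G x) 0 a)
  rw [map_sub, map_add, ← S.map_resolvent', ← S.map_resolvent', h1, h2]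
  rw [h3] at h4
  have h5 : G (∫ s in a..b, S s x) = (∫ s in a..b, S s x) -
      ((∫ s in (0 : ℝ)..b, S s (x - G x)) - ∫ s in (0 : ℝ)..a, S s (x - G x)) := by
    rw [h4]; abel
  rw [h5]; abel

/-- `∫₀ᵗ S (s - r) (x - G x) ds`, the semigroup being cut off to positive times. -/
theorem integral_causal_compl {r t : ℝ} (hr : 0 ≤ r) (ht : 0 ≤ t) (x : H) :
    ∫ s in (0 : ℝ)..t, S.causal (s - r) (x - G x) =
      (Iio t).indicator (fun _ => G x) r - S.causal (t - r) (G x) := by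
  rcases lt_or_ge r t with h | h
  · rw [intervalIntegral.integral_comp_sub_right (fun s => S.causal s (x - G x)),
      indicator_of_mem (by exact h), S.causal_of_pos (by linarith), S.integral' _ _ (by linarith)]
    have h1 : ∀ a b : ℝ, IntervalIntegrable (fun s => S.causal s (x - G x)) volume a b := by
      intro a b
      refine (intervalIntegrable_const (c := ‖x - G x‖)).mono_fun
        (S.causal_aestronglyMeasurable measurable_id aestronglyMeasurable_const)
        (Eventually.of_forall fun s => ?_)
      rw [norm_norm]; exact S.norm_causal_le _ _
    rw [← intervalIntegral.integral_add_adjacent_intervals (h1 (0 - r) 0) (h1 0 (t - r))]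
    have h2 : ∫ s in (0 - r)..0, S.causal s (x - G x) = 0 := by
      refine intervalIntegral.integral_zero_ae (Eventually.of_forall fun s hs => ?_)
      rw [uIoc_of_le (by linarith)] at hs
      rw [S.causal_of_nonpos hs.2]; rfl
    have h3 : ∫ s in 0..(t - r), S.causal s (x - G x) = ∫ s in 0..(t - r), S s (x - G x) := by
      refine intervalIntegral.integral_congr_ae (Eventually.of_forall fun s hs => ?_)
      rw [uIoc_of_le (by linarith)] at hs
      rw [S.causal_of_pos hs.1]
    rw [h2, h3]; abel
  · rw [indicator_of_notMem (by simpa using h), S.causal_of_nonpos (by linarith)]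
    refine (intervalIntegral.integral_zero_ae (Eventually.of_forall fun s hs => ?_)).trans (by simp)
    rw [uIoc_of_le ht] at hs
    rw [S.causal_of_nonpos (by linarith [hs.2])]; rfl

theorem integrable_causal_prod {μ ν : Measure ℝ} [IsFiniteMeasure μ] [SFinite ν] {F : ℝ → H}
    (hF : Integrable F ν) {a : ℝ × ℝ → ℝ} (ha : Measurable a) :
    Integrable (fun p : ℝ × ℝ => S.causal (a p) (F p.2)) (μ.prod ν) := by
  have h : Integrable (fun p : ℝ × ℝ => F p.2) (μ.prod ν) := hF.comp_snd μ
  exact h.mono (S.causal_aestronglyMeasurable ha h.1)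
    (Eventually.of_forall fun p => S.norm_causal_le _ _)

/-- The mild solution solves the evolution equation, integrated in time and with the resolvent
applied to it. -/
theorem map_mild {T t : ℝ} (ht0 : 0 ≤ t) (htT : t ≤ T) (f : H) (F : Lp H 2 (timeMeasure T)) :
    G (S.mild T (f, F) t) = G f +
      ∫ s in (0 : ℝ)..t, (G (F s) - (S.mild T (f, F) s - G (S.mild T (f, F) s))) := by
  have hF := integrable_of_L2 F
  have hsub : Ioc 0 t ≤ᵐ[volume] Ioo (0 : ℝ) T :=
    Ioo_ae_eq_Ioc.symm.le.trans ((Ioo_subset_Ioo_right htT).eventuallyLE)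
  have hFi : IntervalIntegrable F volume 0 t :=
    (intervalIntegrable_iff_integrableOn_Ioc_of_le ht0).2 (IntegrableOn.mono_set_ae hF hsub)
  have hGFi : IntervalIntegrable (fun s => G (F s)) volume 0 t := by
    rw [intervalIntegrable_iff_integrableOn_Ioc_of_le ht0] at hFi ⊢
    exact G.integrable_comp hFi
  set C : H →L[ℝ] H := 1 - G with hC
  have hCx : ∀ x, C x = x - G x := fun x => rfl
  have hconv : Continuous fun s => ∫ r, S.causal (s - r) (F r) ∂(timeMeasure T) :=
    S.isKernel_causal.continuous_integral hF
  have e1 : ∫ s in (0 : ℝ)..t, (S.mild T (f, F) s - G (S.mild T (f, F) s)) =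
      (∫ s in (0 : ℝ)..t, S s (f - G f)) +
        ∫ s in (0 : ℝ)..t, ∫ r, S.causal (s - r) (C (F r)) ∂(timeMeasure T) := by
    have h : ∀ s, S.mild T (f, F) s - G (S.mild T (f, F) s) =
        S s (f - G f) + ∫ r, S.causal (s - r) (C (F r)) ∂(timeMeasure T) := by
      intro s
      have h2 : ∫ r, S.causal (s - r) (C (F r)) ∂(timeMeasure T) =
          C (∫ r, S.causal (s - r) (F r) ∂(timeMeasure T)) := by
        rw [← C.integral_comp_comm (S.isKernel_causal.integrable s hF)]
        refine integral_congr_ae (Eventually.of_forall fun r => ?_)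
        simp only [hCx, map_sub, S.causal_map]
      rw [h2, ← hCx, mild_apply, map_add, hCx (S s f), map_sub, S.map_resolvent']
    simp only [h]
    refine intervalIntegral.integral_add (S.intervalIntegrable_apply _ _ _) ?_
    exact (S.isKernel_causal.continuous_integral
      (C.integrable_comp hF)).intervalIntegrable _ _
  have e2 : ∫ s in (0 : ℝ)..t, ∫ r, S.causal (s - r) (C (F r)) ∂(timeMeasure T) =
      (∫ s in (0 : ℝ)..t, G (F s)) - ∫ r, S.causal (t - r) (G (F r)) ∂(timeMeasure T) := by
    rw [intervalIntegral.integral_of_le ht0, integral_integral_swap]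
    · have h1 : ∀ᵐ r ∂(timeMeasure T), ∫ s in Ioc 0 t, S.causal (s - r) (C (F r)) =
          (Iio t).indicator (fun r => G (F r)) r - S.causal (t - r) (G (F r)) := by
        filter_upwards [ae_restrict_mem measurableSet_Ioo] with r hr
        rw [← intervalIntegral.integral_of_le ht0]
        exact S.integral_causal_compl hr.1.le ht0 (F r)
      rw [integral_congr_ae h1, integral_sub ((G.integrable_comp hF).indicator measurableSet_Iio)
        (S.isKernel_causal.integrable t (G.integrable_comp hF)),
        integral_indicator measurableSet_Iio, Measure.restrict_restrict measurableSet_Iio,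
        intervalIntegral.integral_of_le ht0, integral_Ioc_eq_integral_Ioo]
      congr 3
      ext r
      simp only [mem_inter_iff, mem_Iio, mem_Ioo]
      constructor
      · rintro ⟨h1, h2, h3⟩; exact ⟨h2, h1⟩
      · rintro ⟨h1, h2⟩; exact ⟨h2, h1, by linarith⟩
    · exact S.integrable_causal_prod (C.integrable_comp hF) (by fun_prop)
  have e3 : ∫ r, S.causal (t - r) (G (F r)) ∂(timeMeasure T) =
      G (∫ r, S.causal (t - r) (F r) ∂(timeMeasure T)) := by
    rw [← G.integral_comp_comm (S.isKernel_causal.integrable t hF)]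
    simp only [S.causal_map]
  have e4 : Continuous fun s => S.mild T (f, F) s - G (S.mild T (f, F) s) := by fun_prop
  have e5 := S.integral' t f ht0
  rw [intervalIntegral.integral_sub hGFi (e4.intervalIntegrable _ _), e1, e2, e3, mild_apply,
    map_add, ← S.map_resolvent', e5]
  abel

end ResolventSemigroup

end Mild

section Mild

open scoped RealInnerProductSpace InnerProduct BoundedContinuousFunction

variable {H : Type*} [NormedAddCommGroup H] [InnerProductSpace ℝ H] [CompleteSpace H]

namespace IsResolvent

variable {G : H →L[ℝ] H}

theorem norm_apply_sq_le (hG : IsResolvent G) (x : H) : ‖G x‖ ^ 2 ≤ ⟪G x, x⟫ := by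
  rw [hG.norm_apply_sq]
  have h1 := inner_monomial_succ_right G 1 0 x
  have h2 : monomial G 1 0 = G := by simp [monomial]
  rw [h2] at h1
  linarith [hG.inner_monomial_nonneg 1 1 x]

/-- The homogeneous evolution equation, in integrated form, has only the trivial solution: for
`W t = ∫₀ᵗ w`, the quantity `⟪G W, W⟫` is nonincreasing. -/
theorem eq_zero_of_evolution (hG : IsResolvent G) {T : ℝ} {w : ℝ → H}
    (hw : ContinuousOn w (Icc 0 T))
    (h : ∀ t ∈ Icc 0 T, G (w t) = -∫ s in (0 : ℝ)..t, (w s - G (w s))) :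
    ∀ t ∈ Icc 0 T, w t = 0 := by
  intro t₀ ht₀
  have hT : 0 ≤ T := ht₀.1.trans ht₀.2
  set W : ℝ → H := fun t => ∫ s in (0 : ℝ)..t, w s with hW
  have hwi : ∀ t ∈ Icc 0 T, IntervalIntegrable w volume 0 t := fun t ht =>
    (hw.mono (by rw [uIcc_of_le ht.1]; exact Icc_subset_Icc_right ht.2)).intervalIntegrable
  have hWG : ∀ t ∈ Icc 0 T, G (w t) = -(W t - G (W t)) := by
    intro t ht
    rw [h t ht, intervalIntegral.integral_sub (hwi t ht),
      ContinuousLinearMap.intervalIntegral_comp_comm G (hwi t ht)]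
    exact ⟨G.integrable_comp (hwi t ht).1, G.integrable_comp (hwi t ht).2⟩
  have hWc : ContinuousOn W (Icc 0 T) := by
    have := intervalIntegral.continuousOn_primitive_interval' (hwi T ⟨hT, le_rfl⟩) left_mem_uIcc
    rwa [uIcc_of_le hT] at this
  have hWd : ∀ t ∈ Ioo 0 T, HasDerivAt W (w t) t := by
    intro t ht
    have hn : Icc 0 T ∈ 𝓝 t := Icc_mem_nhds ht.1 ht.2
    refine intervalIntegral.integral_hasDerivAt_right (hwi t ⟨ht.1.le, ht.2.le⟩) ?_
      (hw.continuousAt hn)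
    exact hw.stronglyMeasurableAtFilter_nhdsWithin measurableSet_Icc t |>.filter_mono
      (nhdsWithin_eq_nhds.2 hn).ge
  have hφ : AntitoneOn (fun t => ⟪G (W t), W t⟫) (Icc 0 T) := by
    have hd : ∀ t ∈ Ioo 0 T, HasDerivAt (fun t => ⟪G (W t), W t⟫)
        (⟪G (W t), w t⟫ + ⟪G (w t), W t⟫) t := fun t ht =>
      (G.hasFDerivAt.comp_hasDerivAt t (hWd t ht)).inner ℝ (hWd t ht)
    refine antitoneOn_of_deriv_nonpos (convex_Icc 0 T)
      ((G.continuous.comp_continuousOn hWc).inner hWc) ?_ ?_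
    · rw [interior_Icc]
      exact fun t ht => (hd t ht).differentiableAt.differentiableWithinAt
    · rw [interior_Icc]
      intro t ht
      rw [(hd t ht).deriv, hG.inner_left, real_inner_comm, hWG t ⟨ht.1.le, ht.2.le⟩, inner_neg_left]
      have := hG.compl_pos.inner_nonneg_left (W t)
      have e : (1 - G) (W t) = W t - G (W t) := rfl
      rw [e] at this
      linarith
  have hW0 : W t₀ = 0 := by
    have h1 := hφ ⟨le_rfl, hT⟩ ht₀ ht₀.1
    have h2 : W 0 = 0 := by simp [hW]
    simp only [h2, map_zero, inner_zero_right] at h1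
    have h3 := hG.norm_apply_sq_le (W t₀)
    have h4 : ‖G (W t₀)‖ = 0 := by nlinarith [norm_nonneg (G (W t₀))]
    exact hG.inj (by rw [norm_eq_zero.1 h4, map_zero])
  have h5 := hWG t₀ ht₀
  rw [hW0, map_zero, sub_zero, neg_zero] at h5
  exact hG.inj (by rw [h5, map_zero])

end IsResolvent

/-- A bounded continuous function of time, as an element of `L₂(0,T;X)`. -/
noncomputable def toL2 (X : Type*) [NormedAddCommGroup X] [NormedSpace ℝ X] (T : ℝ) :
    (ℝ →ᵇ X) →L[ℝ] Lp X 2 (timeMeasure T) :=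
  BoundedContinuousFunction.toLp 2 (timeMeasure T) ℝ

theorem coeFn_toL2 {X : Type*} [NormedAddCommGroup X] [NormedSpace ℝ X] (T : ℝ) (w : ℝ →ᵇ X) :
    toL2 X T w =ᵐ[timeMeasure T] w :=
  BoundedContinuousFunction.coeFn_toLp 2 (timeMeasure T) ℝ w

namespace ResolventSemigroup

variable {G : H →L[ℝ] H} (S : ResolventSemigroup G)

/-- The mild solution operator with source `F` and the adjoint state are adjoint to each other. -/
theorem inner_mild_eq {T : ℝ} (F g : Lp H 2 (timeMeasure T)) :
    ⟪toL2 H T (S.mild T (0, F)), g⟫ = ⟪F, toL2 H T (S.adjointState T g)⟫ := by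
  have hF := integrable_of_L2 F
  have hg := integrable_of_L2 g
  rw [L2.inner_def, L2.inner_def]
  have e1 : ∫ t, ⟪toL2 H T (S.mild T (0, F)) t, g t⟫ ∂(timeMeasure T) =
      ∫ t, ∫ s, ⟪S.causal (t - s) (F s), g t⟫ ∂(timeMeasure T) ∂(timeMeasure T) := by
    refine integral_congr_ae ?_
    filter_upwards [coeFn_toL2 T (S.mild T (0, F))] with t ht
    rw [ht, mild_apply, map_zero, zero_add, real_inner_comm,
      ← integral_inner (S.isKernel_causal.integrable t hF)]
    exact integral_congr_ae (Eventually.of_forall fun s => real_inner_comm _ _)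
  have e2 : ∫ s, ⟪F s, toL2 H T (S.adjointState T g) s⟫ ∂(timeMeasure T) =
      ∫ s, ∫ t, ⟪S.causal (t - s) (F s), g t⟫ ∂(timeMeasure T) ∂(timeMeasure T) := by
    refine integral_congr_ae ?_
    filter_upwards [coeFn_toL2 T (S.adjointState T g)] with s hs
    rw [hs, adjointState, kernelOp_apply, ← integral_inner (S.isKernel_anticausal.integrable s hg)]
    exact integral_congr_ae (Eventually.of_forall fun t => (S.causal_inner_left _ _ _).symm)
  rw [e1, e2, integral_integral_swap]
  have hb : Integrable (fun p : ℝ × ℝ => ‖g p.1‖ * ‖F p.2‖)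
      ((timeMeasure T).prod (timeMeasure T)) := hg.norm.mul_prod hF.norm
  refine hb.mono ?_ (Eventually.of_forall fun p => ?_)
  · exact (S.causal_aestronglyMeasurable (by fun_prop) (hF.1.comp_snd)).inner hg.1.comp_fst
  · simp only [Function.uncurry, norm_mul, norm_norm]
    rw [mul_comm]
    exact (norm_inner_le_norm _ _).trans
      (mul_le_mul_of_nonneg_right (S.norm_causal_le _ _) (norm_nonneg _))

/-- `∫ S (s - t) (S (s - r) x) ds` over `s > max t r` is an integral of `S τ x` over an interval, so
it lies in the domain of the generator, whose value there is a difference of values of the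
semigroup. This is the smoothing effect behind `adjointState_mild`. -/
theorem integral_causal_causal {T t r : ℝ} (ht : t ∈ Icc 0 T) (hr : r ∈ Icc 0 T) (x : H) :
    ∫ s, S.causal (s - t) (S.causal (s - r) x) ∂(timeMeasure T) =
      G ((∫ s, S.causal (s - t) (S.causal (s - r) x) ∂(timeMeasure T)) +
        (2⁻¹ : ℝ) • (S (t - r) x - S (2 * T - t - r) x)) := by
  have hm : max t r ≤ T := max_le ht.2 hr.2
  have hm0 : 0 ≤ max t r := ht.1.trans (le_max_left _ _)
  have e1 : ∫ s, S.causal (s - t) (S.causal (s - r) x) ∂(timeMeasure T) =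
      ∫ s in (max t r)..T, S (2 * s - (t + r)) x := by
    rw [intervalIntegral.integral_of_le hm, integral_Ioc_eq_integral_Ioo]
    have h1 : ∀ s, S.causal (s - t) (S.causal (s - r) x) =
        (Ioi (max t r)).indicator (fun s => S (2 * s - (t + r)) x) s := by
      intro s
      by_cases hs : max t r < s
      · rw [indicator_of_mem (by exact hs)]
        obtain ⟨h1, h2⟩ := max_lt_iff.1 hs
        rw [S.causal_of_pos (by linarith), S.causal_of_pos (by linarith), ← mul_apply_eq_comp,
          ← S.add' _ _ (by linarith) (by linarith)]
        congr 2; ring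
      · rw [indicator_of_notMem (by exact hs)]
        rcases le_max_iff.1 (not_lt.1 hs) with h | h
        · rw [S.causal_of_nonpos (by linarith : s - t ≤ 0)]; rfl
        · rw [S.causal_of_nonpos (by linarith : s - r ≤ 0)]; simp
    simp only [h1]
    rw [integral_indicator measurableSet_Ioi, Measure.restrict_restrict measurableSet_Ioi]
    congr 2
    ext s
    simp only [mem_inter_iff, mem_Ioi, mem_Ioo]
    constructor
    · rintro ⟨h1, h2, h3⟩; exact ⟨h1, h3⟩
    · rintro ⟨h1, h2⟩; exact ⟨h1, by linarith, h2⟩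
  have e2 : ∫ s in (max t r)..T, S (2 * s - (t + r)) x =
      (2⁻¹ : ℝ) • ∫ τ in |t - r|..(2 * T - t - r), S τ x := by
    rw [intervalIntegral.integral_comp_mul_sub (fun τ => S τ x) two_ne_zero]
    congr 2
    · rcases le_total t r with h | h
      · rw [max_eq_right h, abs_of_nonpos (by linarith)]; ring
      · rw [max_eq_left h, abs_of_nonneg (by linarith)]; ring
    · ring
  rw [e1, e2]
  conv_lhs => rw [S.integral_eq_map (abs_nonneg _) (by linarith [ht.2, hr.2]), ← map_smul]
  rw [S.abs', add_sub_assoc, smul_add]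

/-- The element `k t` of `H` with `p t = G (k t)`, where `p` is the adjoint state of the mild
solution with data `f` and `F`; that is, `k = p + A p` for the generator `-A`. The formula
`A p t = ½ (S t f - S (2T - t) f) + ½ ∫₀ᵀ (S (t - r) - S (2T - t - r)) (F r) dr` makes `k` a bounded
function of time. -/
noncomputable def adjointPreimage (T : ℝ) : H × Lp H 2 (timeMeasure T) →L[ℝ] (ℝ →ᵇ H) :=
  (S.adjointState T).comp ((toL2 H T).comp (S.mild T)) +
    (2⁻¹ : ℝ) • ((S.hom - S.homReflected (2 * T)).comp (ContinuousLinearMap.fst ℝ _ _) +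
      (kernelOp T S.isKernel_difference - kernelOp T (S.isKernel_reflected (2 * T))).comp
        (ContinuousLinearMap.snd ℝ _ _))

/-- The adjoint state of a mild solution lies in the range of `G`, with a preimage bounded in time:
this replaces parabolic regularity theory. -/
theorem adjointState_mild {T t : ℝ} (ht : t ∈ Icc 0 T) (f : H) (F : Lp H 2 (timeMeasure T)) :
    S.adjointState T (toL2 H T (S.mild T (f, F))) t = G (S.adjointPreimage T (f, F) t) := by
  have hF := integrable_of_L2 F
  have hT : 0 ≤ T := ht.1.trans ht.2
  have hfi : Integrable (fun s => S.causal (s - t) (S.causal (s - 0) f)) (timeMeasure T) :=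
    S.isKernel_anticausal.integrable t
      (S.isKernel_anticausal.integrable 0 (integrable_const f))
  have hprod : Integrable (fun p : ℝ × ℝ => S.causal (p.1 - t) (S.causal (p.1 - p.2) (F p.2)))
      ((timeMeasure T).prod (timeMeasure T)) := by
    have h := S.integrable_causal_prod (μ := timeMeasure T) hF (a := fun p => p.1 - p.2) (by fun_prop)
    exact h.mono (S.causal_aestronglyMeasurable (by fun_prop) h.1)
      (Eventually.of_forall fun p => S.norm_causal_le _ _)
  have e1 : S.adjointState T (toL2 H T (S.mild T (f, F))) t =
      (∫ s, S.causal (s - t) (S.causal (s - 0) f) ∂(timeMeasure T)) +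
        ∫ r, ∫ s, S.causal (s - t) (S.causal (s - r) (F r)) ∂(timeMeasure T) ∂(timeMeasure T) := by
    rw [← integral_integral_swap hprod, ← integral_add hfi hprod.integral_prod_left, adjointState,
      kernelOp_apply]
    refine integral_congr_ae ?_
    filter_upwards [coeFn_toL2 T (S.mild T (f, F)), ae_restrict_mem measurableSet_Ioo] with s hs hs'
    rw [hs, mild_apply, map_add, sub_zero, S.causal_of_pos hs'.1]
    congr 1
    exact ((S.causal (s - t)).integral_comp_comm (S.isKernel_causal.integrable s hF)).symm
  have e2 : ∫ r, ∫ s, S.causal (s - t) (S.causal (s - r) (F r)) ∂(timeMeasure T) ∂(timeMeasure T) =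
      G ((∫ r, ∫ s, S.causal (s - t) (S.causal (s - r) (F r)) ∂(timeMeasure T) ∂(timeMeasure T)) +
        (2⁻¹ : ℝ) • ((∫ r, S (t - r) (F r) ∂(timeMeasure T)) - ∫ r, S (2 * T - t - r) (F r) ∂(timeMeasure T))) := by
    have h1 := S.isKernel_difference.integrable t hF
    have h2 := (S.isKernel_reflected (2 * T)).integrable t hF
    have h3 : Integrable (fun r => ∫ s, S.causal (s - t) (S.causal (s - r) (F r)) ∂(timeMeasure T))
      (timeMeasure T) := hprod.integral_prod_right
    have h4 : Integrable (fun r => (2⁻¹ : ℝ) • (S (t - r) (F r) - S (2 * T - t - r) (F r)))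
      (timeMeasure T) := (h1.sub h2).smul (2⁻¹ : ℝ)
    rw [← integral_sub h1 h2, ← integral_smul, ← integral_add h3 h4]
    refine Eq.trans (integral_congr_ae ?_) (G.integral_comp_comm (h3.add h4))
    filter_upwards [ae_restrict_mem measurableSet_Ioo] with r hr
    exact S.integral_causal_causal ht ⟨hr.1.le, hr.2.le⟩ (F r)
  have e3 := S.integral_causal_causal ht ⟨le_rfl, hT⟩ f
  have e4 : S.adjointPreimage T (f, F) t = S.adjointState T (toL2 H T (S.mild T (f, F))) t +
      (2⁻¹ : ℝ) • ((S t f - S (2 * T - t) f) +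
        ((∫ r, S (t - r) (F r) ∂(timeMeasure T)) - ∫ r, S (2 * T - t - r) (F r) ∂(timeMeasure T))) := rfl
  rw [e4, e1]
  simp only [sub_zero] at e3 ⊢
  nth_rewrite 1 [e2]
  nth_rewrite 1 [e3]
  rw [← map_add]
  congr 1
  rw [smul_add]
  abel

end ResolventSemigroup

end Mild

/-! ### Energy estimate -/

section Energy

open scoped RealInnerProductSpace InnerProduct BoundedContinuousFunction

variable {H : Type*} [NormedAddCommGroup H] [InnerProductSpace ℝ H] [CompleteSpace H]

theorem norm_sq_L2_eq {X : Type*} [NormedAddCommGroup X] [InnerProductSpace ℝ X] {T : ℝ}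
    (F : Lp X 2 (timeMeasure T)) : ‖F‖ ^ 2 = ∫ t, ‖F t‖ ^ 2 ∂(timeMeasure T) := by
  rw [← real_inner_self_eq_norm_sq, L2.inner_def]
  simp only [real_inner_self_eq_norm_sq]

theorem IsResolvent.isPositive_iff_forall {B : H →L[ℝ] H} (hsymm : ∀ x y, ⟪B x, y⟫ = ⟪x, B y⟫)
    (hnonneg : ∀ x, 0 ≤ ⟪B x, x⟫) : B.IsPositive :=
  ⟨fun x y => hsymm x y, fun x => hnonneg x⟩

/-- Acting pointwise in time, a resolvent on `H` induces a resolvent on `L₂(0,T;H)`. -/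
theorem IsResolvent.compLpL {G : H →L[ℝ] H} (hG : IsResolvent G) (T : ℝ) :
    IsResolvent (G.compLpL 2 (timeMeasure T)) := by
  have key : ∀ {B : H →L[ℝ] H}, B.IsPositive → (B.compLpL 2 (timeMeasure T)).IsPositive := by
    intro B hB
    refine isPositive_iff_forall (fun x y => ?_) fun x => ?_
    · rw [L2.inner_def, L2.inner_def]
      refine integral_congr_ae ?_
      filter_upwards [B.coeFn_compLpL x, B.coeFn_compLpL y] with t h1 h2
      rw [h1, h2, hB.inner_left_eq_inner_right]
    · rw [L2.inner_def]
      refine integral_nonneg_of_ae ?_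
      filter_upwards [B.coeFn_compLpL x] with t h1
      rw [h1]
      exact hB.inner_nonneg_left _
  refine ⟨key hG.pos, ?_, ?_⟩
  · have h := key hG.compl_pos
    convert h using 1
    ext1 x
    refine Lp.ext ?_
    filter_upwards [(1 - G).coeFn_compLpL x, G.coeFn_compLpL x,
      Lp.coeFn_sub x (G.compLpL 2 (timeMeasure T) x)] with t h1 h2 h3
    rw [h1]
    exact h3.trans (by rw [Pi.sub_apply, h2]; rfl)
  · intro x y hxy
    refine Lp.ext ?_
    filter_upwards [G.coeFn_compLpL x, G.coeFn_compLpL y] with t h1 h2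
    refine hG.inj ?_
    rw [← h1, ← h2, hxy]

namespace ResolventSemigroup

variable {G : H →L[ℝ] H} (S : ResolventSemigroup G)

theorem map_mild_comm {T : ℝ} (f : H) (F : Lp H 2 (timeMeasure T)) (t : ℝ) :
    G (S.mild T (f, F) t) = S.mild T (G f, G.compLpL 2 (timeMeasure T) F) t := by
  rw [mild_apply, mild_apply, map_add, S.map_resolvent',
    ← G.integral_comp_comm (S.isKernel_causal.integrable t (integrable_of_L2 F))]
  congr 1
  refine integral_congr_ae ?_
  filter_upwards [G.coeFn_compLpL F] with s hs
  rw [hs, S.causal_map]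

/-- Energy estimate for mild solutions with regular data `G f`, `G F`. -/
theorem integral_inner_mild_le (T : ℝ) (hT : 0 ≤ T) (f : H) (F : ℝ →ᵇ H) :
    ∫ t, ⟪S.mild T (f, toL2 H T F) t, G (S.mild T (f, toL2 H T F) t)⟫ ∂(timeMeasure T) ≤
      2⁻¹ * ‖G f‖ ^ 2 +
        (∫ t, ⟪G (F t), G (S.mild T (f, toL2 H T F) t)⟫ ∂(timeMeasure T)) +
        ∫ t, ‖G (S.mild T (f, toL2 H T F) t)‖ ^ 2 ∂(timeMeasure T) := by
  set m : ℝ →ᵇ H := S.mild T (f, toL2 H T F) with hm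
  set h : ℝ → H := fun s => G (F s) - (m s - G (m s)) with hh
  have hhc : Continuous h := by fun_prop
  have hw : ∀ t ∈ Icc 0 T, G (m t) = G f + ∫ s in (0 : ℝ)..t, h s := by
    intro t ht
    rw [hm, S.map_mild ht.1 ht.2]
    congr 1
    refine intervalIntegral.integral_congr_ae ?_
    have h1 : ∀ᵐ s, s ∈ Ioo 0 T → toL2 H T F s = F s :=
      (ae_restrict_iff' measurableSet_Ioo).1 (coeFn_toL2 T F)
    have h2 : ∀ᵐ s : ℝ, s ≠ T := by simp [ae_iff]
    filter_upwards [h1, h2] with s hs hs2 hs3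
    rw [uIoc_of_le ht.1] at hs3
    rw [hs ⟨hs3.1, lt_of_le_of_ne (hs3.2.trans ht.2) hs2⟩]
  have hd : ∀ t ∈ Ioo 0 T, HasDerivAt (fun t => ‖G (m t)‖ ^ 2) (2 * ⟪G (m t), h t⟫) t := by
    intro t ht
    have h1 : HasDerivAt (fun t => G f + ∫ s in (0 : ℝ)..t, h s) (h t) t :=
      (hhc.integral_hasStrictDerivAt 0 t).hasDerivAt.const_add _
    have h2 : HasDerivAt (fun t => G (m t)) (h t) t := by
      refine h1.congr_of_eventuallyEq ?_
      filter_upwards [Icc_mem_nhds ht.1 ht.2] with s hs using hw s hs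
    exact h2.norm_sq
  have hc : Continuous fun t => ‖G (m t)‖ ^ 2 := by fun_prop
  have hi : Continuous fun t => 2 * ⟪G (m t), h t⟫ := by fun_prop
  have hftc := intervalIntegral.integral_eq_sub_of_hasDerivAt_of_le hT hc.continuousOn hd
    (hi.intervalIntegrable _ _)
  have c1 : Continuous fun t => ⟪G (F t), G (m t)⟫ := by fun_prop
  have c2 : Continuous fun t => ⟪m t, G (m t)⟫ := by fun_prop
  have c3 : Continuous fun t => ⟪G (F t), G (m t)⟫ - ⟪m t, G (m t)⟫ := c1.sub c2
  have e : ∀ t, 2 * ⟪G (m t), h t⟫ =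
      2 * (⟪G (F t), G (m t)⟫ - ⟪m t, G (m t)⟫ + ‖G (m t)‖ ^ 2) := by
    intro t
    simp only [hh, inner_sub_right, real_inner_self_eq_norm_sq]
    rw [real_inner_comm (G (F t)), real_inner_comm (m t)]
    ring
  simp only [e] at hftc
  rw [intervalIntegral.integral_const_mul, intervalIntegral.integral_add
    (c3.intervalIntegrable _ _) (hc.intervalIntegrable _ _),
    intervalIntegral.integral_sub (c1.intervalIntegrable _ _) (c2.intervalIntegrable _ _)] at hftc
  simp only [intervalIntegral.integral_of_le hT, integral_Ioc_eq_integral_Ioo] at hftc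
  have h0 : m 0 = f := S.mild_zero f _
  rw [h0] at hftc
  have := sq_nonneg ‖G (m T)‖
  linarith

theorem le_of_sq_le_energy {y a b c n w : ℝ} (ha : 0 ≤ a) (hb : 0 ≤ b) (hn : 0 ≤ n) (hw : 0 ≤ w)
    (h : y ^ 2 ≤ 2⁻¹ * b ^ 2 + c + n ^ 2) (hba : b ≤ a) (hc : c ≤ a * n) (hna : n ≤ w * a) :
    y ≤ (1 + w) * a := by
  refine (abs_le_of_sq_le_sq' ?_ (by positivity)).2
  have h1 : b ^ 2 ≤ a ^ 2 := by gcongr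
  have h2 : n ^ 2 ≤ (w * a) ^ 2 := by gcongr
  have h3 : a * n ≤ a * (w * a) := by gcongr
  have h4 : 0 ≤ w * a ^ 2 := by positivity
  nlinarith [sq_nonneg a]

variable {V : Type*} [NormedAddCommGroup V] [InnerProductSpace ℝ V] [CompleteSpace V]

open ContinuousLinearMap (adjoint)

/-- If `G = ι ι†` for an embedding `ι : V → H`, then mild solutions take values in `V` at almost all
times, and are square integrable with values in `V`. -/
theorem exists_lift {ι : V →L[ℝ] H} (hι : G = ι ∘L adjoint ι) (hG : IsResolvent G)
    {T : ℝ} (hT : 0 ≤ T) :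
    ∃ Y : H × Lp H 2 (timeMeasure T) →L[ℝ] Lp V 2 (timeMeasure T),
      ∀ z, ι.compLpL 2 (timeMeasure T) (Y z) = toL2 H T (S.mild T z) := by
  set M : H × (ℝ →ᵇ H) →L[ℝ] (ℝ →ᵇ H) := (S.mild T).comp
    ((ContinuousLinearMap.id ℝ H).prodMap (toL2 H T)) with hM
  set Y₀ : H × (ℝ →ᵇ H) →L[ℝ] Lp V 2 (timeMeasure T) :=
    ((adjoint ι).compLpL 2 (timeMeasure T)).comp ((toL2 H T).comp M) with hY₀
  set e : H × (ℝ →ᵇ H) →L[ℝ] H × Lp H 2 (timeMeasure T) :=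
    G.prodMap ((G.compLpL 2 (timeMeasure T)).comp (toL2 H T)) with he
  set W : H × Lp H 2 (timeMeasure T) →L[ℝ] Lp H 2 (timeMeasure T) := (toL2 H T).comp (S.mild T)
    with hW
  have hWe : ∀ z, ∀ᵐ t ∂(timeMeasure T), W (e z) t = G (M z t) := by
    intro z
    filter_upwards [coeFn_toL2 T (S.mild T (e z))] with t ht
    exact ht.trans (S.map_mild_comm z.1 (toL2 H T z.2) t).symm
  have hY₀e : ∀ z, ∀ᵐ t ∂(timeMeasure T), Y₀ z t = adjoint ι (M z t) := by
    intro z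
    filter_upwards [(adjoint ι).coeFn_compLpL (toL2 H T (M z)), coeFn_toL2 T (M z)] with t h1 h2
    rw [← h2]; exact h1
  have hdense : DenseRange e := by
    have h1 : DenseRange (G.compLpL 2 (timeMeasure T) ∘ toL2 H T) :=
      (hG.compLpL T).denseRange.comp
        (BoundedContinuousFunction.toLp_denseRange H _ ℝ (by norm_num)) (by fun_prop)
    exact hG.denseRange.prodMap h1
  have hbound : ∃ C, ∀ z, ‖Y₀ z‖ ≤ C * ‖e z‖ := by
    refine ⟨1 + ‖W‖, fun z => ?_⟩
    have h1 : ‖Y₀ z‖ ^ 2 = ∫ t, ⟪M z t, G (M z t)⟫ ∂(timeMeasure T) := by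
      rw [norm_sq_L2_eq]
      refine integral_congr_ae ?_
      filter_upwards [hY₀e z] with t ht
      rw [ht, ← real_inner_self_eq_norm_sq, ContinuousLinearMap.adjoint_inner_left, hι]
      rfl
    have h2 := S.integral_inner_mild_le T hT z.1 z.2
    have h3 : ∫ t, ⟪G (z.2 t), G (M z t)⟫ ∂(timeMeasure T) = ⟪(e z).2, W (e z)⟫ := by
      rw [L2.inner_def]
      refine integral_congr_ae ?_
      filter_upwards [hWe z, G.coeFn_compLpL (toL2 H T z.2), coeFn_toL2 T z.2] with t h1 h2 h3
      rw [h1, ← h3, ← h2]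
      rfl
    have h4 : ∫ t, ‖G (M z t)‖ ^ 2 ∂(timeMeasure T) = ‖W (e z)‖ ^ 2 := by
      rw [norm_sq_L2_eq]
      refine integral_congr_ae ?_
      filter_upwards [hWe z] with t h1
      rw [h1]
    have h5 : ‖Y₀ z‖ ^ 2 ≤ 2⁻¹ * ‖(e z).1‖ ^ 2 + ⟪(e z).2, W (e z)⟫ + ‖W (e z)‖ ^ 2 := by
      rw [h1, ← h3, ← h4]; exact h2
    exact le_of_sq_le_energy (norm_nonneg _) (norm_nonneg _) (norm_nonneg _) W.opNorm_nonneg h5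
      (norm_fst_le _) ((real_inner_le_norm _ _).trans
        (mul_le_mul_of_nonneg_right (norm_snd_le _) (norm_nonneg _))) (W.le_opNorm _)
  refine ⟨Y₀.toLinearMap.extendOfNorm e.toLinearMap, fun z => ?_⟩
  refine congrFun (DenseRange.equalizer hdense
    ((ι.compLpL 2 (timeMeasure T)).continuous.comp
      (Y₀.toLinearMap.extendOfNorm e.toLinearMap).continuous) W.continuous (funext fun z => ?_)) z
  have h1 : Y₀.toLinearMap.extendOfNorm e.toLinearMap (e z) = Y₀ z :=
    LinearMap.extendOfNorm_eq (f := Y₀.toLinearMap) (e := e.toLinearMap) hdense hbound z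
  simp only [Function.comp_apply]
  rw [h1]
  refine Lp.ext ?_
  filter_upwards [hWe z, hY₀e z, ι.coeFn_compLpL (Y₀ z)] with t h2 h3 h4
  rw [h4, h3, h2, hι]
  rfl

end ResolventSemigroup

end Energy

/-! ### Weak derivatives on an interval -/

section Interval

open scoped ContDiff

theorem test_eq_zero {φ : ℝ → ℝ} {T t : ℝ} (hs : tsupport φ ⊆ Ioo 0 T) (ht : t ∉ Ioo 0 T) :
    φ t = 0 := by
  by_contra h
  exact ht (hs (subset_tsupport φ h))

/-- Integration by parts for a test function and the primitive of an integrable function. -/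
theorem integral_deriv_mul_primitive {T : ℝ} {φ g : ℝ → ℝ} (hφ : ContDiff ℝ ∞ φ)
    (hs : tsupport φ ⊆ Ioo 0 T) (hg : Integrable g (timeMeasure T)) (c : ℝ) :
    ∫ t in Ioo 0 T, deriv φ t * (c + ∫ s in (0 : ℝ)..t, g s) = -∫ t in Ioo 0 T, φ t * g t := by
  rcases le_or_gt T 0 with hT | hT
  · simp [Ioo_eq_empty (not_lt.2 hT)]
  have hφd : Continuous (deriv φ) := hφ.continuous_deriv (by simp)
  have hftc : ∀ a b : ℝ, ∫ t in a..b, deriv φ t = φ b - φ a := fun a b =>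
    intervalIntegral.integral_deriv_eq_sub
      (fun t _ => (hφ.differentiable (by simp)).differentiableAt) (hφd.intervalIntegrable _ _)
  have hφT : φ T = 0 := test_eq_zero hs (by simp)
  have hφ0 : φ 0 = 0 := test_eq_zero hs (by simp)
  have hφi : Integrable (deriv φ) (timeMeasure T) :=
    (hφd.integrableOn_Icc (a := 0) (b := T)).mono_set Ioo_subset_Icc_self
  have hprod : Integrable (fun p : ℝ × ℝ => (Ioi p.2).indicator (fun t => deriv φ t * g p.2) p.1)
      ((timeMeasure T).prod (timeMeasure T)) := by
    have h1 : Integrable (fun p : ℝ × ℝ => deriv φ p.1 * g p.2)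
      ((timeMeasure T).prod (timeMeasure T)) := hφi.mul_prod hg
    exact h1.indicator (measurableSet_lt measurable_snd measurable_fst)
  have e1 : ∀ t ∈ Ioo 0 T, deriv φ t * (c + ∫ s in (0 : ℝ)..t, g s) = c * deriv φ t +
      ∫ s in Ioo 0 T, (Ioi s).indicator (fun t => deriv φ t * g s) t := by
    intro t ht
    have h1 : ∀ s, (Ioi s).indicator (fun t => deriv φ t * g s) t =
        deriv φ t * (Iio t).indicator g s := by
      intro s
      by_cases h : s < t
      · rw [indicator_of_mem (by exact h), indicator_of_mem (by exact h)]
      · rw [indicator_of_notMem (by exact h), indicator_of_notMem (by exact h), mul_zero]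
    simp only [h1]
    rw [integral_const_mul, integral_indicator measurableSet_Iio,
      Measure.restrict_restrict measurableSet_Iio, intervalIntegral.integral_of_le ht.1.le,
      integral_Ioc_eq_integral_Ioo]
    have h2 : Iio t ∩ Ioo 0 T = Ioo 0 t := by
      ext s
      simp only [mem_inter_iff, mem_Iio, mem_Ioo]
      constructor
      · rintro ⟨h1, h2, h3⟩; exact ⟨h2, h1⟩
      · rintro ⟨h1, h2⟩; exact ⟨h2, h1, h2.trans ht.2⟩
    rw [h2]; ring
  have e2 : ∀ s ∈ Ioo 0 T, ∫ t in Ioo 0 T, (Ioi s).indicator (fun t => deriv φ t * g s) t =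
      -(φ s * g s) := by
    intro s hs
    rw [integral_indicator measurableSet_Ioi, Measure.restrict_restrict measurableSet_Ioi,
      integral_mul_const]
    have h2 : Ioi s ∩ Ioo 0 T = Ioo s T := by
      ext t
      simp only [mem_inter_iff, mem_Ioi, mem_Ioo]
      constructor
      · rintro ⟨h1, h2, h3⟩; exact ⟨h1, h3⟩
      · rintro ⟨h1, h2⟩; exact ⟨h1, hs.1.trans h1, h2⟩
    rw [h2, ← integral_Ioc_eq_integral_Ioo, ← intervalIntegral.integral_of_le hs.2.le, hftc, hφT]
    ring
  have e3 : ∫ t in Ioo 0 T, deriv φ t = 0 := by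
    rw [← integral_Ioc_eq_integral_Ioo, ← intervalIntegral.integral_of_le hT.le, hftc, hφT, hφ0,
      sub_zero]
  rw [setIntegral_congr_fun measurableSet_Ioo e1, integral_add (hφi.const_mul c)
    hprod.integral_prod_left, integral_const_mul, e3, integral_integral_swap hprod,
    setIntegral_congr_fun measurableSet_Ioo e2, integral_neg]
  ring

/-- The lemma of du Bois-Reymond: a continuous function with vanishing weak derivative is
constant. -/
theorem eq_of_integral_deriv_mul_eq_zero {T : ℝ} (hT : 0 < T) {D : ℝ → ℝ}
    (hD : ContinuousOn D (Icc 0 T))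
    (h : ∀ φ : ℝ → ℝ, ContDiff ℝ ∞ φ → HasCompactSupport φ → tsupport φ ⊆ Ioo 0 T →
      ∫ t in Ioo 0 T, deriv φ t * D t = 0) :
    ∀ t ∈ Icc 0 T, D t = D 0 := by
  have hDi : IntegrableOn D (Ioo 0 T) := (hD.integrableOn_Icc).mono_set Ioo_subset_Icc_self
  -- a bump function of integral one, supported in the interval
  obtain ⟨ρ, hρ, hρc, hρs, hρ1⟩ : ∃ ρ : ℝ → ℝ, ContDiff ℝ ∞ ρ ∧ HasCompactSupport ρ ∧
      tsupport ρ ⊆ Ioo 0 T ∧ ∫ t, ρ t = 1 := by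
    let b : ContDiffBump (T / 2) := ⟨T / 8, T / 4, by positivity, by linarith⟩
    refine ⟨b.normed volume, b.contDiff_normed, b.hasCompactSupport_normed, ?_,
      b.integral_normed⟩
    rw [b.tsupport_normed_eq, Real.closedBall_eq_Icc]
    intro t ht
    simp only [b, mem_Icc] at ht
    exact ⟨by linarith [ht.1], by linarith [ht.2]⟩
  set c : ℝ := ∫ t in Ioo 0 T, ρ t * D t with hc
  have hint : ∀ ψ : ℝ → ℝ, Continuous ψ → IntegrableOn (fun t => ψ t * D t) (Ioo 0 T) := by
    intro ψ hψ
    exact (hψ.continuousOn.mul hD).integrableOn_Icc.mono_set Ioo_subset_Icc_self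
  have key : ∀ ψ : ℝ → ℝ, ContDiff ℝ ∞ ψ → HasCompactSupport ψ → tsupport ψ ⊆ Ioo 0 T →
      ∫ t in Ioo 0 T, ψ t * D t = (∫ t, ψ t) * c := by
    intro ψ hψ hψc hψs
    set η : ℝ → ℝ := fun t => ψ t - (∫ s, ψ s) * ρ t with hη
    have hηd : ContDiff ℝ ∞ η := hψ.sub (contDiff_const.mul hρ)
    have hK : IsCompact (tsupport ψ ∪ tsupport ρ) := hψc.isCompact.union hρc.isCompact
    have hηK : ∀ t, t ∉ tsupport ψ ∪ tsupport ρ → η t = 0 := by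
      intro t ht
      rw [mem_union, not_or] at ht
      simp [hη, image_eq_zero_of_notMem_tsupport ht.1, image_eq_zero_of_notMem_tsupport ht.2]
    have hKs : tsupport ψ ∪ tsupport ρ ⊆ Ioo 0 T := union_subset hψs hρs
    have hne : (tsupport ψ ∪ tsupport ρ).Nonempty := by
      by_contra hne
      rw [not_nonempty_iff_eq_empty, union_empty_iff, tsupport_eq_empty_iff,
        tsupport_eq_empty_iff] at hne
      rw [hne.2] at hρ1
      simp at hρ1
    obtain ⟨a, haK, ha⟩ := hK.exists_isLeast hne
    obtain ⟨b, hbK, hb⟩ := hK.exists_isGreatest hne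
    have hη0 : ∀ t, t ∉ Icc a b → η t = 0 := fun t ht =>
      hηK t fun htK => ht ⟨ha htK, hb htK⟩
    have hηint : ∫ t, η t = 0 := by
      rw [hη, integral_sub (hψ.continuous.integrable_of_hasCompactSupport hψc)
        ((hρ.continuous.integrable_of_hasCompactSupport hρc).const_mul _), integral_const_mul, hρ1]
      ring
    set Φ : ℝ → ℝ := fun t => ∫ s in a..t, η s with hΦ
    have hΦd : ∀ t, HasDerivAt Φ (η t) t := fun t =>
      (hηd.continuous.integral_hasStrictDerivAt a t).hasDerivAt
    have hderiv : deriv Φ = η := funext fun t => (hΦd t).deriv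
    have hΦ0 : ∀ t, t ∉ Icc a b → Φ t = 0 := by
      intro t ht
      rcases lt_or_ge t a with h1 | h1
      · refine intervalIntegral.integral_zero_ae ?_
        have h2 : ∀ᵐ s : ℝ, s ≠ a := by simp [ae_iff]
        filter_upwards [h2] with s hs2 hs
        rw [uIoc_of_ge h1.le] at hs
        exact hη0 s fun h3 => hs2 (le_antisymm hs.2 h3.1)
      · have h2 : b < t := by
          by_contra h2
          exact ht ⟨h1, not_lt.1 h2⟩
        rw [hΦ]
        simp only
        rw [intervalIntegral.integral_of_le h1, ← integral_Icc_eq_integral_Ioc,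
          setIntegral_eq_integral_of_forall_compl_eq_zero, hηint]
        exact fun s hs => hη0 s fun h3 => hs ⟨h3.1, h3.2.trans h2.le⟩
    have hΦs : tsupport Φ ⊆ Icc a b :=
      closure_minimal (fun t ht => by_contra fun h1 => ht (hΦ0 t h1)) isClosed_Icc
    have hΦC : ContDiff ℝ ∞ Φ := by
      rw [contDiff_infty_iff_deriv, hderiv]
      exact ⟨fun t => (hΦd t).differentiableAt, hηd⟩
    have h1 := h Φ hΦC (isCompact_Icc.of_isClosed_subset (isClosed_tsupport Φ) hΦs)
      (hΦs.trans (Icc_subset_Ioo (hKs haK).1 (hKs hbK).2))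
    rw [hderiv] at h1
    have h2 : ∀ t, η t * D t = ψ t * D t - (∫ s, ψ s) * (ρ t * D t) := fun t => by
      simp only [hη]; ring
    simp only [h2] at h1
    rw [integral_sub (hint ψ hψ.continuous) ((hint ρ hρ.continuous).const_mul _),
      integral_const_mul] at h1
    linarith
  have hae : ∀ᵐ t, t ∈ Ioo 0 T → D t - c = 0 := by
    refine isOpen_Ioo.ae_eq_zero_of_integral_contDiff_smul_eq_zero
      ((hDi.sub (integrableOn_const (by simp))).locallyIntegrableOn) fun ψ hψ hψc hψs => ?_
    have h0 : ∀ t, t ∉ Ioo 0 T → ψ t • (D t - c) = 0 := fun t ht => by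
      rw [test_eq_zero hψs ht, zero_smul]
    rw [← setIntegral_eq_integral_of_forall_compl_eq_zero h0]
    have h1 : ∫ t in Ioo 0 T, ψ t = ∫ t, ψ t :=
      setIntegral_eq_integral_of_forall_compl_eq_zero fun t ht => test_eq_zero hψs ht
    simp only [smul_eq_mul, mul_sub]
    rw [integral_sub (hint ψ hψ.continuous)
      ((hψ.continuous.integrable_of_hasCompactSupport hψc).integrableOn.mul_const c),
      integral_mul_const, key ψ hψ hψc hψs, h1, sub_self]
  have hIoo : EqOn D (fun _ => c) (Ioo 0 T) := by
    refine Measure.eqOn_open_of_ae_eq (μ := volume) ?_ isOpen_Ioo (hD.mono Ioo_subset_Icc_self)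
      continuousOn_const
    rw [EventuallyEq, ae_restrict_iff' measurableSet_Ioo]
    filter_upwards [hae] with t ht ht' using sub_eq_zero.1 (ht ht')
  have hIcc : EqOn D (fun _ => c) (Icc 0 T) := by
    refine hIoo.of_subset_closure hD continuousOn_const Ioo_subset_Icc_self ?_
    rw [closure_Ioo hT.ne]
  exact fun t ht => (hIcc ht).trans (hIcc ⟨le_rfl, hT.le⟩).symm

end Interval

/-! ### The space `H¹₀(Ω)` -/

section Sobolev

open scoped ContDiff RealInnerProductSpace InnerProduct
open ContinuousLinearMap (adjoint)

variable {d : ℕ} {Ω : Set (E d)}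

instance : CompleteSpace (H10 Ω) :=
  (Submodule.isClosed_topologicalClosure (testPairs Ω)).completeSpace_coe

theorem H10.inner_eq (v w : H10 Ω) :
    ⟪v, w⟫ = ⟪H10.val v, H10.val w⟫ + ⟪H10.grad v, H10.grad w⟫ :=
  WithLp.prod_inner_apply _ _

theorem H10.norm_val_le (v : H10 Ω) : ‖H10.val v‖ ≤ ‖v‖ := by
  refine (abs_le_of_sq_le_sq' ?_ (norm_nonneg _)).2
  rw [← real_inner_self_eq_norm_sq, ← real_inner_self_eq_norm_sq, H10.inner_eq]
  linarith [real_inner_self_nonneg (x := H10.grad v)]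

theorem toHneg1_apply (v w : H10 Ω) : toHneg1 v w = ⟪H10.val v, H10.val w⟫ := rfl

theorem continuous_gradient {φ : E d → ℝ} (hφ : ContDiff ℝ ∞ φ) : Continuous (∇ φ) :=
  (InnerProductSpace.toDual ℝ (E d)).symm.continuous.comp (hφ.continuous_fderiv (by simp))

theorem hasCompactSupport_gradient {φ : E d → ℝ} (hc : HasCompactSupport φ) :
    HasCompactSupport (∇ φ) := by
  have h := (hc.fderiv (𝕜 := ℝ)).comp_left (g := (InnerProductSpace.toDual ℝ (E d)).symm)
    (map_zero _)
  exact h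

/-- Test functions belong to `H¹₀(Ω)`. -/
theorem H10.exists_of_test {φ : E d → ℝ} (hφ : ContDiff ℝ ∞ φ) (hc : HasCompactSupport φ)
    (hs : tsupport φ ⊆ Ω) :
    ∃ v : H10 Ω, H10.val v =ᵐ[volume.restrict Ω] φ ∧ H10.grad v =ᵐ[volume.restrict Ω] ∇ φ := by
  have h1 : MemLp φ 2 (volume.restrict Ω) :=
    (hφ.continuous.memLp_of_hasCompactSupport hc).restrict Ω
  have h2 : MemLp (∇ φ) 2 (volume.restrict Ω) :=
    ((continuous_gradient hφ).memLp_of_hasCompactSupport (hasCompactSupport_gradient hc)).restrict Ω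
  refine ⟨⟨WithLp.toLp 2 (h1.toLp, h2.toLp), subset_closure ⟨φ, hφ, hc, hs, ?_, ?_⟩⟩, ?_, ?_⟩
  · exact h1.coeFn_toLp
  · exact h2.coeFn_toLp
  · exact h1.coeFn_toLp
  · exact h2.coeFn_toLp

theorem L2_inner_eq {X : Type*} [NormedAddCommGroup X] [InnerProductSpace ℝ X]
    {f g : Lp X 2 (volume.restrict Ω)} {f' g' : E d → X} (hf : f =ᵐ[volume.restrict Ω] f')
    (hg : g =ᵐ[volume.restrict Ω] g') : ⟪f, g⟫ = ∫ x in Ω, ⟪f' x, g' x⟫ := by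
  rw [L2.inner_def]
  refine integral_congr_ae ?_
  filter_upwards [hf, hg] with x h1 h2
  rw [h1, h2]

/-- The gradient component of an element of `H¹₀(Ω)` is its weak gradient, also against test
functions that do not vanish near the boundary. -/
theorem H10.integral_val_mul_fderiv (v : H10 Ω) {ψ : E d → ℝ} (hψ : ContDiff ℝ ∞ ψ)
    (hc : HasCompactSupport ψ) (e : E d) :
    ∫ x in Ω, H10.val v x * fderiv ℝ ψ x e = -∫ x in Ω, ⟪H10.grad v x, e⟫ * ψ x := by
  have hdc : Continuous fun x => fderiv ℝ ψ x e :=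
    (hψ.continuous_fderiv (by simp)).clm_apply continuous_const
  have hdcs : HasCompactSupport fun x => fderiv ℝ ψ x e := hc.fderiv_apply (𝕜 := ℝ) e
  have h1 : MemLp (fun x => fderiv ℝ ψ x e) 2 (volume.restrict Ω) :=
    (hdc.memLp_of_hasCompactSupport hdcs).restrict Ω
  have hce : Continuous fun x => ψ x • e := by have := hψ.continuous; fun_prop
  have h2 : MemLp (fun x => ψ x • e) 2 (volume.restrict Ω) :=
    (hce.memLp_of_hasCompactSupport hc.smul_right).restrict Ω
  suffices h : ∀ p : L2Pair Ω, p ∈ H10 Ω → ⟪p.fst, h1.toLp⟫ + ⟪p.snd, h2.toLp⟫ = 0 by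
    have h3 := h v v.2
    rw [L2_inner_eq (Filter.EventuallyEq.refl _ _) h1.coeFn_toLp,
      L2_inner_eq (Filter.EventuallyEq.refl _ _) h2.coeFn_toLp] at h3
    rw [eq_neg_iff_add_eq_zero, ← h3]
    congr 1
    · exact integral_congr_ae (Eventually.of_forall fun x => mul_comm _ _)
    · refine integral_congr_ae (Eventually.of_forall fun x => ?_)
      simp only [inner_smul_right]
      exact mul_comm _ _
  intro p hp
  refine closure_minimal (s := (testPairs Ω : Set (L2Pair Ω)))
    (t := {p : L2Pair Ω | ⟪p.fst, h1.toLp⟫ + ⟪p.snd, h2.toLp⟫ = 0}) ?_ ?_ hp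
  · rintro q ⟨φ, hφ, hφc, hφs, hq1, hq2⟩
    have hout : ∀ x, x ∉ Ω → φ x = 0 := fun x hx => image_eq_zero_of_notMem_tsupport
      fun h => hx (hφs h)
    have hout' : ∀ x, x ∉ Ω → fderiv ℝ φ x e = 0 := fun x hx => by
      rw [image_eq_zero_of_notMem_tsupport fun h => hx (hφs (tsupport_fderiv_subset ℝ h))]; rfl
    have hφd : Continuous fun x => fderiv ℝ φ x e :=
      (hφ.continuous_fderiv (by simp)).clm_apply continuous_const
    have hibp := integral_mul_fderiv_eq_neg_fderiv_mul_of_integrable (μ := volume)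
      (f := φ) (g := ψ) (v := e)
      ((hφd.mul hψ.continuous).integrable_of_hasCompactSupport hc.mul_left)
      ((hφ.continuous.mul hdc).integrable_of_hasCompactSupport hφc.mul_right)
      ((hφ.continuous.mul hψ.continuous).integrable_of_hasCompactSupport hφc.mul_right)
      (fun x _ => hφ.differentiable (by simp) x) (fun x _ => hψ.differentiable (by simp) x)
    have e1 : ⟪q.fst, h1.toLp⟫ = ∫ x, φ x * fderiv ℝ ψ x e := by
      rw [L2_inner_eq hq1 h1.coeFn_toLp, ← setIntegral_eq_integral_of_forall_compl_eq_zero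
        (s := Ω) (f := fun x => φ x * fderiv ℝ ψ x e) (fun x hx => by rw [hout x hx, zero_mul])]
      exact integral_congr_ae (Eventually.of_forall fun x => mul_comm _ _)
    have e2 : ⟪q.snd, h2.toLp⟫ = ∫ x, fderiv ℝ φ x e * ψ x := by
      rw [L2_inner_eq hq2 h2.coeFn_toLp, ← setIntegral_eq_integral_of_forall_compl_eq_zero
        (s := Ω) (f := fun x => fderiv ℝ φ x e * ψ x) (fun x hx => by rw [hout' x hx, zero_mul])]
      refine integral_congr_ae (Eventually.of_forall fun x => ?_)
      simp only [inner_smul_right, inner_gradient_left]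
      exact mul_comm _ _
    rw [mem_ofPred_eq, e1, e2, hibp]; ring
  · refine isClosed_eq ?_ continuous_const
    have c1 : Continuous fun p : L2Pair Ω => p.fst := (WithLp.fstL 2 ℝ (L2 Ω) (L2Vec Ω)).continuous
    have c2 : Continuous fun p : L2Pair Ω => p.snd := (WithLp.sndL 2 ℝ (L2 Ω) (L2Vec Ω)).continuous
    exact (c1.inner continuous_const).add (c2.inner continuous_const)

theorem ae_eq_zero_of_inner_test (hΩ : IsOpen Ω) {h : E d → ℝ}
    (hi : LocallyIntegrableOn h Ω)
    (h0 : ∀ φ : E d → ℝ, ContDiff ℝ ∞ φ → HasCompactSupport φ → tsupport φ ⊆ Ω →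
      ∫ x in Ω, h x * φ x = 0) : h =ᵐ[volume.restrict Ω] 0 := by
  rw [EventuallyEq, ae_restrict_iff' hΩ.measurableSet]
  refine hΩ.ae_eq_zero_of_integral_contDiff_smul_eq_zero hi fun φ hφ hc hs => ?_
  rw [← setIntegral_eq_integral_of_forall_compl_eq_zero (s := Ω) (fun x hx => by
    rw [image_eq_zero_of_notMem_tsupport fun h => hx (hs h), zero_smul]), ← h0 φ hφ hc hs]
  exact integral_congr_ae (Eventually.of_forall fun x => mul_comm _ _)

theorem locallyIntegrableOn_of_memLp {X : Type*} [NormedAddCommGroup X]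
    {h : E d → X} (hh : MemLp h 2 (volume.restrict Ω)) : LocallyIntegrableOn h Ω :=
  locallyIntegrableOn_of_locallyIntegrable_restrict (hh.locallyIntegrable one_le_two)

/-- A function of `H¹₀(Ω)` determines its weak gradient. -/
theorem H10.val_injective (hΩ : IsOpen Ω) : Function.Injective (H10.val (Ω := Ω)) := by
  rw [injective_iff_map_eq_zero]
  intro v hv
  have hg : ∀ e : E d, (fun x => ⟪H10.grad v x, e⟫) =ᵐ[volume.restrict Ω] 0 := by
    intro e
    refine ae_eq_zero_of_inner_test hΩ (locallyIntegrableOn_of_memLp ?_) fun φ hφ hc _ => ?_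
    · exact (Lp.memLp (H10.grad v)).inner_const e
    · have h := H10.integral_val_mul_fderiv v hφ hc e
      rw [eq_comm, neg_eq_iff_eq_neg] at h
      rw [h, neg_eq_zero]
      refine integral_eq_zero_of_ae ?_
      rw [hv]
      filter_upwards [Lp.coeFn_zero ℝ 2 (volume.restrict Ω)] with x hx
      rw [hx, Pi.zero_apply, zero_mul]
  have hg0 : H10.grad v = 0 := by
    refine Lp.ext ?_
    have hall : ∀ᵐ x ∂(volume.restrict Ω), ∀ i, ⟪H10.grad v x, EuclideanSpace.basisFun (Fin d) ℝ i⟫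
        = 0 := ae_all_iff.2 fun i => hg _
    filter_upwards [hall, Lp.coeFn_zero (E d) 2 (volume.restrict Ω)] with x hx h0
    rw [h0, Pi.zero_apply]
    ext i
    simpa [EuclideanSpace.inner_single_right] using hx i
  rw [← inner_self_eq_zero (𝕜 := ℝ), H10.inner_eq, hv, hg0]
  simp

/-- The adjoint of the embedding `H¹₀(Ω) → L₂(Ω)`: it maps `h` to the weak solution `v` of
`v - Δ v = h`, `v = 0` on the boundary. -/
noncomputable def resolventLift (Ω : Set (E d)) : L2 Ω →L[ℝ] H10 Ω := adjoint H10.val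

/-- The resolvent `(1 - Δ)⁻¹` of the Dirichlet Laplacian on `L₂(Ω)`. -/
noncomputable def resolvent (Ω : Set (E d)) : L2 Ω →L[ℝ] L2 Ω := H10.val ∘L adjoint H10.val

theorem val_resolventLift (h : L2 Ω) : H10.val (resolventLift Ω h) = resolvent Ω h := rfl

theorem inner_resolventLift (h : L2 Ω) (v : H10 Ω) : ⟪resolventLift Ω h, v⟫ = ⟪h, H10.val v⟫ :=
  ContinuousLinearMap.adjoint_inner_left _ _ _

theorem inner_resolventLift_right (v : H10 Ω) (h : L2 Ω) :
    ⟪v, resolventLift Ω h⟫ = ⟪H10.val v, h⟫ :=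
  ContinuousLinearMap.adjoint_inner_right _ _ _

theorem isResolvent_resolvent (hΩ : IsOpen Ω) : IsResolvent (resolvent Ω) := by
  have hq : ∀ x : L2 Ω, ⟪resolvent Ω x, x⟫ = ‖resolventLift Ω x‖ ^ 2 := fun x => by
    rw [← val_resolventLift, ← inner_resolventLift_right, real_inner_self_eq_norm_sq]
  have hsymm : ∀ x y, ⟪resolvent Ω x, y⟫ = ⟪x, resolvent Ω y⟫ := fun x y => by
    rw [← val_resolventLift, ← val_resolventLift, ← inner_resolventLift_right, inner_resolventLift]
  refine ⟨IsResolvent.isPositive_iff_forall hsymm fun x => ?_,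
    IsResolvent.isPositive_iff_forall (fun x y => ?_) fun x => ?_, ?_⟩
  · rw [hq]; positivity
  · simp only [sub_apply, one_apply_eq_self, inner_sub_left, inner_sub_right, hsymm]
  · simp only [sub_apply, one_apply_eq_self, inner_sub_left, hq, real_inner_self_eq_norm_sq]
    have h1 : ‖resolventLift Ω x‖ ^ 2 ≤ ‖x‖ * ‖resolventLift Ω x‖ := by
      rw [← real_inner_self_eq_norm_sq, inner_resolventLift]
      exact (real_inner_le_norm _ _).trans (by gcongr; exact H10.norm_val_le _)
    nlinarith [norm_nonneg (resolventLift Ω x), norm_nonneg x,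
      sq_nonneg (‖x‖ - ‖resolventLift Ω x‖)]
  · rw [injective_iff_map_eq_zero]
    intro x hx
    have h1 : resolventLift Ω x = 0 := by
      have := hq x
      rw [hx, inner_zero_left] at this
      exact norm_eq_zero.1 (pow_eq_zero_iff two_ne_zero |>.1 this.symm)
    refine Lp.ext ((ae_eq_zero_of_inner_test hΩ (locallyIntegrableOn_of_memLp (Lp.memLp x))
      fun φ hφ hc hs => ?_).trans (Lp.coeFn_zero ℝ 2 (volume.restrict Ω)).symm)
    obtain ⟨v, hv, -⟩ := H10.exists_of_test hφ hc hs
    have h2 : ⟪x, H10.val v⟫ = 0 := by rw [← inner_resolventLift, h1, inner_zero_left]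
    rw [L2_inner_eq (Filter.EventuallyEq.refl _ _) hv] at h2
    rw [← h2]
    exact integral_congr_ae (Eventually.of_forall fun x => mul_comm _ _)

theorem denseRange_resolventLift (hΩ : IsOpen Ω) : DenseRange (resolventLift Ω) := by
  have h : (LinearMap.range (resolventLift Ω).toLinearMap).topologicalClosure = ⊤ := by
    rw [Submodule.topologicalClosure_eq_top_iff, ContinuousLinearMap.orthogonal_range,
      resolventLift, ContinuousLinearMap.adjoint_adjoint]
    exact LinearMap.ker_eq_bot.mpr (H10.val_injective hΩ)
  intro x
  have hx : x ∈ (LinearMap.range (resolventLift Ω).toLinearMap).topologicalClosure :=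
    h ▸ Submodule.mem_top
  exact hx

end Sobolev

/-! ### Weak solutions are mild solutions -/

section WeakSolution

open scoped RealInnerProductSpace InnerProduct BoundedContinuousFunction

variable {d : ℕ} {Ω : Set (E d)}

/-- Multiplication by the characteristic function of `ω`. -/
noncomputable def restrictTo (Ω : Set (E d)) {ω : Set (E d)} (hω : MeasurableSet ω) :
    L2 Ω →L[ℝ] L2 Ω :=
  LinearMap.mkContinuous
    { toFun := fun g => ((Lp.memLp g).indicator hω).toLp
      map_add' := fun g h => by
        refine Lp.ext ?_
        filter_upwards [((Lp.memLp (g + h)).indicator hω).coeFn_toLp,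
          ((Lp.memLp g).indicator hω).coeFn_toLp, ((Lp.memLp h).indicator hω).coeFn_toLp,
          Lp.coeFn_add (((Lp.memLp g).indicator hω).toLp) (((Lp.memLp h).indicator hω).toLp),
          Lp.coeFn_add g h] with x h1 h2 h3 h4 h5
        rw [h1, h4, Pi.add_apply, h2, h3]
        by_cases hx : x ∈ ω
        · simp only [indicator_of_mem hx, h5, Pi.add_apply]
        · simp only [indicator_of_notMem hx, add_zero]
      map_smul' := fun a g => by
        refine Lp.ext ?_
        filter_upwards [((Lp.memLp (a • g)).indicator hω).coeFn_toLp,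
          ((Lp.memLp g).indicator hω).coeFn_toLp,
          Lp.coeFn_smul a (((Lp.memLp g).indicator hω).toLp), Lp.coeFn_smul a g] with x h1 h2 h3 h4
        rw [h1, RingHom.id_apply, h3, Pi.smul_apply, h2]
        by_cases hx : x ∈ ω
        · simp only [indicator_of_mem hx, h4, Pi.smul_apply]
        · simp only [indicator_of_notMem hx, smul_zero] }
    1 fun g => by
      rw [one_mul]
      refine Lp.norm_le_norm_of_ae_le ?_
      filter_upwards [((Lp.memLp g).indicator hω).coeFn_toLp] with x h1
      exact (congrArg norm h1).trans_le (norm_indicator_le_norm_self _ _)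

theorem coeFn_restrictTo {ω : Set (E d)} (hω : MeasurableSet ω) (g : L2 Ω) :
    restrictTo Ω hω g =ᵐ[volume.restrict Ω] ω.indicator g :=
  ((Lp.memLp g).indicator hω).coeFn_toLp

theorem inner_restrictTo {ω : Set (E d)} (hω : MeasurableSet ω) (g h : L2 Ω) :
    ⟪restrictTo Ω hω g, h⟫ =
      ∫ x in Ω, ω.indicator (fun _ => (1 : ℝ)) x * g x * h x := by
  rw [L2_inner_eq (coeFn_restrictTo hω g) (Filter.EventuallyEq.refl _ _)]
  refine integral_congr_ae (Eventually.of_forall fun x => ?_)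
  by_cases hx : x ∈ ω
  · simp [hx, mul_comm]
  · simp [hx]

/-- The source `χ_ω u` of the evolution equation. -/
noncomputable def source (Ω : Set (E d)) (T : ℝ) {ω : Set (E d)} (hω : MeasurableSet ω) :
    Lp (L2 Ω) 2 (timeMeasure T) →L[ℝ] Lp (L2 Ω) 2 (timeMeasure T) :=
  (restrictTo Ω hω).compLpL 2 (timeMeasure T)

theorem inner_source {T : ℝ} {ω : Set (E d)} (hω : MeasurableSet ω)
    (u : Lp (L2 Ω) 2 (timeMeasure T)) : ∀ᵐ t ∂(timeMeasure T), ∀ h : L2 Ω,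
      ⟪source Ω T hω u t, h⟫ = ∫ x in Ω, ω.indicator (fun _ => (1 : ℝ)) x * u t x * h x := by
  filter_upwards [(restrictTo Ω hω).coeFn_compLpL u] with t ht h
  have ht' : source Ω T hω u t = restrictTo Ω hω (u t) := ht
  rw [ht', inner_restrictTo]

theorem integrable_test_smul {X : Type*} [NormedAddCommGroup X] [NormedSpace ℝ X] {T : ℝ}
    {φ : ℝ → ℝ} (hφ : Continuous φ) (hc : HasCompactSupport φ) {F : ℝ → X}
    (hF : Integrable F (timeMeasure T)) : Integrable (fun t => φ t • F t) (timeMeasure T) :=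
  hF.smul_of_top_right (hφ.memLp_of_hasCompactSupport hc)

/-- The right hand side `G F - (w - G w)` of the evolution equation for `G w`. -/
theorem integrable_rhs {H : Type*} [NormedAddCommGroup H] [InnerProductSpace ℝ H] [CompleteSpace H]
    (G : H →L[ℝ] H) {T : ℝ} (F : Lp H 2 (timeMeasure T)) {w : ℝ → H}
    (hw : Integrable w (timeMeasure T)) :
    Integrable (fun t => G (F t) - (w t - G (w t))) (timeMeasure T) :=
  (G.integrable_comp (integrable_of_L2 F)).sub (hw.sub (G.integrable_comp hw))

theorem intervalIntegrable_of_integrable {X : Type*} [NormedAddCommGroup X] {T t : ℝ} {g : ℝ → X}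
    (hg : Integrable g (timeMeasure T)) (ht : t ∈ Icc 0 T) : IntervalIntegrable g volume 0 t :=
  (intervalIntegrable_iff_integrableOn_Ioc_of_le ht.1).2 (IntegrableOn.mono_set_ae hg
    (Ioo_ae_eq_Ioc.symm.le.trans (Ioo_subset_Ioo_right ht.2).eventuallyLE))

theorem inner_primitive {H : Type*} [NormedAddCommGroup H] [InnerProductSpace ℝ H] [CompleteSpace H]
    {T t : ℝ} {g : ℝ → H} (hg : Integrable g (timeMeasure T)) (ht : t ∈ Icc 0 T) (x : H) :
    ⟪∫ s in (0 : ℝ)..t, g s, x⟫ = ∫ s in (0 : ℝ)..t, ⟪g s, x⟫ := by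
  have h := ContinuousLinearMap.intervalIntegral_comp_comm (innerSL ℝ x)
    (intervalIntegrable_of_integrable hg ht)
  simp only [innerSL_apply_apply] at h
  rw [real_inner_comm, ← h]
  simp only [real_inner_comm]

section Dual

variable {H V : Type*} [NormedAddCommGroup H] [InnerProductSpace ℝ H]
  [NormedAddCommGroup V] [InnerProductSpace ℝ V] {T : ℝ} {φ : ℝ → ℝ}

theorem integral_test_smul_apply (hφ : Continuous φ) (hc : HasCompactSupport φ)
    (y' : Lp (StrongDual ℝ V) 2 (timeMeasure T)) (v : V) :
    (∫ t in Ioo 0 T, φ t • y' t) v = ∫ t in Ioo 0 T, φ t * y' t v :=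
  ContinuousLinearMap.integral_apply (integrable_test_smul hφ hc (integrable_of_L2 y')) v

theorem integral_test_smul_map_apply (hφ : Continuous φ) (hc : HasCompactSupport φ)
    (L : V →L[ℝ] StrongDual ℝ V) (y : Lp V 2 (timeMeasure T)) (v : V) :
    (∫ t in Ioo 0 T, φ t • L (y t)) v = ∫ t in Ioo 0 T, φ t * L (y t) v :=
  ContinuousLinearMap.integral_apply
    (integrable_test_smul hφ hc (L.integrable_comp (integrable_of_L2 y))) v

theorem strongDual_ext_of_denseRange {J : H → V} (hJ : DenseRange J) {l l' : StrongDual ℝ V}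
    (h : ∀ x, l (J x) = l' (J x)) : l = l' :=
  DFunLike.coe_injective (hJ.equalizer l.continuous l'.continuous (funext h))

/-- The functional `v ↦ (F t, ι v) - (y t, v) + b (y t) v`, as an element of `L₂(0,T;V')`. -/
theorem exists_dual_L2 (ι : V →L[ℝ] H) (b : V →L[ℝ] StrongDual ℝ V)
    (F : Lp H 2 (timeMeasure T)) (y : Lp V 2 (timeMeasure T)) :
    ∃ y' : Lp (StrongDual ℝ V) 2 (timeMeasure T), ∀ᵐ t ∂(timeMeasure T), ∀ v,
      y' t v = ⟪F t, ι v⟫ - (⟪y t, v⟫ - b (y t) v) := by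
  let B : H →L[ℝ] StrongDual ℝ V :=
    (innerSL ℝ : H →L[ℝ] H →L[ℝ] ℝ).bilinearComp (ContinuousLinearMap.id ℝ _) ι
  let I : V →L[ℝ] StrongDual ℝ V := innerSL ℝ
  let A : V →L[ℝ] StrongDual ℝ V := I - b
  refine ⟨B.compLpL 2 (timeMeasure T) F - A.compLpL 2 (timeMeasure T) y, ?_⟩
  filter_upwards [Lp.coeFn_sub (B.compLpL 2 (timeMeasure T) F) (A.compLpL 2 (timeMeasure T) y),
    B.coeFn_compLpL F, A.coeFn_compLpL y] with t h1 h2 h3 v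
  rw [h1, Pi.sub_apply, h2, h3]
  rfl

/-- The mild solution solves the evolution equation in the dual of `V`. -/
theorem ResolventSemigroup.exists_weak_solution [CompleteSpace H] [CompleteSpace V] {G : H →L[ℝ] H}
    (S : ResolventSemigroup G) (hG : IsResolvent G) {ι : V →L[ℝ] H} (hι : G = ι ∘L ι.adjoint)
    (hJ : DenseRange ι.adjoint) {b : V →L[ℝ] StrongDual ℝ V} (hb : ∀ v v', b v v' = ⟪ι v, ι v'⟫)
    (hT : 0 < T) (f : H) (F : Lp H 2 (timeMeasure T)) :
    ∃ (y : Lp V 2 (timeMeasure T)) (y' : Lp (StrongDual ℝ V) 2 (timeMeasure T)),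
      (∀ᵐ t ∂(timeMeasure T), ι (y t) = S.mild T (f, F) t) ∧
      (∀ᵐ t ∂(timeMeasure T), ∀ v, y' t v = ⟪F t, ι v⟫ - (⟪y t, v⟫ - b (y t) v)) ∧
      ∀ φ : ℝ → ℝ, ContDiff ℝ (⊤ : ℕ∞) φ → HasCompactSupport φ → tsupport φ ⊆ Ioo 0 T →
        ∫ t in Ioo 0 T, deriv φ t • b (y t) = - ∫ t in Ioo 0 T, φ t • y' t := by
  obtain ⟨Y, hY⟩ := S.exists_lift hι hG hT.le
  have hιJ : ∀ x, ι (ι.adjoint x) = G x := fun x => by rw [hι]; rfl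
  obtain ⟨w, hw⟩ : ∃ w, w = S.mild T (f, F) := ⟨_, rfl⟩
  obtain ⟨y, hy⟩ : ∃ y, y = Y (f, F) := ⟨_, rfl⟩
  have hyw : ∀ᵐ t ∂(timeMeasure T), ι (y t) = w t := by
    filter_upwards [ι.coeFn_compLpL y, coeFn_toL2 T w] with t h1 h2
    rw [← h2, hw, ← hY, ← hy, h1]
  obtain ⟨y', hy't⟩ := exists_dual_L2 ι b F y
  refine ⟨y, y', hw ▸ hyw, hy't, fun φ hφ hc hs => ?_⟩
  have hwi : Integrable w (timeMeasure T) :=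
    (integrable_of_L2 (toL2 H T w)).congr (coeFn_toL2 T w)
  have hg := integrable_rhs G F hwi
  refine strongDual_ext_of_denseRange hJ fun x => ?_
  rw [neg_apply, integral_test_smul_map_apply (hφ.continuous_deriv (by simp)) hc.deriv,
    integral_test_smul_apply hφ.continuous hc]
  have hgx : Integrable (fun t => ⟪G (F t) - (w t - G (w t)), x⟫) (timeMeasure T) :=
    hg.inner_const x
  have hibp := integral_deriv_mul_primitive hφ hs hgx ⟪G f, x⟫
  have hsymm := hG.inner_left
  have e1 : ∫ t in Ioo 0 T, deriv φ t * b (y t) (ι.adjoint x) =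
      ∫ t in Ioo 0 T, deriv φ t * (⟪G f, x⟫ +
        ∫ s in (0 : ℝ)..t, ⟪G (F s) - (w s - G (w s)), x⟫) := by
    refine integral_congr_ae ?_
    filter_upwards [hyw, ae_restrict_mem measurableSet_Ioo] with t h1 h2
    have h3 : t ∈ Icc 0 T := Ioo_subset_Icc_self h2
    have h4 := S.map_mild (f := f) (F := F) h3.1 h3.2
    rw [← hw] at h4
    rw [hb, h1, hιJ, ← inner_primitive hg h3, ← inner_add_left, ← h4, hsymm]
  have e2 : ∫ t in Ioo 0 T, φ t * y' t (ι.adjoint x) =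
      ∫ t in Ioo 0 T, φ t * ⟪G (F t) - (w t - G (w t)), x⟫ := by
    refine integral_congr_ae ?_
    filter_upwards [hy't, hyw] with t h1 h2
    rw [h1, hb, hιJ, ι.adjoint_inner_right, h2, inner_sub_left, inner_sub_left, hsymm, hsymm]
  rw [e1, e2, hibp]

/-- A continuous weak solution of the evolution equation is the mild solution. -/
theorem ResolventSemigroup.eq_mild_of_weak [CompleteSpace H] {G : H →L[ℝ] H}
    (S : ResolventSemigroup G) (hG : IsResolvent G) (hT : 0 < T) {F : Lp H 2 (timeMeasure T)}
    {w : ℝ → H} (hwc : ContinuousOn w (Icc 0 T))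
    (hw : ∀ φ : ℝ → ℝ, ContDiff ℝ (⊤ : ℕ∞) φ → HasCompactSupport φ → tsupport φ ⊆ Ioo 0 T → ∀ x,
      ∫ t in Ioo 0 T, deriv φ t * ⟪G (w t), x⟫ =
        -∫ t in Ioo 0 T, φ t * ⟪G (F t) - (w t - G (w t)), x⟫) :
    ∀ t ∈ Icc 0 T, w t = S.mild T (w 0, F) t := by
  have hwi : Integrable w (timeMeasure T) := hwc.integrableOn_Icc.mono_set Ioo_subset_Icc_self
  have hg := integrable_rhs G F hwi
  have hevol : ∀ t ∈ Icc 0 T, G (w t) = G (w 0) +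
      ∫ s in (0 : ℝ)..t, (G (F s) - (w s - G (w s))) := by
    intro t ht
    refine ext_inner_right ℝ fun x => ?_
    have hgx : Integrable (fun t => ⟪G (F t) - (w t - G (w t)), x⟫)
        (timeMeasure T) := hg.inner_const x
    have hwx : ContinuousOn (fun t => ⟪G (w t), x⟫) (Icc 0 T) :=
      ContinuousOn.inner (𝕜 := ℝ) (G.continuous.comp_continuousOn hwc) continuousOn_const
    have hprim : ContinuousOn (fun t => ∫ s in (0 : ℝ)..t,
        ⟪G (F s) - (w s - G (w s)), x⟫) (Icc 0 T) := by
      have := intervalIntegral.continuousOn_primitive_interval'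
        (intervalIntegrable_of_integrable hgx ⟨hT.le, le_rfl⟩) left_mem_uIcc
      rwa [uIcc_of_le hT.le] at this
    have hconst := eq_of_integral_deriv_mul_eq_zero hT (hwx.sub hprim) (fun φ hφ hc hs => ?_) t ht
    · simp only [Pi.sub_apply, intervalIntegral.integral_same, sub_zero] at hconst
      rw [inner_add_left, inner_primitive hg ht]
      linarith
    · have hφd : Continuous (deriv φ) := hφ.continuous_deriv (by simp)
      have h1 := hw φ hφ hc hs x
      have h2 := integral_deriv_mul_primitive hφ hs hgx 0
      simp only [zero_add] at h2
      rw [← h2] at h1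
      have j1 : IntegrableOn (fun t => deriv φ t * ⟪G (w t), x⟫) (Ioo 0 T) :=
        (hφd.continuousOn.mul hwx).integrableOn_Icc.mono_set Ioo_subset_Icc_self
      have j2 : IntegrableOn (fun t => deriv φ t * ∫ s in (0 : ℝ)..t,
          ⟪G (F s) - (w s - G (w s)), x⟫) (Ioo 0 T) :=
        (hφd.continuousOn.mul hprim).integrableOn_Icc.mono_set Ioo_subset_Icc_self
      simp only [Pi.sub_apply, mul_sub]
      rw [integral_sub j1 j2, h1, sub_self]
  obtain ⟨m, hm⟩ : ∃ m, m = S.mild T (w 0, F) := ⟨_, rfl⟩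
  have hmi : Integrable m (timeMeasure T) :=
    (integrable_of_L2 (toL2 H T m)).congr (coeFn_toL2 T m)
  have hgm := integrable_rhs G F hmi
  have hzero := hG.eq_zero_of_evolution (T := T)
    (w := fun t => w t - m t) (hwc.sub m.continuous.continuousOn) (fun t ht => by
      have h4 := S.map_mild (f := w 0) (F := F) ht.1 ht.2
      rw [← hm] at h4
      rw [map_sub, hevol t ht, h4, add_sub_add_left_eq_sub,
        ← intervalIntegral.integral_sub (intervalIntegrable_of_integrable hg ht)
          (intervalIntegrable_of_integrable hgm ht), ← intervalIntegral.integral_neg]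
      refine intervalIntegral.integral_congr fun s _ => ?_
      simp only [map_sub]
      abel)
  intro t ht
  rw [← hm]
  exact sub_eq_zero.1 (hzero t ht)

end Dual

theorem exists_isWeakSolution (hΩ : IsOpen Ω) (S : ResolventSemigroup (resolvent Ω)) {T : ℝ}
    (hT : 0 < T) {ω : Set (E d)} (hω : MeasurableSet ω) (u : Lp (L2 Ω) 2 (timeMeasure T))
    (f : H10 Ω) : ∃ y, IsWeakSolution Ω T ω u f y := by
  obtain ⟨y, y', hyw, hy', hφ⟩ := S.exists_weak_solution (isResolvent_resolvent hΩ) (ι := H10.val)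
    rfl (denseRange_resolventLift hΩ) (b := toHneg1) toHneg1_apply hT (H10.val f)
    (source Ω T hω u)
  refine ⟨y, y', hφ, fun φ => ?_, S.mild T (H10.val f, source Ω T hω u),
    (S.mild T _).continuous.continuousOn, hyw.mono fun t ht => ht.symm, S.mild_zero _ _⟩
  filter_upwards [hy', inner_source hω u] with t h1 h2
  rw [h1, ← h2, H10.inner_eq, toHneg1_apply]
  ring

theorem val_eq_of_isWeakSolution (hΩ : IsOpen Ω) (S : ResolventSemigroup (resolvent Ω)) {T : ℝ}
    (hT : 0 < T) {ω : Set (E d)} (hω : MeasurableSet ω) {u : Lp (L2 Ω) 2 (timeMeasure T)}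
    {f : H10 Ω} {y : Lp (H10 Ω) 2 (timeMeasure T)} (hsol : IsWeakSolution Ω T ω u f y) :
    H10.val.compLpL 2 (timeMeasure T) y =
      toL2 (L2 Ω) T (S.mild T (H10.val f, source Ω T hω u)) := by
  obtain ⟨y', hyy', heq, w, hwc, hwy, hw0⟩ := hsol
  have hsymm := (isResolvent_resolvent hΩ).inner_left
  have hmild := S.eq_mild_of_weak (isResolvent_resolvent hΩ) hT (F := source Ω T hω u) hwc
    (fun φ hφ hc hs x => ?_)
  · refine Lp.ext ?_
    filter_upwards [H10.val.coeFn_compLpL y, coeFn_toL2 T (S.mild T (H10.val f, source Ω T hω u)),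
      hwy, ae_restrict_mem measurableSet_Ioo] with t h1 h2 h3 h4
    rw [h1, h2, ← h3, hmild t (Ioo_subset_Icc_self h4), hw0]
  · have h1 : (∫ t in Ioo 0 T, deriv φ t • toHneg1 (y t)) (resolventLift Ω x) =
        (-∫ t in Ioo 0 T, φ t • y' t) (resolventLift Ω x) :=
      DFunLike.congr_fun (hyy' φ hφ hc hs) _
    rw [neg_apply, integral_test_smul_map_apply (hφ.continuous_deriv (by simp)) hc.deriv,
      integral_test_smul_apply hφ.continuous hc] at h1
    have e1 : ∫ t in Ioo 0 T, deriv φ t * toHneg1 (y t) (resolventLift Ω x) =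
        ∫ t in Ioo 0 T, deriv φ t * ⟪resolvent Ω (w t), x⟫ := by
      refine integral_congr_ae ?_
      filter_upwards [hwy] with t h1
      rw [toHneg1_apply, ← h1, val_resolventLift, hsymm]
    have e2 : ∫ t in Ioo 0 T, φ t * y' t (resolventLift Ω x) =
        ∫ t in Ioo 0 T, φ t *
          ⟪resolvent Ω (source Ω T hω u t) - (w t - resolvent Ω (w t)), x⟫ := by
      refine integral_congr_ae ?_
      filter_upwards [heq (resolventLift Ω x), hwy, inner_source hω u] with t h1 h2 h3
      have h4 := H10.inner_eq (y t) (resolventLift Ω x)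
      rw [inner_resolventLift_right, val_resolventLift, ← h2] at h4
      rw [← h3, val_resolventLift] at h1
      rw [inner_sub_left, inner_sub_left, hsymm, hsymm]
      congr 1
      linarith
    rw [← e1, ← e2, h1]

end WeakSolution

/-! ### The reduced optimal control problem -/

section Tikhonov

variable {X Y : Type*} [NormedAddCommGroup X] [InnerProductSpace ℝ X]
  [NormedAddCommGroup Y] [InnerProductSpace ℝ Y]

/-- The Tikhonov functional `u ↦ ‖b + Q u‖² + γ ‖u‖²`. -/
def tikhonov (Q : X →L[ℝ] Y) (b : Y) (γ : ℝ) (u : X) : ℝ := ‖b + Q u‖ ^ 2 + γ * ‖u‖ ^ 2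

variable (Q : X →L[ℝ] Y) (b : Y) {γ : ℝ}

theorem continuous_tikhonov : Continuous (tikhonov Q b γ) := by
  unfold tikhonov
  fun_prop

theorem tikhonov_nonneg (hγ : 0 < γ) (u : X) : 0 ≤ tikhonov Q b γ u := by
  unfold tikhonov
  positivity

theorem tikhonov_midpoint_le (u v : X) :
    tikhonov Q b γ (midpoint ℝ u v) + γ / 4 * ‖u - v‖ ^ 2 ≤
      (tikhonov Q b γ u + tikhonov Q b γ v) / 2 := by
  have h1 : b + Q (midpoint ℝ u v) = (2⁻¹ : ℝ) • ((b + Q u) + (b + Q v)) := by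
    rw [midpoint_eq_smul_add, map_smul, map_add]
    simp only [invOf_eq_inv]
    module
  have h2 := parallelogram_law_with_norm ℝ (b + Q u) (b + Q v)
  have h3 := parallelogram_law_with_norm ℝ u v
  unfold tikhonov
  rw [h1, midpoint_eq_smul_add, invOf_eq_inv, norm_smul, norm_smul, Real.norm_of_nonneg (by simp)]
  linarith [congrArg (γ * ·) h3, sq_nonneg ‖b + Q u - (b + Q v)‖]

/-- Quadratic growth of the Tikhonov functional away from its minimiser. -/
theorem sq_norm_sub_le_tikhonov_sub {K : Set X} (hK : Convex ℝ K) {u₀ : X} (h₀ : u₀ ∈ K)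
    (hmin : ∀ v ∈ K, tikhonov Q b γ u₀ ≤ tikhonov Q b γ v) {u : X} (hu : u ∈ K) :
    γ / 2 * ‖u - u₀‖ ^ 2 ≤ tikhonov Q b γ u - tikhonov Q b γ u₀ := by
  have h1 := tikhonov_midpoint_le Q b (γ := γ) u u₀
  have h2 := hmin _ (hK.midpoint_mem hu h₀)
  linarith

theorem exists_isMinOn_tikhonov [CompleteSpace X] (hγ : 0 < γ) {K : Set X} (hK : Convex ℝ K)
    (hKc : IsClosed K) (hne : K.Nonempty) :
    ∃ u₀ ∈ K, ∀ v ∈ K, tikhonov Q b γ u₀ ≤ tikhonov Q b γ v := by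
  obtain ⟨m, hm⟩ : ∃ m, m = sInf (tikhonov Q b γ '' K) := ⟨_, rfl⟩
  have hbdd : BddBelow (tikhonov Q b γ '' K) :=
    ⟨0, by rintro _ ⟨u, _, rfl⟩; exact tikhonov_nonneg Q b hγ u⟩
  have hmle : ∀ v ∈ K, m ≤ tikhonov Q b γ v := fun v hv =>
    hm ▸ csInf_le hbdd (mem_image_of_mem _ hv)
  have hex : ∀ n : ℕ, ∃ u ∈ K, tikhonov Q b γ u < m + 1 / ((n : ℝ) + 1) := fun n => by
    have : sInf (tikhonov Q b γ '' K) < m + 1 / ((n : ℝ) + 1) := by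
      rw [← hm]; linarith [Nat.one_div_pos_of_nat (α := ℝ) (n := n)]
    obtain ⟨_, ⟨u, hu, rfl⟩, h⟩ := exists_lt_of_csInf_lt (hne.image _) this
    exact ⟨u, hu, h⟩
  choose u huK hu using hex
  have hdist : ∀ N n k : ℕ, N ≤ n → N ≤ k → dist (u n) (u k) ≤ √(4 / γ * (1 / ((N : ℝ) + 1))) := by
    intro N n k hn hk
    have h1 := tikhonov_midpoint_le Q b (γ := γ) (u n) (u k)
    have h2 := hmle _ (hK.midpoint_mem (huK n) (huK k))
    have h3 : 1 / ((n : ℝ) + 1) ≤ 1 / ((N : ℝ) + 1) := Nat.one_div_le_one_div hn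
    have h4 : 1 / ((k : ℝ) + 1) ≤ 1 / ((N : ℝ) + 1) := Nat.one_div_le_one_div hk
    rw [dist_eq_norm]
    refine Real.le_sqrt_of_sq_le ?_
    have h5 : γ / 4 * ‖u n - u k‖ ^ 2 ≤ 1 / ((N : ℝ) + 1) := by linarith [hu n, hu k]
    calc ‖u n - u k‖ ^ 2 = 4 / γ * (γ / 4 * ‖u n - u k‖ ^ 2) := by field_simp
      _ ≤ _ := by gcongr
  have hlim : Tendsto (fun N : ℕ => √(4 / γ * (1 / ((N : ℝ) + 1)))) atTop (𝓝 0) := by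
    have h := (tendsto_one_div_add_atTop_nhds_zero_nat (𝕜 := ℝ)).const_mul (4 / γ)
    rw [mul_zero] at h
    have h' := (Real.continuous_sqrt.tendsto 0).comp h
    rwa [Real.sqrt_zero] at h'
  have hcau : CauchySeq u := cauchySeq_of_le_tendsto_0 _ (fun n k N hn hk => hdist N n k hn hk) hlim
  obtain ⟨u₀, hu₀⟩ := cauchySeq_tendsto_of_complete hcau
  have hle : tikhonov Q b γ u₀ ≤ m := by
    have h1 := ((continuous_tikhonov Q b (γ := γ)).tendsto u₀).comp hu₀
    have h2 := (tendsto_one_div_add_atTop_nhds_zero_nat (𝕜 := ℝ)).const_add m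
    rw [add_zero] at h2
    exact le_of_tendsto_of_tendsto' h1 h2 fun n => (hu n).le
  exact ⟨u₀, hKc.mem_of_tendsto hu₀ (Eventually.of_forall huK), fun v hv => hle.trans (hmle v hv)⟩

end Tikhonov

section Controls

variable {d : ℕ} {Ω : Set (E d)} {T : ℝ} {U : Set (L2 Ω)}

theorem zero_mem_controls (h0 : (0 : L2 Ω) ∈ U) :
    (0 : Lp (L2 Ω) 2 (timeMeasure T)) ∈ controls T U := by
  filter_upwards [Lp.coeFn_zero (L2 Ω) 2 (timeMeasure T)] with t ht
  rw [ht]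
  exact h0

theorem neg_mem_controls (hneg : ∀ v ∈ U, -v ∈ U) {u : Lp (L2 Ω) 2 (timeMeasure T)}
    (hu : u ∈ controls T U) : -u ∈ controls T U := by
  filter_upwards [hu, Lp.coeFn_neg u] with t h1 h2
  rw [h2]
  exact hneg _ h1

theorem convex_controls (hU : Convex ℝ U) :
    Convex ℝ (controls T U : Set (Lp (L2 Ω) 2 (timeMeasure T))) := by
  intro u hu v hv a c ha hc hac
  filter_upwards [hu, hv, Lp.coeFn_add (a • u) (c • v), Lp.coeFn_smul a u, Lp.coeFn_smul c v]
    with t h1 h2 h3 h4 h5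
  rw [h3, Pi.add_apply, h4, h5]
  exact hU h1 h2 ha hc hac

theorem isClosed_controls (hU : IsClosed U) :
    IsClosed (controls T U : Set (Lp (L2 Ω) 2 (timeMeasure T))) := by
  refine isClosed_of_closure_subset fun u hu => ?_
  obtain ⟨v, hv, hlim⟩ := mem_closure_iff_seq_limit.1 hu
  obtain ⟨k, -, hk⟩ := (tendstoInMeasure_of_tendsto_Lp hlim).exists_seq_tendsto_ae
  filter_upwards [hk, ae_all_iff.2 fun n => hv n] with t h1 h2
  exact hU.mem_of_tendsto h1 (Eventually.of_forall fun n => h2 (k n))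

end Controls

section Reduced

variable {d : ℕ} {Ω : Set (E d)}

/-- The states `y^{u,0,ω}` as a function of the control `u`. -/
noncomputable def controlToState (S : ResolventSemigroup (resolvent Ω)) (T : ℝ) {ω : Set (E d)}
    (hω : MeasurableSet ω) : Lp (L2 Ω) 2 (timeMeasure T) →L[ℝ] Lp (L2 Ω) 2 (timeMeasure T) :=
  (toL2 (L2 Ω) T).comp ((S.mild T).comp
    ((ContinuousLinearMap.inr ℝ (L2 Ω) (Lp (L2 Ω) 2 (timeMeasure T))).comp (source Ω T hω)))

/-- The uncontrolled state `y^{0,f,ω}`. -/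
noncomputable def freeState (S : ResolventSemigroup (resolvent Ω)) (T : ℝ) (f : H10 Ω) :
    Lp (L2 Ω) 2 (timeMeasure T) :=
  toL2 (L2 Ω) T (S.mild T (H10.val f, 0))

/-- The cost `J(ω,u,f)`. -/
noncomputable def reducedCost (S : ResolventSemigroup (resolvent Ω)) (T γ : ℝ) {ω : Set (E d)}
    (hω : MeasurableSet ω) (f : H10 Ω) : Lp (L2 Ω) 2 (timeMeasure T) → ℝ :=
  tikhonov (controlToState S T hω) (freeState S T f) γ

theorem freeState_add_controlToState (S : ResolventSemigroup (resolvent Ω)) (T : ℝ)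
    {ω : Set (E d)} (hω : MeasurableSet ω) (f : H10 Ω) (u : Lp (L2 Ω) 2 (timeMeasure T)) :
    freeState S T f + controlToState S T hω u =
      toL2 (L2 Ω) T (S.mild T (H10.val f, source Ω T hω u)) := by
  have h : ((H10.val f, source Ω T hω u) : L2 Ω × Lp (L2 Ω) 2 (timeMeasure T)) =
      (H10.val f, 0) + (0, source Ω T hω u) := by simp
  rw [h, map_add, map_add]
  rfl

theorem cost_eq_reducedCost (hΩ : IsOpen Ω) (S : ResolventSemigroup (resolvent Ω)) {T : ℝ}
    (hT : 0 < T) (γ : ℝ) {ω : Set (E d)} (hω : MeasurableSet ω) {u : Lp (L2 Ω) 2 (timeMeasure T)}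
    {f : H10 Ω} {y : Lp (H10 Ω) 2 (timeMeasure T)} (hy : IsWeakSolution Ω T ω u f y) :
    cost γ y u = reducedCost S T γ hω f u := by
  have hval := val_eq_of_isWeakSolution hΩ S hT hω hy
  unfold reducedCost tikhonov cost
  rw [freeState_add_controlToState, ← hval, norm_sq_L2_eq, norm_sq_L2_eq, ← integral_const_mul,
    ← integral_add]
  · refine integral_congr_ae ?_
    filter_upwards [H10.val.coeFn_compLpL (p := 2) y] with t ht
    rw [ht]
  · exact (Lp.memLp (H10.val.compLpL 2 (timeMeasure T) y)).integrable_norm_pow two_ne_zero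
  · exact ((Lp.memLp u).integrable_norm_pow two_ne_zero).const_mul γ

theorem J1_eq (hΩ : IsOpen Ω) (S : ResolventSemigroup (resolvent Ω)) {T : ℝ}
    (hT : 0 < T) (γ : ℝ) (U : Set (L2 Ω)) {ω : Set (E d)} (hω : MeasurableSet ω) (f : H10 Ω) :
    J1 Ω T γ U ω f = sInf (reducedCost S T γ hω f '' controls T U) := by
  unfold J1
  congr 1
  ext c
  constructor
  · rintro ⟨u, hu, y, hy, rfl⟩
    exact ⟨u, hu, (cost_eq_reducedCost hΩ S hT γ hω hy).symm⟩
  · rintro ⟨u, hu, rfl⟩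
    obtain ⟨y, hy⟩ := exists_isWeakSolution hΩ S hT hω u f
    exact ⟨u, hu, y, hy, (cost_eq_reducedCost hΩ S hT γ hω hy).symm⟩

theorem J1_neg (hΩ : IsOpen Ω) {T : ℝ} (hT : 0 < T) (γ : ℝ) {U : Set (L2 Ω)}
    (hneg : ∀ v ∈ U, -v ∈ U) {ω : Set (E d)} (hω : MeasurableSet ω) (f : H10 Ω) :
    J1 Ω T γ U ω (-f) = J1 Ω T γ U ω f := by
  obtain ⟨S⟩ := (isResolvent_resolvent hΩ).nonempty_semigroup
  have hcost : ∀ u, reducedCost S T γ hω (-f) (-u) = reducedCost S T γ hω f u := fun u => by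
    have h : ((H10.val (-f), (0 : Lp (L2 Ω) 2 (timeMeasure T)))) = -(H10.val f, 0) := by simp
    unfold reducedCost tikhonov freeState
    rw [h, map_neg, map_neg, map_neg, ← neg_add, norm_neg, norm_neg]
  rw [J1_eq hΩ S hT γ U hω, J1_eq hΩ S hT γ U hω]
  congr 1
  ext c
  constructor
  · rintro ⟨u, hu, rfl⟩
    exact ⟨-u, neg_mem_controls hneg hu, by rw [← hcost, neg_neg]⟩
  · rintro ⟨u, hu, rfl⟩
    exact ⟨-u, neg_mem_controls hneg hu, hcost u⟩

/-- The optimal control exists, and the cost grows quadratically away from it. -/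
theorem exists_isOptimalControl (hΩ : IsOpen Ω) (S : ResolventSemigroup (resolvent Ω)) {T γ : ℝ}
    (hT : 0 < T) (hγ : 0 < γ) {U : Set (L2 Ω)} (hUc : IsClosed U) (hU : Convex ℝ U)
    (hU0 : (0 : L2 Ω) ∈ U) {ω : Set (E d)} (hω : MeasurableSet ω) (f : H10 Ω) :
    ∃ u, IsOptimalControl Ω T γ U ω f u ∧ J1 Ω T γ U ω f = reducedCost S T γ hω f u ∧
      ∀ v ∈ controls T U, γ / 2 * ‖v - u‖ ^ 2 ≤ reducedCost S T γ hω f v - reducedCost S T γ hω f u := by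
  obtain ⟨u, hu, hmin⟩ := exists_isMinOn_tikhonov (controlToState S T hω) (freeState S T f) hγ
    (convex_controls hU) (isClosed_controls hUc) ⟨0, zero_mem_controls (T := T) hU0⟩
  have hJ : J1 Ω T γ U ω f = reducedCost S T γ hω f u := by
    rw [J1_eq hΩ S hT γ U hω]
    exact IsLeast.csInf_eq ⟨mem_image_of_mem _ hu, by rintro _ ⟨v, hv, rfl⟩; exact hmin v hv⟩
  obtain ⟨y, hy⟩ := exists_isWeakSolution hΩ S hT hω u f
  exact ⟨u, ⟨hu, y, hy, (cost_eq_reducedCost hΩ S hT γ hω hy).trans hJ.symm⟩, hJ, fun v hv =>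
    sq_norm_sub_le_tikhonov_sub _ _ (convex_controls hU) hu hmin hv⟩

end Reduced

/-! ### Sobolev embedding: `L₂` functions with `L₂` Laplacian are continuous in dimension `≤ 3` -/

section Embedding

open TemperedDistribution FourierTransform
open scoped SchwartzMap LineDeriv Laplacian ENNReal

variable {d : ℕ}

theorem memSobolev_two_of_laplacian {w g : Lp ℂ 2 (volume : Measure (E d))}
    (h : Δ (w : 𝓢'(E d, ℂ)) = (g : 𝓢'(E d, ℂ))) : MemSobolev 2 2 (w : 𝓢'(E d, ℂ)) := by
  have h1 : besselPotential (E d) ℂ 2 (w : 𝓢'(E d, ℂ)) =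
      (w : 𝓢'(E d, ℂ)) - (((2 * Real.pi) ^ 2)⁻¹ : ℝ) • (g : 𝓢'(E d, ℂ)) := by
    have hsq : (fun x : E d => ((‖x‖ ^ 2 : ℝ) : ℂ)).HasTemperateGrowth := by fun_prop
    have h2 := laplacian_eq_fourierMultiplierCLM (w : 𝓢'(E d, ℂ))
    rw [h] at h2
    have h3 : besselPotential (E d) ℂ 2 (w : 𝓢'(E d, ℂ)) = (w : 𝓢'(E d, ℂ)) +
        fourierMultiplierCLM ℂ (fun x : E d => ((‖x‖ ^ 2 : ℝ) : ℂ)) (w : 𝓢'(E d, ℂ)) := by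
      have h4 := smulLeftCLM_add (F := ℂ) (g₁ := fun _ : E d => (1 : ℂ))
        (Function.HasTemperateGrowth.const 1) hsq
      have h5 : (fun x : E d => (((1 + ‖x‖ ^ 2) ^ ((2 : ℝ) / 2) : ℝ) : ℂ)) =
          (fun _ : E d => (1 : ℂ)) + fun x : E d => ((‖x‖ ^ 2 : ℝ) : ℂ) := by
        ext x
        simp
      rw [besselPotential, fourierMultiplierCLM_apply, fourierMultiplierCLM_apply, h5, h4,
        add_apply, smulLeftCLM_const, one_smul, fourierInv_add, fourierInv_fourier_eq]
    have hpi : ((2 * Real.pi) ^ 2 : ℝ) ≠ 0 := by positivity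
    rw [h2, h3, smul_smul, mul_neg, inv_mul_cancel₀ hpi, neg_one_smul, sub_neg_eq_add]
  refine ⟨w - ((((2 * Real.pi) ^ 2)⁻¹ : ℝ) : ℂ) • g, ?_⟩
  rw [h1, ← Lp.toTemperedDistributionCLM_apply, ← Lp.toTemperedDistributionCLM_apply,
    ← Lp.toTemperedDistributionCLM_apply, map_sub, map_smul, Complex.coe_smul]

/-- A tempered distribution whose Fourier transform is integrable is a continuous function. -/
theorem exists_continuous_of_fourier {w : Lp ℂ 2 (volume : Measure (E d))}
    {v : Lp ℂ 1 (volume : Measure (E d))} (h : 𝓕 (w : 𝓢'(E d, ℂ)) = (v : 𝓢'(E d, ℂ))) :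
    ∃ c : E d → ℂ, Continuous c ∧ ⇑w =ᵐ[volume] c := by
  have hv : Integrable v volume := L1.integrable_coeFn v
  have hc : Continuous (𝓕⁻ (v : E d → ℂ)) := by
    have := VectorFourier.fourierIntegral_continuous (L := -innerₗ (E d)) (μ := volume)
      (e := Real.fourierChar) Real.continuous_fourierChar (continuous_inner (𝕜 := ℝ) (E := E d)).neg hv
    exact this
  refine ⟨𝓕⁻ (v : E d → ℂ), hc, ?_⟩
  refine ae_eq_of_integral_contDiff_smul_eq ((Lp.memLp w).locallyIntegrable one_le_two)
    hc.locallyIntegrable fun φ hφ hcs => ?_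
  have hcsC : HasCompactSupport fun x => (φ x : ℂ) := hcs.comp_left (g := ((↑) : ℝ → ℂ)) rfl
  have hφC : ContDiff ℝ (⊤ : ℕ∞) fun x => (φ x : ℂ) := Complex.ofRealCLM.contDiff.comp hφ
  obtain ⟨ψ, hψ⟩ : ∃ ψ : 𝓢(E d, ℂ), ∀ x, ψ x = φ x := ⟨hcsC.toSchwartzMap hφC, fun x => rfl⟩
  have e0 : (w : 𝓢'(E d, ℂ)) = 𝓕⁻ (v : 𝓢'(E d, ℂ)) := by rw [← h, fourierInv_fourier_eq]
  have e1 := DFunLike.congr_fun e0 ψ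
  rw [fourierInv_apply, Lp.toTemperedDistribution_apply, Lp.toTemperedDistribution_apply] at e1
  have e2 := VectorFourier.integral_fourierIntegral_smul_eq_flip (L := -innerₗ (E d))
    (μ := volume) (ν := volume) (e := Real.fourierChar) (f := ψ) (g := v)
    Real.continuous_fourierChar (continuous_inner (𝕜 := ℝ) (E := E d)).neg ψ.integrable hv
  have e3 : ∫ x, φ x • w x = ∫ x, ψ x • w x :=
    integral_congr_ae (Eventually.of_forall fun x => by simp [hψ])
  have e4 : ∫ x, φ x • (𝓕⁻ (v : E d → ℂ)) x = ∫ x, ψ x • (𝓕⁻ (v : E d → ℂ)) x :=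
    integral_congr_ae (Eventually.of_forall fun x => by simp [hψ])
  have hflip : (-innerₗ (E d)).flip = -innerₗ (E d) := by
    ext x y
    simp [real_inner_comm]
  rw [hflip] at e2
  rw [e3, e4, e1, SchwartzMap.fourierInv_coe]
  exact e2

/-- In dimension at most three, a square integrable function with square integrable distributional
Laplacian is continuous. -/
theorem exists_continuous_of_laplacian (hd : d ≤ 3) {w g : E d → ℝ} (hw : MemLp w 2 volume)
    (hg : MemLp g 2 volume)
    (h : ∀ ψ : E d → ℝ, ContDiff ℝ (⊤ : ℕ∞) ψ →
      ∫ x, w x * ∑ i, fderiv ℝ (fun y => fderiv ℝ ψ y (EuclideanSpace.basisFun (Fin d) ℝ i)) x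
        (EuclideanSpace.basisFun (Fin d) ℝ i) = ∫ x, g x * ψ x) :
    ∃ c : E d → ℝ, Continuous c ∧ w =ᵐ[volume] c := by
  have hwC : MemLp (fun x => (w x : ℂ)) 2 volume := hw.ofReal
  have hgC : MemLp (fun x => (g x : ℂ)) 2 volume := hg.ofReal
  have hΔ : Δ (hwC.toLp : 𝓢'(E d, ℂ)) = (hgC.toLp : 𝓢'(E d, ℂ)) := by
    ext ψ
    rw [laplacian_apply_apply, Lp.toTemperedDistribution_apply, Lp.toTemperedDistribution_apply,
      SchwartzMap.laplacian_eq_sum (EuclideanSpace.basisFun (Fin d) ℝ)]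
    have hi1 : Integrable (fun x => (∑ i, ∂_{EuclideanSpace.basisFun (Fin d) ℝ i}
        (∂_{EuclideanSpace.basisFun (Fin d) ℝ i} ψ)) x * (w x : ℂ)) volume :=
      (SchwartzMap.memLp _ 2 volume).integrable_mul hwC
    have hi2 : Integrable (fun x => ψ x * (g x : ℂ)) volume :=
      (ψ.memLp 2 volume).integrable_mul hgC
    have e1 : ∫ x, (∑ i, ∂_{EuclideanSpace.basisFun (Fin d) ℝ i}
        (∂_{EuclideanSpace.basisFun (Fin d) ℝ i} ψ)) x • hwC.toLp _ x = ∫ x,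
        (∑ i, ∂_{EuclideanSpace.basisFun (Fin d) ℝ i}
        (∂_{EuclideanSpace.basisFun (Fin d) ℝ i} ψ)) x * (w x : ℂ) := by
      refine integral_congr_ae ?_
      filter_upwards [hwC.coeFn_toLp] with x hx
      rw [hx, smul_eq_mul]
    have e2 : ∫ x, ψ x • hgC.toLp _ x = ∫ x, ψ x * (g x : ℂ) := by
      refine integral_congr_ae ?_
      filter_upwards [hgC.coeFn_toLp] with x hx
      rw [hx, smul_eq_mul]
    have key : ∀ l : ℂ →L[ℝ] ℝ, l (∫ x, (∑ i, ∂_{EuclideanSpace.basisFun (Fin d) ℝ i}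
        (∂_{EuclideanSpace.basisFun (Fin d) ℝ i} ψ)) x * (w x : ℂ)) =
        l (∫ x, ψ x * (g x : ℂ)) := by
      intro l
      rw [← l.integral_comp_comm hi1, ← l.integral_comp_comm hi2]
      have hl : ∀ (z : ℂ) (r : ℝ), l (z * r) = r * l z := fun z r => by
        rw [mul_comm, ← Complex.real_smul, map_smul, smul_eq_mul]
      have hd1 : ∀ (χ : 𝓢(E d, ℂ)) (x e : E d), fderiv ℝ (fun y => l (χ y)) x e = l (∂_{e} χ x) :=
        fun χ x e => DFunLike.congr_fun
          (l.hasFDerivAt.comp x χ.differentiableAt.hasFDerivAt).fderiv e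
      have h1 := h (fun x => l (ψ x)) (l.contDiff.comp (ψ.smooth ⊤))
      simp only [hl]
      rw [← h1]
      refine integral_congr_ae (Eventually.of_forall fun x => ?_)
      simp only [hd1, sum_apply, map_sum]
    rw [e1, e2]
    exact Complex.ext (key Complex.reCLM) (key Complex.imCLM)
  obtain ⟨v, hv⟩ := (memSobolev_two_of_laplacian hΔ).fourier_memL1 (by
    rw [finrank_euclideanSpace_fin]; norm_num; exact_mod_cast Nat.lt_succ_of_le hd)
  obtain ⟨c, hc, hwc⟩ := exists_continuous_of_fourier hv
  refine ⟨fun x => (c x).re, Complex.continuous_re.comp hc, ?_⟩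
  filter_upwards [hwc, hwC.coeFn_toLp] with x h1 h2
  rw [← h1, h2, Complex.ofReal_re]

end Embedding

/-! ### Interior regularity of the resolvent -/

section Interior

open scoped RealInnerProductSpace

variable {d : ℕ} {Ω : Set (E d)}

/-- The derivative of `φ` in the direction `e`. -/
noncomputable def dirDeriv (e : E d) (φ : E d → ℝ) : E d → ℝ := fun x => fderiv ℝ φ x e

theorem contDiff_dirDeriv {φ : E d → ℝ} (hφ : ContDiff ℝ (⊤ : ℕ∞) φ) (e : E d) :
    ContDiff ℝ (⊤ : ℕ∞) (dirDeriv e φ) :=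
  (hφ.fderiv_right (by simp)).clm_apply contDiff_const

theorem hasCompactSupport_dirDeriv {φ : E d → ℝ} (hc : HasCompactSupport φ) (e : E d) :
    HasCompactSupport (dirDeriv e φ) :=
  hc.fderiv_apply (𝕜 := ℝ) e

theorem dirDeriv_mul {φ ψ : E d → ℝ} (hφ : ContDiff ℝ (⊤ : ℕ∞) φ) (hψ : ContDiff ℝ (⊤ : ℕ∞) ψ)
    (e : E d) (x : E d) :
    dirDeriv e (fun y => φ y * ψ y) x = dirDeriv e φ x * ψ x + φ x * dirDeriv e ψ x := by
  unfold dirDeriv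
  rw [fderiv_fun_mul (hφ.differentiable (by simp) x) (hψ.differentiable (by simp) x)]
  simp only [add_apply, smul_apply, smul_eq_mul]
  ring

theorem memLp_mul_test {g θ : E d → ℝ} (hg : MemLp g 2 (volume.restrict Ω)) (hθ : Continuous θ)
    (hc : HasCompactSupport θ) : MemLp (fun x => g x * θ x) 2 (volume.restrict Ω) :=
  MemLp.mul' (r := 2) (p := 2) (q := ⊤) ((hθ.memLp_of_hasCompactSupport hc).restrict Ω) hg

theorem integrable_mul_test {g θ : E d → ℝ} (hg : MemLp g 2 (volume.restrict Ω))
    (hθ : Continuous θ) (hc : HasCompactSupport θ) :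
    Integrable (fun x => g x * θ x) (volume.restrict Ω) :=
  hg.integrable_mul (q := 2) ((hθ.memLp_of_hasCompactSupport hc).restrict Ω)

theorem memLp_inner_grad (v : H10 Ω) (e : E d) :
    MemLp (fun x => ⟪H10.grad v x, e⟫) 2 (volume.restrict Ω) :=
  (Lp.memLp (H10.grad v)).inner_const e

/-- The weak second derivative of `θ v` in the direction `e`, up to the term that involves the
second derivative of `v`. -/
theorem H10.integral_mul_dirDeriv_dirDeriv (v : H10 Ω) {θ ψ : E d → ℝ}
    (hθ : ContDiff ℝ (⊤ : ℕ∞) θ) (hc : HasCompactSupport θ) (hψ : ContDiff ℝ (⊤ : ℕ∞) ψ) (e : E d) :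
    ∫ x in Ω, H10.val v x * (θ x * dirDeriv e (dirDeriv e ψ) x) =
      -(∫ x in Ω, ⟪H10.grad v x, e⟫ * dirDeriv e (fun y => θ y * ψ y) x) +
        ∫ x in Ω, (2 * (⟪H10.grad v x, e⟫ * dirDeriv e θ x) +
          H10.val v x * dirDeriv e (dirDeriv e θ) x) * ψ x := by
  have hv := Lp.memLp (H10.val v)
  have hg := memLp_inner_grad v e
  have hθ1 := contDiff_dirDeriv hθ e
  have hθ2 := contDiff_dirDeriv hθ1 e
  have hψ1 := contDiff_dirDeriv hψ e
  have hψ2 := contDiff_dirDeriv hψ1 e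
  have hc1 := hasCompactSupport_dirDeriv hc e
  have hc2 := hasCompactSupport_dirDeriv hc1 e
  have h1 := H10.integral_val_mul_fderiv v (hθ.mul hψ1) hc.mul_right e
  have h2 := H10.integral_val_mul_fderiv v (hθ1.mul hψ) hc1.mul_right e
  have d1 : ∀ x, fderiv ℝ (fun y => θ y * dirDeriv e ψ y) x e =
      dirDeriv e θ x * dirDeriv e ψ x + θ x * dirDeriv e (dirDeriv e ψ) x := dirDeriv_mul hθ hψ1 e
  have d2 : ∀ x, fderiv ℝ (fun y => dirDeriv e θ y * ψ y) x e =
      dirDeriv e (dirDeriv e θ) x * ψ x + dirDeriv e θ x * dirDeriv e ψ x := dirDeriv_mul hθ1 hψ e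
  simp only [d1, d2, mul_add] at h1 h2
  rw [integral_add (integrable_mul_test hv (hθ1.mul hψ1).continuous hc1.mul_right)
    (integrable_mul_test hv (hθ.mul hψ2).continuous hc.mul_right)] at h1
  rw [integral_add (integrable_mul_test hv (hθ2.mul hψ).continuous hc2.mul_right)
    (integrable_mul_test hv (hθ1.mul hψ1).continuous hc1.mul_right)] at h2
  simp only [dirDeriv_mul hθ hψ e, mul_add, add_mul]
  have i1 := integrable_mul_test hg (hθ1.mul hψ).continuous hc1.mul_right
  have i2 := integrable_mul_test hg (hθ.mul hψ1).continuous hc.mul_right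
  have i3 := integrable_mul_test hv (hθ2.mul hψ).continuous hc2.mul_right
  have e1 : ∀ x, 2 * (⟪H10.grad v x, e⟫ * dirDeriv e θ x) * ψ x =
      2 * (⟪H10.grad v x, e⟫ * (dirDeriv e θ x * ψ x)) := fun x => by ring
  have e2 : ∀ x, H10.val v x * dirDeriv e (dirDeriv e θ) x * ψ x =
      H10.val v x * (dirDeriv e (dirDeriv e θ) x * ψ x) := fun x => by ring
  simp only [e1, e2]
  rw [integral_add i1 i2, integral_add (i1.const_mul 2) i3, integral_const_mul]
  linarith

/-- The Laplacian of `θ v` for the solution `v` of `v - Δ v = h` and a cutoff function `θ`. -/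
noncomputable def cutoffLaplacian (h : L2 Ω) (θ : E d → ℝ) (x : E d) : ℝ :=
  (H10.val (resolventLift Ω h) x - h x) * θ x +
    ∑ i, (2 * (⟪H10.grad (resolventLift Ω h) x, EuclideanSpace.basisFun (Fin d) ℝ i⟫ *
      dirDeriv (EuclideanSpace.basisFun (Fin d) ℝ i) θ x) + H10.val (resolventLift Ω h) x *
        dirDeriv (EuclideanSpace.basisFun (Fin d) ℝ i)
          (dirDeriv (EuclideanSpace.basisFun (Fin d) ℝ i) θ) x)

theorem memLp_cutoffLaplacian (h : L2 Ω) {θ : E d → ℝ} (hθ : ContDiff ℝ (⊤ : ℕ∞) θ)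
    (hc : HasCompactSupport θ) : MemLp (cutoffLaplacian h θ) 2 (volume.restrict Ω) := by
  refine (memLp_mul_test ((Lp.memLp _).sub (Lp.memLp h)) hθ.continuous hc).add
    (memLp_finsetSum _ fun i _ => ?_)
  have hθ1 := contDiff_dirDeriv hθ (EuclideanSpace.basisFun (Fin d) ℝ i)
  have hc1 := hasCompactSupport_dirDeriv hc (EuclideanSpace.basisFun (Fin d) ℝ i)
  exact ((memLp_mul_test (memLp_inner_grad _ _) hθ1.continuous hc1).const_mul 2).add
    (memLp_mul_test (Lp.memLp _) (contDiff_dirDeriv hθ1 _).continuous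
      (hasCompactSupport_dirDeriv hc1 _))

theorem integral_cutoffLaplacian_mul (h : L2 Ω) {θ ψ : E d → ℝ} (hθ : ContDiff ℝ (⊤ : ℕ∞) θ)
    (hc : HasCompactSupport θ) (hs : tsupport θ ⊆ Ω) (hψ : ContDiff ℝ (⊤ : ℕ∞) ψ) :
    ∫ x in Ω, cutoffLaplacian h θ x * ψ x =
      ∫ x in Ω, H10.val (resolventLift Ω h) x * θ x * ∑ i,
        dirDeriv (EuclideanSpace.basisFun (Fin d) ℝ i)
          (dirDeriv (EuclideanSpace.basisFun (Fin d) ℝ i) ψ) x := by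
  obtain ⟨v, hv⟩ : ∃ v, v = resolventLift Ω h := ⟨_, rfl⟩
  have hvm := Lp.memLp (H10.val v)
  have hθψ : ContDiff ℝ (⊤ : ℕ∞) fun y => θ y * ψ y := hθ.mul hψ
  have hcψ : HasCompactSupport fun y => θ y * ψ y := hc.mul_right
  obtain ⟨p, hp1, hp2⟩ := H10.exists_of_test hθψ hcψ ((tsupport_mul_subset_left).trans hs)
  have hweak : ∫ x in Ω, (H10.val v x - h x) * (θ x * ψ x) =
      -∫ x in Ω, ∑ i, ⟪H10.grad v x, EuclideanSpace.basisFun (Fin d) ℝ i⟫ *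
        dirDeriv (EuclideanSpace.basisFun (Fin d) ℝ i) (fun y => θ y * ψ y) x := by
    have h1 := H10.inner_eq v p
    rw [hv, inner_resolventLift, ← hv, L2_inner_eq (Filter.EventuallyEq.refl _ _) hp1,
      L2_inner_eq (Filter.EventuallyEq.refl _ _) hp1,
      L2_inner_eq (Filter.EventuallyEq.refl _ _) hp2] at h1
    have h2 : ∀ x, ⟪H10.grad v x, ∇ (fun y => θ y * ψ y) x⟫ =
        ∑ i, ⟪H10.grad v x, EuclideanSpace.basisFun (Fin d) ℝ i⟫ *
          dirDeriv (EuclideanSpace.basisFun (Fin d) ℝ i) (fun y => θ y * ψ y) x := fun x => by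
      rw [← (EuclideanSpace.basisFun (Fin d) ℝ).sum_inner_mul_inner]
      refine Finset.sum_congr rfl fun i _ => ?_
      rw [real_inner_comm (∇ (fun y => θ y * ψ y) x), inner_gradient_left]
      rfl
    simp only [h2] at h1
    simp only [sub_mul]
    rw [integral_sub (integrable_mul_test hvm hθψ.continuous hcψ)
      (integrable_mul_test (Lp.memLp h) hθψ.continuous hcψ)]
    have h3 : ∀ g : L2 Ω, ∫ x in Ω, ⟪g x, θ x * ψ x⟫ = ∫ x in Ω, g x * (θ x * ψ x) := fun g =>
      integral_congr_ae (Eventually.of_forall fun x => mul_comm _ _)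
    rw [h3, h3] at h1
    linarith
  have hi : ∀ i : Fin d, Integrable (fun x => ⟪H10.grad v x, EuclideanSpace.basisFun (Fin d) ℝ i⟫ *
      dirDeriv (EuclideanSpace.basisFun (Fin d) ℝ i) (fun y => θ y * ψ y) x)
      (volume.restrict Ω) := fun i =>
    integrable_mul_test (memLp_inner_grad v _) (contDiff_dirDeriv hθψ _).continuous
      (hasCompactSupport_dirDeriv hcψ _)
  have hj : ∀ i : Fin d, Integrable (fun x =>
      (2 * (⟪H10.grad v x, EuclideanSpace.basisFun (Fin d) ℝ i⟫ *
        dirDeriv (EuclideanSpace.basisFun (Fin d) ℝ i) θ x) + H10.val v x *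
          dirDeriv (EuclideanSpace.basisFun (Fin d) ℝ i)
            (dirDeriv (EuclideanSpace.basisFun (Fin d) ℝ i) θ) x) * ψ x)
      (volume.restrict Ω) := fun i => by
    have hθ1 := contDiff_dirDeriv hθ (EuclideanSpace.basisFun (Fin d) ℝ i)
    have hc1 := hasCompactSupport_dirDeriv hc (EuclideanSpace.basisFun (Fin d) ℝ i)
    refine (((integrable_mul_test
      (memLp_inner_grad v (EuclideanSpace.basisFun (Fin d) ℝ i)) (hθ1.mul hψ).continuous
      hc1.mul_right).const_mul 2).add (integrable_mul_test hvm
        ((contDiff_dirDeriv hθ1 (EuclideanSpace.basisFun (Fin d) ℝ i)).mul hψ).continuous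
        (hasCompactSupport_dirDeriv hc1 _).mul_right)).congr (Eventually.of_forall fun x => ?_)
    simp only [Pi.add_apply]
    ring
  have hl : ∀ i : Fin d, Integrable (fun x => H10.val v x * (θ x *
      dirDeriv (EuclideanSpace.basisFun (Fin d) ℝ i)
        (dirDeriv (EuclideanSpace.basisFun (Fin d) ℝ i) ψ) x)) (volume.restrict Ω) := fun i =>
    integrable_mul_test hvm
      (hθ.mul (contDiff_dirDeriv (contDiff_dirDeriv hψ _) _)).continuous hc.mul_right
  have hL : ∫ x in Ω, H10.val v x * θ x * ∑ i, dirDeriv (EuclideanSpace.basisFun (Fin d) ℝ i)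
      (dirDeriv (EuclideanSpace.basisFun (Fin d) ℝ i) ψ) x =
      ∑ i, ∫ x in Ω, H10.val v x * (θ x * dirDeriv (EuclideanSpace.basisFun (Fin d) ℝ i)
        (dirDeriv (EuclideanSpace.basisFun (Fin d) ℝ i) ψ) x) := by
    rw [← integral_finsetSum _ fun i _ => hl i]
    simp only [Finset.mul_sum, mul_assoc]
  unfold cutoffLaplacian
  rw [← hv, hL]
  simp only [H10.integral_mul_dirDeriv_dirDeriv v hθ hc hψ]
  rw [Finset.sum_add_distrib, Finset.sum_neg_distrib, ← integral_finsetSum _ fun i _ => hi i,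
    ← hweak, ← integral_finsetSum _ fun i _ => hj i, ← integral_add]
  · refine integral_congr_ae (Eventually.of_forall fun x => ?_)
    simp only [← Finset.sum_mul]
    ring
  · exact integrable_mul_test (hvm.sub (Lp.memLp h)) hθψ.continuous hcψ
  · exact integrable_finsetSum _ fun i _ => hj i

theorem exists_continuous_resolventLift (hd : d ≤ 3) (hΩ : IsOpen Ω) (h : L2 Ω) {θ : E d → ℝ}
    (hθ : ContDiff ℝ (⊤ : ℕ∞) θ) (hc : HasCompactSupport θ) (hs : tsupport θ ⊆ Ω) :
    ∃ c : E d → ℝ, Continuous c ∧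
      ∀ᵐ x ∂(volume.restrict Ω), H10.val (resolventLift Ω h) x * θ x = c x := by
  obtain ⟨c, hcc, hwc⟩ := exists_continuous_of_laplacian hd
    (w := Ω.indicator fun x => H10.val (resolventLift Ω h) x * θ x)
    (g := Ω.indicator (cutoffLaplacian h θ))
    ((memLp_indicator_iff_restrict hΩ.measurableSet).2
      (memLp_mul_test (Lp.memLp _) hθ.continuous hc))
    ((memLp_indicator_iff_restrict hΩ.measurableSet).2 (memLp_cutoffLaplacian h hθ hc))
    (fun ψ hψ => by
      have h1 := integral_cutoffLaplacian_mul h hθ hc hs hψ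
      rw [← integral_indicator hΩ.measurableSet, ← integral_indicator hΩ.measurableSet] at h1
      refine (integral_congr_ae (Eventually.of_forall fun x => ?_)).trans
        (h1.symm.trans (integral_congr_ae (Eventually.of_forall fun x => ?_)))
      · by_cases hx : x ∈ Ω
        · simp only [indicator_of_mem hx]
          rfl
        · simp only [indicator_of_notMem hx, zero_mul]
      · by_cases hx : x ∈ Ω
        · simp only [indicator_of_mem hx]
        · simp only [indicator_of_notMem hx, zero_mul])
  refine ⟨c, hcc, ?_⟩
  filter_upwards [ae_restrict_of_ae hwc, ae_restrict_mem hΩ.measurableSet] with x h1 h2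
  rw [← h1, indicator_of_mem h2]

open scoped Classical in
/-- The extension by zero of a continuous function on a closed ball. -/
noncomputable def ballExtend {η : E d} {r : ℝ} (c : C(Metric.closedBall η r, ℝ)) (x : E d) : ℝ :=
  if hx : x ∈ Metric.closedBall η r then c ⟨x, hx⟩ else 0

theorem ballExtend_apply {η : E d} {r : ℝ} (c : C(Metric.closedBall η r, ℝ)) {x : E d}
    (hx : x ∈ Metric.closedBall η r) : ballExtend c x = c ⟨x, hx⟩ := dif_pos hx

theorem continuousOn_ballExtend {η : E d} {r : ℝ} (c : C(Metric.closedBall η r, ℝ)) :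
    ContinuousOn (ballExtend c) (Metric.closedBall η r) := by
  rw [continuousOn_iff_continuous_domRestrict]
  exact c.continuous.congr fun x => (ballExtend_apply c x.2).symm

theorem integrableOn_ballExtend {η : E d} {r : ℝ} (c : C(Metric.closedBall η r, ℝ)) :
    IntegrableOn (ballExtend c) (Metric.closedBall η r) :=
  (continuousOn_ballExtend c).integrableOn_compact (isCompact_closedBall η r)

/-- Equality almost everywhere on a closed ball determines a continuous function. -/
theorem continuousMap_eq_of_ae {η : E d} {r : ℝ} (hr : 0 < r)
    {c c' : C(Metric.closedBall η r, ℝ)} {g : E d → ℝ}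
    (h : ∀ᵐ x ∂(volume.restrict (Metric.closedBall η r)),
      ∀ hx : x ∈ Metric.closedBall η r, g x = c ⟨x, hx⟩)
    (h' : ∀ᵐ x ∂(volume.restrict (Metric.closedBall η r)),
      ∀ hx : x ∈ Metric.closedBall η r, g x = c' ⟨x, hx⟩) : c = c' := by
  have heq : EqOn (ballExtend c) (ballExtend c') (Metric.closedBall η r) := by
    refine Measure.eqOn_of_ae_eq (μ := volume) ?_ (continuousOn_ballExtend c)
      (continuousOn_ballExtend c') ?_
    · filter_upwards [h, h', ae_restrict_mem Metric.isClosed_closedBall.measurableSet]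
        with x h1 h2 hx
      rw [ballExtend_apply c hx, ballExtend_apply c' hx, ← h1 hx, ← h2 hx]
    · rw [interior_closedBall η hr.ne', closure_ball η hr.ne']
  ext x
  have hx := heq x.2
  rwa [ballExtend_apply c x.2, ballExtend_apply c' x.2] at hx

/-- In dimension at most three, the resolvent maps `L₂(Ω)` boundedly into the continuous functions
on a closed ball inside `Ω`. -/
theorem exists_interiorEval (hd : d ≤ 3) (hΩ : IsOpen Ω) {η : E d} {r δ : ℝ} (hr : 0 < r)
    (hrδ : r < δ) (hball : Metric.closedBall η δ ⊆ Ω) :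
    ∃ A : L2 Ω →L[ℝ] C(Metric.closedBall η r, ℝ), ∀ h,
      ∀ᵐ x ∂(volume.restrict (Metric.closedBall η r)), ∀ hx : x ∈ Metric.closedBall η r,
        resolvent Ω h x = A h ⟨x, hx⟩ := by
  have hsub : Metric.closedBall η r ⊆ Ω :=
    (Metric.closedBall_subset_closedBall hrδ.le).trans hball
  have hres : ∀ {P : E d → Prop}, (∀ᵐ x ∂(volume.restrict Ω), P x) →
      ∀ᵐ x ∂(volume.restrict (Metric.closedBall η r)), P x := fun h =>
    ae_restrict_of_ae_restrict_of_subset hsub h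
  have hex : ∀ h : L2 Ω, ∃ c : C(Metric.closedBall η r, ℝ),
      ∀ᵐ x ∂(volume.restrict (Metric.closedBall η r)), ∀ hx : x ∈ Metric.closedBall η r,
        resolvent Ω h x = c ⟨x, hx⟩ := fun h => by
    let θ : ContDiffBump η := ⟨r, δ, hr, hrδ⟩
    obtain ⟨c, hc, hcv⟩ := exists_continuous_resolventLift hd hΩ h (θ := θ) θ.contDiff
      θ.hasCompactSupport (by rw [θ.tsupport_eq]; exact hball)
    refine ⟨⟨fun x => c x, hc.comp continuous_subtype_val⟩, ?_⟩
    filter_upwards [hres hcv] with x h1 hx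
    rw [θ.one_of_mem_closedBall hx, mul_one] at h1
    exact h1
  choose A hA using hex
  have huniq : ∀ (h : L2 Ω) (c : C(Metric.closedBall η r, ℝ)),
      (∀ᵐ x ∂(volume.restrict (Metric.closedBall η r)), ∀ hx : x ∈ Metric.closedBall η r,
        resolvent Ω h x = c ⟨x, hx⟩) → c = A h := fun h c hc => continuousMap_eq_of_ae hr hc (hA h)
  let L : L2 Ω →ₗ[ℝ] C(Metric.closedBall η r, ℝ) :=
    { toFun := A
      map_add' := fun g h => (huniq _ _ (by
        rw [map_add]
        filter_upwards [hA g, hA h, hres (Lp.coeFn_add (resolvent Ω g) (resolvent Ω h))]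
          with x h1 h2 h3 hx
        rw [h3, Pi.add_apply, h1 hx, h2 hx]
        rfl)).symm
      map_smul' := fun a g => (huniq _ _ (by
        rw [map_smul]
        filter_upwards [hA g, hres (Lp.coeFn_smul a (resolvent Ω g))] with x h1 h2 hx
        rw [h2, Pi.smul_apply, h1 hx]
        rfl)).symm }
  refine ⟨⟨L, L.continuous_of_seq_closed_graph fun u h c hu hc => huniq h c ?_⟩, hA⟩
  obtain ⟨k, hk, hlim⟩ := (tendstoInMeasure_of_tendsto_Lp
    (((resolvent Ω).continuous.tendsto h).comp hu)).exists_seq_tendsto_ae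
  filter_upwards [hres hlim, ae_all_iff.2 fun n => hA (u (k n))] with x h1 h2 hx
  refine tendsto_nhds_unique h1 ?_
  have h3 : Tendsto (fun n => A (u (k n)) ⟨x, hx⟩) atTop (𝓝 (c ⟨x, hx⟩)) :=
    ((continuous_eval_const (F := C(Metric.closedBall η r, ℝ)) (⟨x, hx⟩ : Metric.closedBall η r)).tendsto c).comp
      (hc.comp hk.tendsto_atTop)
  exact h3.congr fun n => (h2 n hx).symm

end Interior

/-! ### Integrals of continuous functions over shrinking balls -/

section Balls

variable {d : ℕ} {η : E d} {r : ℝ}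

/-- The integral over `B` as a functional on the continuous functions on a closed ball
containing `B`. -/
noncomputable def ballIntegral (η : E d) (r : ℝ) {B : Set (E d)}
    (hB : B ⊆ Metric.closedBall η r) : C(Metric.closedBall η r, ℝ) →L[ℝ] ℝ :=
  LinearMap.mkContinuous
    { toFun := fun c => ∫ x in B, ballExtend c x
      map_add' := fun c c' => by
        rw [← integral_add ((integrableOn_ballExtend c).mono_set hB)
          ((integrableOn_ballExtend c').mono_set hB)]
        refine integral_congr_ae (Eventually.of_forall fun x => ?_)
        by_cases hx : x ∈ Metric.closedBall η r <;> simp [ballExtend, hx]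
      map_smul' := fun a c => by
        rw [RingHom.id_apply, ← integral_smul]
        refine integral_congr_ae (Eventually.of_forall fun x => ?_)
        by_cases hx : x ∈ Metric.closedBall η r <;> simp [ballExtend, hx] }
    (volume.real B) fun c => by
      rw [mul_comm]
      refine norm_setIntegral_le_of_norm_le_const ?_ fun x hx => ?_
      · exact (measure_mono hB).trans_lt measure_closedBall_lt_top
      · rw [ballExtend_apply c (hB hx)]
        exact c.norm_coe_le_norm _

theorem ballIntegral_apply {B : Set (E d)} (hB : B ⊆ Metric.closedBall η r)
    (c : C(Metric.closedBall η r, ℝ)) : ballIntegral η r hB c = ∫ x in B, ballExtend c x := rfl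

theorem norm_ballIntegral_le {B : Set (E d)} (hB : B ⊆ Metric.closedBall η r)
    (c : C(Metric.closedBall η r, ℝ)) : ‖ballIntegral η r hB c‖ ≤ volume.real B * ‖c‖ :=
  (ContinuousLinearMap.le_opNorm _ _).trans (mul_le_mul_of_nonneg_right
    (LinearMap.mkContinuous_norm_le _ measureReal_nonneg _) (norm_nonneg _))

/-- Averages over shrinking sets converge to the value at the centre. -/
theorem tendsto_ballIntegral_div (hr : 0 ≤ r) {B : ℕ → Set (E d)} {ρ : ℕ → ℝ}
    (hρ : Tendsto ρ atTop (𝓝 0))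
    (hBρ : ∀ n, B n ⊆ Metric.closedBall η (ρ n)) (hB0 : ∀ n, volume.real (B n) ≠ 0)
    (hB : ∀ n, B n ⊆ Metric.closedBall η r) {c : ℕ → C(Metric.closedBall η r, ℝ)}
    {c₀ : C(Metric.closedBall η r, ℝ)} (hc : Tendsto c atTop (𝓝 c₀)) :
    Tendsto (fun n => ballIntegral η r (hB n) (c n) / volume.real (B n)) atTop
      (𝓝 (c₀ ⟨η, Metric.mem_closedBall_self hr⟩)) := by
  have h1 : Tendsto (fun n => ballIntegral η r (hB n) (c n - c₀) / volume.real (B n)) atTop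
      (𝓝 0) := by
    have h2 : Tendsto (fun n => ‖c n - c₀‖) atTop (𝓝 0) := tendsto_iff_norm_sub_tendsto_zero.1 hc
    refine squeeze_zero_norm (fun n => ?_) h2
    have hpos : 0 < volume.real (B n) := lt_of_le_of_ne measureReal_nonneg (hB0 n).symm
    rw [norm_div, Real.norm_of_nonneg hpos.le, div_le_iff₀ hpos, mul_comm]
    exact norm_ballIntegral_le _ _
  have h3 : Tendsto (fun n => ballIntegral η r (hB n) c₀ / volume.real (B n)) atTop
      (𝓝 (c₀ ⟨η, Metric.mem_closedBall_self hr⟩)) := by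
    rw [Metric.tendsto_atTop]
    intro e he
    obtain ⟨s, hs, hcs⟩ := Metric.continuous_iff.1 c₀.continuous
      ⟨η, Metric.mem_closedBall_self hr⟩ (e / 2) (half_pos he)
    obtain ⟨N, hN⟩ := eventually_atTop.1 (hρ.eventually_lt_const hs)
    refine ⟨N, fun n hn => ?_⟩
    have hpos : 0 < volume.real (B n) := lt_of_le_of_ne measureReal_nonneg (hB0 n).symm
    have hfin : volume (B n) < ⊤ := (measure_mono (hB n)).trans_lt measure_closedBall_lt_top
    have h4 : ‖∫ x in B n, (ballExtend c₀ x - c₀ ⟨η, Metric.mem_closedBall_self hr⟩)‖ ≤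
        e / 2 * volume.real (B n) :=
      norm_setIntegral_le_of_norm_le_const hfin fun x hx => by
        rw [ballExtend_apply c₀ (hB n hx), ← dist_eq_norm]
        refine (hcs ⟨x, hB n hx⟩ ?_).le
        exact lt_of_le_of_lt (Metric.mem_closedBall.1 (hBρ n hx)) (hN n hn)
    rw [integral_sub ((integrableOn_ballExtend c₀).mono_set (hB n))
      (integrableOn_const hfin.ne), setIntegral_const, smul_eq_mul] at h4
    rw [Real.dist_eq, ballIntegral_apply, div_sub' hpos.ne', abs_div, abs_of_pos hpos,
      div_lt_iff₀ hpos]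
    exact lt_of_le_of_lt h4 (mul_lt_mul_of_pos_right (half_lt_self he) hpos)
  have h5 := h1.add h3
  rw [zero_add] at h5
  refine h5.congr fun n => ?_
  rw [← add_div, ← map_add, sub_add_cancel]

end Balls

section Pairing

open scoped BoundedContinuousFunction

variable {X Q : Type*} [NormedAddCommGroup X] [NormedSpace ℝ X] [TopologicalSpace Q]
  [CompactSpace Q]

theorem exists_norm_bilinear_le {X Y Z : Type*} [NormedAddCommGroup X] [NormedSpace ℝ X]
    [NormedAddCommGroup Y] [NormedSpace ℝ Y] [NormedAddCommGroup Z] [NormedSpace ℝ Z]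
    (b : X →L[ℝ] Y →L[ℝ] Z) : ∃ C ≥ 0, ∀ x y, ‖b x y‖ ≤ C * ‖x‖ * ‖y‖ :=
  ⟨‖b‖, b.opNorm_nonneg, b.le_opNorm₂⟩

theorem tendsto_bilinear {X Y Z ι : Type*} [NormedAddCommGroup X] [NormedSpace ℝ X]
    [NormedAddCommGroup Y] [NormedSpace ℝ Y] [NormedAddCommGroup Z] [NormedSpace ℝ Z]
    (b : X →L[ℝ] Y →L[ℝ] Z) {l : Filter ι} {x : ι → X} {x₀ : X} (hx : Tendsto x l (𝓝 x₀))
    {y : ι → Y} {y₀ : Y} (hy : Tendsto y l (𝓝 y₀)) :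
    Tendsto (fun n => b (x n) (y n)) l (𝓝 (b x₀ y₀)) :=
  (b.continuous₂.tendsto (x₀, y₀)).comp (hx.prodMk_nhds hy)

/-- The continuous function `x ↦ ∫₀ᵀ V(t,x) (A k(t))(x) dt`, as a bilinear map in
`V ∈ L₁(0,T;C(Q))` and `k`. -/
noncomputable def timePairing (T : ℝ) (A : X →L[ℝ] C(Q, ℝ)) :
    Lp C(Q, ℝ) 1 (timeMeasure T) →L[ℝ] (ℝ →ᵇ X) →L[ℝ] C(Q, ℝ) :=
  (ContinuousLinearMap.lpPairing (timeMeasure T) 1 ⊤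
    (ContinuousLinearMap.mul ℝ C(Q, ℝ))).bilinearComp
      (ContinuousLinearMap.id ℝ _)
      ((BoundedContinuousFunction.toLp ⊤ (timeMeasure T) ℝ).comp
        (A.compLeftContinuousBounded ℝ))

theorem timePairing_apply (T : ℝ) (A : X →L[ℝ] C(Q, ℝ))
    (V : Lp C(Q, ℝ) 1 (timeMeasure T)) (k : ℝ →ᵇ X) :
    timePairing T A V k = ∫ t in Ioo 0 T, V t * A (k t) := by
  refine (ContinuousLinearMap.lpPairing_eq_integral _ _ _).trans ?_
  refine integral_congr_ae ?_
  filter_upwards [BoundedContinuousFunction.coeFn_toLp ⊤ (timeMeasure T) ℝ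
    (A.compLeftContinuousBounded ℝ k)] with t ht
  exact congrArg (V t * ·) ht

theorem exists_norm_timePairing_le (T : ℝ) (A : X →L[ℝ] C(Q, ℝ)) :
    ∃ C ≥ 0, ∀ V k, ‖timePairing T A V k‖ ≤ C * ‖V‖ * ‖k‖ :=
  exists_norm_bilinear_le (timePairing T A)

theorem tendsto_timePairing {ι : Type*} {l : Filter ι} (T : ℝ) (A : X →L[ℝ] C(Q, ℝ))
    {V : ι → Lp C(Q, ℝ) 1 (timeMeasure T)} {V₀ : Lp C(Q, ℝ) 1 (timeMeasure T)}
    (hV : Tendsto V l (𝓝 V₀)) {k : ι → ℝ →ᵇ X} {k₀ : ℝ →ᵇ X} (hk : Tendsto k l (𝓝 k₀)) :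
    Tendsto (fun n => timePairing T A (V n) (k n)) l (𝓝 (timePairing T A V₀ k₀)) :=
  tendsto_bilinear (timePairing T A) hV hk

theorem integrable_timePairing (T : ℝ) (A : X →L[ℝ] C(Q, ℝ))
    (V : Lp C(Q, ℝ) 1 (timeMeasure T)) (k : ℝ →ᵇ X) :
    Integrable (fun t => V t * A (k t)) (timeMeasure T) := by
  have hV : MemLp V 1 (timeMeasure T) := Lp.memLp V
  have hk : MemLp (fun t => A (k t)) ⊤ (timeMeasure T) :=
    (Lp.memLp (BoundedContinuousFunction.toLp ⊤ (timeMeasure T) ℝ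
      (A.compLeftContinuousBounded ℝ k))).ae_eq (BoundedContinuousFunction.coeFn_toLp _ _ _ _)
  exact memLp_one_iff_integrable.1 (MemLp.mul' (r := 1) (p := 1) (q := ⊤) hk hV)

/-- Restriction of continuous functions to a smaller ball. -/
noncomputable def ballRestrict {d : ℕ} (η : E d) {r δ : ℝ} (h : r ≤ δ) :
    C(Metric.closedBall η δ, ℝ) →L[ℝ] C(Metric.closedBall η r, ℝ) where
  toLinearMap := (ContinuousMap.compRightAlgHom ℝ ℝ
    ⟨inclusion (Metric.closedBall_subset_closedBall h), continuous_inclusion _⟩).toLinearMap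
  cont := ContinuousMap.compRightAlgHom_continuous ℝ ℝ _

theorem ballRestrict_apply {d : ℕ} {η : E d} {r δ : ℝ} (h : r ≤ δ)
    (c : C(Metric.closedBall η δ, ℝ)) (x : E d)
    (hx : x ∈ Metric.closedBall η r) : ballRestrict η h c ⟨x, hx⟩ =
      c ⟨x, Metric.closedBall_subset_closedBall h hx⟩ := rfl

end Pairing

/-! ### The variation of the cost with respect to the actuator -/

section Variation

open scoped RealInnerProductSpace BoundedContinuousFunction

variable {d : ℕ} {Ω : Set (E d)}

/-- The sum of the states of the control `u` for the actuators `ω` and `ω'` is the mild solution with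
data `2 f` and `χ_{ω'} u + χ_ω u`. Its adjoint state is `(1 - Δ)⁻¹ k`, and this is the function `k` of
time. -/
noncomputable def adjointDensity (S : ResolventSemigroup (resolvent Ω)) (T : ℝ) {ω ω' : Set (E d)}
    (hω : MeasurableSet ω) (hω' : MeasurableSet ω') (f : H10 Ω)
    (u : Lp (L2 Ω) 2 (timeMeasure T)) : ℝ →ᵇ L2 Ω :=
  S.adjointPreimage T ((2 : ℝ) • H10.val f, source Ω T hω' u + source Ω T hω u)

/-- For `χ_{ω'} = χ_ω + σ χ_B` the cost changes by `σ ∫₀ᵀ ∫_B u p dx dt`, exactly and not only to first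
order: `p` is the adjoint state of the sum of both states, as `‖X‖² - ‖Y‖² = ⟪X - Y, X + Y⟫`. -/
theorem reducedCost_sub (S : ResolventSemigroup (resolvent Ω)) (T γ : ℝ) {ω ω' B : Set (E d)}
    (hω : MeasurableSet ω) (hω' : MeasurableSet ω') (hB : MeasurableSet B) {σ : ℝ} (f : H10 Ω)
    (u : Lp (L2 Ω) 2 (timeMeasure T))
    (hrel : source Ω T hω' u = source Ω T hω u + σ • source Ω T hB u) :
    reducedCost S T γ hω' f u - reducedCost S T γ hω f u =
      σ * ∫ t in Ioo 0 T, ⟪restrictTo Ω hB (u t),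
        resolvent Ω (adjointDensity S T hω hω' f u t)⟫ := by
  obtain ⟨X, hX⟩ : ∃ X, X = freeState S T f + controlToState S T hω' u := ⟨_, rfl⟩
  obtain ⟨Y, hY⟩ : ∃ Y, Y = freeState S T f + controlToState S T hω u := ⟨_, rfl⟩
  have h1 : reducedCost S T γ hω' f u - reducedCost S T γ hω f u = ⟪X - Y, X + Y⟫ := by
    unfold reducedCost tikhonov
    rw [← hX, ← hY, inner_sub_left, inner_add_right, inner_add_right, real_inner_comm X Y,
      real_inner_self_eq_norm_sq, real_inner_self_eq_norm_sq]
    ring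
  rw [freeState_add_controlToState] at hX hY
  have h2 : X - Y = σ • toL2 (L2 Ω) T (S.mild T (0, source Ω T hB u)) := by
    rw [hX, hY, ← map_sub, ← map_sub, ← map_smul, ← map_smul, hrel]
    simp
  have h3 : X + Y = toL2 (L2 Ω) T (S.mild T ((2 : ℝ) • H10.val f,
      source Ω T hω' u + source Ω T hω u)) := by
    rw [hX, hY, ← map_add, ← map_add, Prod.mk_add_mk, two_smul]
  rw [h1, h2, h3, inner_smul_left, S.inner_mild_eq, L2.inner_def]
  congr 1
  refine integral_congr_ae ?_
  filter_upwards [(restrictTo Ω hB).coeFn_compLpL (p := 2) u, coeFn_toL2 T (S.adjointState T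
    (toL2 (L2 Ω) T (S.mild T ((2 : ℝ) • H10.val f, source Ω T hω' u + source Ω T hω u)))),
    ae_restrict_mem measurableSet_Ioo] with t h4 h5 h6
  rw [h5, S.adjointState_mild (Ioo_subset_Icc_self h6)]
  exact congrArg (⟪·, _⟫) h4

/-- The control `u` is given by `V ∈ L₁(0,T;C(B))` on a closed ball `B`. -/
def IsControlOnBall {T : ℝ} {η : E d} {r : ℝ} (u : Lp (L2 Ω) 2 (timeMeasure T))
    (V : Lp C(Metric.closedBall η r, ℝ) 1 (timeMeasure T)) : Prop :=
  ∀ᵐ t ∂(timeMeasure T), ∀ᵐ x ∂(volume.restrict (Metric.closedBall η r)),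
    ∀ hx : x ∈ Metric.closedBall η r, u t x = V t ⟨x, hx⟩

theorem IsControlOnBall.restrict {T : ℝ} {η : E d} {r δ : ℝ} (hrδ : r ≤ δ)
    {u : Lp (L2 Ω) 2 (timeMeasure T)}
    {V : Lp C(Metric.closedBall η δ, ℝ) 1 (timeMeasure T)} (h : IsControlOnBall u V) :
    IsControlOnBall u ((ballRestrict η hrδ).compLpL 1 (timeMeasure T) V) := by
  filter_upwards [h, (ballRestrict η hrδ).coeFn_compLpL (p := 1) V] with t h1 h2
  rw [h2]
  filter_upwards [ae_restrict_of_ae_restrict_of_subset (Metric.closedBall_subset_closedBall hrδ) h1]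
    with x h3 hx
  rw [h3 (Metric.closedBall_subset_closedBall hrδ hx), ballRestrict_apply]

/-- The variation of the cost is the integral over `B` of one continuous function, the time integral
of the product of the control and the adjoint state. -/
theorem integral_restrictTo_resolvent {T : ℝ} {η : E d} {r : ℝ}
    (hball : Metric.closedBall η r ⊆ Ω) {B : Set (E d)} (hB : MeasurableSet B)
    (hBr : B ⊆ Metric.closedBall η r) {A : L2 Ω →L[ℝ] C(Metric.closedBall η r, ℝ)}
    (hA : ∀ h, ∀ᵐ x ∂(volume.restrict (Metric.closedBall η r)),
      ∀ hx : x ∈ Metric.closedBall η r, resolvent Ω h x = A h ⟨x, hx⟩)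
    {u : Lp (L2 Ω) 2 (timeMeasure T)} {V : Lp C(Metric.closedBall η r, ℝ) 1 (timeMeasure T)}
    (huV : IsControlOnBall u V) (k : ℝ →ᵇ L2 Ω) :
    ∫ t in Ioo 0 T, ⟪restrictTo Ω hB (u t), resolvent Ω (k t)⟫ =
      ballIntegral η r hBr (timePairing T A V k) := by
  rw [timePairing_apply, ← (ballIntegral η r hBr).integral_comp_comm (integrable_timePairing T A V k)]
  refine integral_congr_ae ?_
  filter_upwards [huV] with t ht
  rw [inner_restrictTo, ballIntegral_apply]
  have h1 : ∀ x, B.indicator (fun _ => (1 : ℝ)) x * u t x * resolvent Ω (k t) x =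
      B.indicator (fun x => u t x * resolvent Ω (k t) x) x := fun x => by
    by_cases hx : x ∈ B
    · simp [hx]
    · simp [hx]
  simp only [h1]
  rw [setIntegral_indicator hB, inter_eq_self_of_subset_right (hBr.trans hball)]
  refine setIntegral_congr_ae hB ?_
  have h2 := (ae_restrict_iff' Metric.isClosed_closedBall.measurableSet).1 ht
  have h3 := (ae_restrict_iff' Metric.isClosed_closedBall.measurableSet).1 (hA (k t))
  filter_upwards [h2, h3] with x h4 h5 hx
  rw [h4 (hBr hx) (hBr hx), h5 (hBr hx) (hBr hx), ballExtend_apply _ (hBr hx)]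
  rfl

/-- Removing a small set from the actuator, or adding one, changes the source by little. -/
theorem tendsto_source_zero {T : ℝ} {B : ℕ → Set (E d)} (hB : ∀ n, MeasurableSet (B n))
    (hlim : Tendsto (fun n => volume (B n)) atTop (𝓝 0)) (u : Lp (L2 Ω) 2 (timeMeasure T)) :
    Tendsto (fun n => source Ω T (hB n) u) atTop (𝓝 0) := by
  have hsq : ∀ (g : L2 Ω) (n : ℕ), ‖restrictTo Ω (hB n) g‖ ^ 2 =
      ∫ x in B n, (g x) ^ 2 ∂(volume.restrict Ω) := fun g n => by
    rw [← real_inner_self_eq_norm_sq, L2_inner_eq (coeFn_restrictTo (hB n) g)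
      (coeFn_restrictTo (hB n) g), ← integral_indicator (hB n)]
    refine integral_congr_ae (Eventually.of_forall fun x => ?_)
    by_cases hx : x ∈ B n
    · simp [hx, sq]
    · simp [hx]
  have hpt : ∀ g : L2 Ω, Tendsto (fun n => ‖restrictTo Ω (hB n) g‖ ^ 2) atTop (𝓝 0) := fun g => by
    simp only [hsq]
    refine Integrable.tendsto_setIntegral_nhds_zero (Lp.memLp g).integrable_sq ?_
    exact tendsto_of_tendsto_of_tendsto_of_le_of_le tendsto_const_nhds hlim (fun _ => zero_le)
      fun n => Measure.restrict_apply_le _ _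
  have hle : ∀ (g : L2 Ω) (n : ℕ), ‖restrictTo Ω (hB n) g‖ ≤ ‖g‖ := fun g n =>
    (ContinuousLinearMap.le_of_opNorm_le _
      (LinearMap.mkContinuous_norm_le _ zero_le_one _) g).trans_eq (one_mul _)
  have h1 : Tendsto (fun n => ‖source Ω T (hB n) u‖ ^ 2) atTop (𝓝 0) := by
    have h2 : ∀ n, ‖source Ω T (hB n) u‖ ^ 2 =
        ∫ t, ‖restrictTo Ω (hB n) (u t)‖ ^ 2 ∂(timeMeasure T) := fun n => by
      rw [norm_sq_L2_eq]
      refine integral_congr_ae ?_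
      filter_upwards [(restrictTo Ω (hB n)).coeFn_compLpL (p := 2) u] with t ht
      exact congrArg (‖·‖ ^ 2) ht
    simp only [h2]
    have h3 : ∫ _ : ℝ, (0 : ℝ) ∂(timeMeasure T) = 0 := integral_zero _ _
    rw [← h3]
    refine tendsto_integral_of_dominated_convergence (fun t => ‖u t‖ ^ 2) (fun n => ?_)
      ((Lp.memLp u).integrable_norm_pow two_ne_zero) (fun n => Eventually.of_forall fun t => ?_)
      (Eventually.of_forall fun t => hpt (u t))
    · exact ((restrictTo Ω (hB n)).continuous.comp_aestronglyMeasurable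
        (Lp.aestronglyMeasurable u)).norm.pow 2
    · rw [norm_pow, norm_norm]
      gcongr
      exact hle _ _
  rw [tendsto_zero_iff_norm_tendsto_zero]
  have h4 := (Real.continuous_sqrt.tendsto 0).comp h1
  rw [Real.sqrt_zero] at h4
  exact h4.congr fun n => Real.sqrt_sq (norm_nonneg _)

end Variation

/-! ### The topological derivative -/

section Derivative

open scoped RealInnerProductSpace BoundedContinuousFunction

variable {d : ℕ} {Ω : Set (E d)}

theorem norm_restrictTo_le {ω : Set (E d)} (hω : MeasurableSet ω) : ‖restrictTo Ω hω‖ ≤ 1 :=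
  LinearMap.mkContinuous_norm_le _ zero_le_one _

theorem norm_source_apply_le {T : ℝ} {ω : Set (E d)} (hω : MeasurableSet ω)
    (u : Lp (L2 Ω) 2 (timeMeasure T)) : ‖source Ω T hω u‖ ≤ ‖u‖ := by
  refine Lp.norm_le_norm_of_ae_le ?_
  filter_upwards [(restrictTo Ω hω).coeFn_compLpL (p := 2) u] with t ht
  have ht' : source Ω T hω u t = restrictTo Ω hω (u t) := ht
  rw [ht']
  exact (ContinuousLinearMap.le_of_opNorm_le _ (norm_restrictTo_le hω) _).trans_eq (one_mul _)

/-- If `χ_{ω'} = χ_ω + σ χ_B` then the sources are related accordingly. -/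
theorem source_eq_add {T σ : ℝ} {ω ω' B : Set (E d)} (hω : MeasurableSet ω)
    (hω' : MeasurableSet ω') (hB : MeasurableSet B) (hΩ : MeasurableSet Ω)
    (hrel : ∀ x ∈ Ω, ω'.indicator (fun _ => (1 : ℝ)) x =
      ω.indicator (fun _ => (1 : ℝ)) x + σ * B.indicator (fun _ => (1 : ℝ)) x)
    (u : Lp (L2 Ω) 2 (timeMeasure T)) :
    source Ω T hω' u = source Ω T hω u + σ • source Ω T hB u := by
  have h1 : restrictTo Ω hω' = restrictTo Ω hω + σ • restrictTo Ω hB := by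
    ext1 g
    refine Lp.ext ?_
    rw [add_apply, smul_apply]
    filter_upwards [coeFn_restrictTo hω' g, coeFn_restrictTo hω g, coeFn_restrictTo hB g,
      Lp.coeFn_add (restrictTo Ω hω g) (σ • restrictTo Ω hB g),
      Lp.coeFn_smul σ (restrictTo Ω hB g), ae_restrict_mem hΩ] with x h2 h3 h4 h5 h6 hx
    have hind : ∀ s : Set (E d), s.indicator g x = s.indicator (fun _ => (1 : ℝ)) x * g x :=
      fun s => by by_cases hs : x ∈ s <;> simp [hs]
    rw [h5, Pi.add_apply, h6, Pi.smul_apply, h2, h3, h4, smul_eq_mul, hind, hind ω, hind B,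
      hrel x hx]
    ring
  unfold source
  rw [h1, ContinuousLinearMap.add_compLpL, ContinuousLinearMap.smul_compLpL, add_apply, smul_apply]

theorem actuatorTendsto_of_indicator {σ : ℝ} {ω : Set (E d)} {ωs B : ℕ → Set (E d)}
    (hΩ : MeasurableSet Ω) (hB : ∀ n, MeasurableSet (B n))
    (hrel : ∀ n, ∀ x ∈ Ω, (ωs n).indicator (fun _ => (1 : ℝ)) x =
      ω.indicator (fun _ => (1 : ℝ)) x + σ * (B n).indicator (fun _ => (1 : ℝ)) x)
    (hlim : Tendsto (fun n => volume (B n)) atTop (𝓝 0)) : ActuatorTendsto Ω ωs ω := by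
  have h1 : ∀ n, eLpNorm (fun x => (ωs n).indicator (fun _ => (1 : ℝ)) x -
      ω.indicator (fun _ => (1 : ℝ)) x) 1 (volume.restrict Ω) ≤ ‖σ‖ₑ * volume (B n) := fun n => by
    calc _ = eLpNorm ((B n).indicator fun _ => σ) 1 (volume.restrict Ω) := by
          refine eLpNorm_congr_ae ?_
          filter_upwards [ae_restrict_mem hΩ] with x hx
          rw [hrel n x hx]
          by_cases hxB : x ∈ B n <;> simp [hxB]
      _ = ‖σ‖ₑ * volume.restrict Ω (B n) := by
          rw [eLpNorm_indicator_const (hB n) one_ne_zero ENNReal.one_ne_top]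
          simp
      _ ≤ _ := by exact mul_le_mul_right (Measure.restrict_apply_le _ _) _
  have h2 : Tendsto (fun n => ‖σ‖ₑ * volume (B n)) atTop (𝓝 0) := by
    have := ENNReal.Tendsto.const_mul (a := ‖σ‖ₑ) hlim (Or.inr enorm_ne_top)
    rwa [mul_zero] at this
  exact tendsto_of_tendsto_of_tendsto_of_le_of_le tendsto_const_nhds h2 (fun _ => zero_le) h1

theorem tendsto_adjointDensity (S : ResolventSemigroup (resolvent Ω)) {T σ : ℝ} {ω : Set (E d)}
    {ωs B : ℕ → Set (E d)} (hω : MeasurableSet ω) (hωs : ∀ n, MeasurableSet (ωs n))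
    (hB : ∀ n, MeasurableSet (B n)) (f : H10 Ω)
    (hrel : ∀ n (u : Lp (L2 Ω) 2 (timeMeasure T)),
      source Ω T (hωs n) u = source Ω T hω u + σ • source Ω T (hB n) u)
    (hlim : Tendsto (fun n => volume (B n)) atTop (𝓝 0))
    {u : ℕ → Lp (L2 Ω) 2 (timeMeasure T)} {u₀ : Lp (L2 Ω) 2 (timeMeasure T)}
    (hu : Tendsto u atTop (𝓝 u₀)) :
    Tendsto (fun n => adjointDensity S T hω (hωs n) f (u n)) atTop
      (𝓝 (adjointDensity S T hω hω f u₀)) := by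
  have h1 : Tendsto (fun n => source Ω T (hB n) (u n)) atTop (𝓝 0) := by
    have h2 : Tendsto (fun n => source Ω T (hB n) (u n - u₀)) atTop (𝓝 0) :=
      squeeze_zero_norm (fun n => norm_source_apply_le (hB n) _)
        (tendsto_iff_norm_sub_tendsto_zero.1 hu)
    have h3 := h2.add (tendsto_source_zero hB hlim u₀)
    rw [add_zero] at h3
    refine h3.congr fun n => ?_
    rw [← map_add, sub_add_cancel]
  have h4 : Tendsto (fun n => source Ω T hω (u n)) atTop (𝓝 (source Ω T hω u₀)) :=
    ((source Ω T hω).continuous.tendsto u₀).comp hu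
  have h5 : Tendsto (fun n => source Ω T (hωs n) (u n)) atTop (𝓝 (source Ω T hω u₀)) := by
    have h6 := h4.add (h1.const_smul σ)
    rw [smul_zero, add_zero] at h6
    exact h6.congr fun n => (hrel n (u n)).symm
  exact ((S.adjointPreimage T).continuous.tendsto _).comp
    (tendsto_const_nhds.prodMk_nhds (h5.add h4))

theorem norm_adjointDensity_le (S : ResolventSemigroup (resolvent Ω)) (T : ℝ) {ω ω' : Set (E d)}
    (hω : MeasurableSet ω) (hω' : MeasurableSet ω') (f : H10 Ω)
    (u : Lp (L2 Ω) 2 (timeMeasure T)) :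
    ‖adjointDensity S T hω hω' f u‖ ≤ ‖S.adjointPreimage T‖ * (2 * ‖H10.val f‖ + 2 * ‖u‖) := by
  refine (ContinuousLinearMap.le_opNorm _ _).trans ?_
  gcongr
  rw [Prod.norm_mk]
  refine max_le ?_ ?_
  · rw [norm_smul, Real.norm_two]
    linarith [norm_nonneg u]
  · have h1 := norm_add_le (source Ω T hω' u) (source Ω T hω u)
    linarith [norm_source_apply_le hω u, norm_source_apply_le hω' u, norm_nonneg (H10.val f)]

/-- An optimal control is bounded by the cost of the zero control. -/
theorem norm_le_of_reducedCost_le (S : ResolventSemigroup (resolvent Ω)) {T γ : ℝ} (hγ : 0 < γ)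
    {ω : Set (E d)} (hω : MeasurableSet ω) (f : H10 Ω) {u : Lp (L2 Ω) 2 (timeMeasure T)}
    (h : reducedCost S T γ hω f u ≤ reducedCost S T γ hω f 0) :
    ‖u‖ ≤ √(‖freeState S T f‖ ^ 2 / γ) := by
  refine Real.le_sqrt_of_sq_le ?_
  rw [le_div_iff₀ hγ]
  unfold reducedCost tikhonov at h
  simp only [map_zero, add_zero, norm_zero, ne_eq, OfNat.ofNat_ne_zero, not_false_eq_true, zero_pow,
    mul_zero] at h
  nlinarith [sq_nonneg ‖freeState S T f + controlToState S T hω u‖]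

/-- The difference quotients of `𝒥₁` converge along all sequences of perturbations of `ω` that
shrink to a point `η` near which the optimal controls are regular. -/
theorem exists_tendsto_J1_quotient (hd : d ≤ 3) (hΩ : IsOpen Ω) {T γ : ℝ} (hT : 0 < T) (hγ : 0 < γ)
    {U : Set (L2 Ω)} (hUc : IsClosed U) (hU : Convex ℝ U) (hU0 : (0 : L2 Ω) ∈ U) {ω : Set (E d)}
    (hω : MeasurableSet ω) (hωΩ : ω ⊆ Ω) {η : E d} (f : H10 Ω)
    (hreg : ControlRegularity Ω T γ U η) :
    ∃ r > 0, Metric.closedBall η r ⊆ Ω ∧ ∃ L : ℝ, ∀ (σ : ℝ) (ρ : ℕ → ℝ) (B ωs : ℕ → Set (E d)),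
      (∀ n, MeasurableSet (B n)) → (∀ n, MeasurableSet (ωs n)) → (∀ n, ωs n ⊆ Ω) →
      (∀ n, ∀ x ∈ Ω, (ωs n).indicator (fun _ => (1 : ℝ)) x =
        ω.indicator (fun _ => (1 : ℝ)) x + σ * (B n).indicator (fun _ => (1 : ℝ)) x) →
      (∀ n, B n ⊆ Metric.closedBall η (ρ n)) → (∀ n, ρ n ≤ r) → Tendsto ρ atTop (𝓝 0) →
      Tendsto (fun n => volume (B n)) atTop (𝓝 0) → (∀ n, volume.real (B n) ≠ 0) →
      Tendsto (fun n => (J1 Ω T γ U (ωs n) f - J1 Ω T γ U ω f) / volume.real (B n)) atTop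
        (𝓝 (σ * L)) := by
  obtain ⟨δ, hδ, hball, ub, hub, hubc⟩ := hreg
  obtain ⟨r, hr, hrδ⟩ : ∃ r, 0 < r ∧ r < δ := ⟨δ / 2, half_pos hδ, half_lt_self hδ⟩
  obtain ⟨A, hA⟩ := exists_interiorEval hd hΩ hr hrδ hball
  obtain ⟨CA, hCA, hCAle⟩ := exists_norm_timePairing_le T A
  obtain ⟨S⟩ := (isResolvent_resolvent hΩ).nonempty_semigroup
  have hballr : Metric.closedBall η r ⊆ Ω :=
    (Metric.closedBall_subset_closedBall hrδ.le).trans hball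
  obtain ⟨u₀, hu₀, hJ₀, hgrow₀⟩ := exists_isOptimalControl hΩ S hT hγ hUc hU hU0 hω f
  obtain ⟨R, hR⟩ : ∃ R : Lp C(Metric.closedBall η δ, ℝ) 1 (timeMeasure T) →L[ℝ]
      Lp C(Metric.closedBall η r, ℝ) 1 (timeMeasure T),
      R = (ballRestrict η hrδ.le).compLpL 1 (timeMeasure T) := ⟨_, rfl⟩
  have honball : ∀ {ω' : Set (E d)}, MeasurableSet ω' → ω' ⊆ Ω → ∀ {u},
      IsOptimalControl Ω T γ U ω' f u → IsControlOnBall u (R (ub f ω')) := fun h1 h2 u hu => by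
    rw [hR]
    exact IsControlOnBall.restrict hrδ.le (hub f _ h1 h2 u hu)
  refine ⟨r, hr, hballr, timePairing T A (R (ub f ω)) (adjointDensity S T hω hω f u₀)
    ⟨η, Metric.mem_closedBall_self hr.le⟩, fun σ ρ B ωs hB hωs hωsΩ hrel hBρ hρr hρ hlim hB0 => ?_⟩
  have hBr : ∀ n, B n ⊆ Metric.closedBall η r := fun n =>
    (hBρ n).trans (Metric.closedBall_subset_closedBall (hρr n))
  have hpos : ∀ n, 0 < volume.real (B n) := fun n =>
    lt_of_le_of_ne measureReal_nonneg (hB0 n).symm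
  have hsrc : ∀ n (u : Lp (L2 Ω) 2 (timeMeasure T)),
      source Ω T (hωs n) u = source Ω T hω u + σ • source Ω T (hB n) u := fun n u =>
    source_eq_add hω (hωs n) (hB n) hΩ.measurableSet (hrel n) u
  choose u hu hJ hgrow using fun n => exists_isOptimalControl hΩ S hT hγ hUc hU hU0 (hωs n) f
  have hV : Tendsto (fun n => R (ub f (ωs n))) atTop (𝓝 (R (ub f ω))) :=
    (R.continuous.tendsto _).comp (tendsto_iff_norm_sub_tendsto_zero.2
      (hubc (fun _ => f) f ωs ω (fun n => ⟨hωs n, hωsΩ n⟩) hω hωΩ (fun _ => tendsto_const_nhds)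
        (actuatorTendsto_of_indicator hΩ.measurableSet hB hrel hlim)))
  have hvar : ∀ n {v : Lp (L2 Ω) 2 (timeMeasure T)}
      {V : Lp C(Metric.closedBall η r, ℝ) 1 (timeMeasure T)}, IsControlOnBall v V →
      reducedCost S T γ (hωs n) f v - reducedCost S T γ hω f v = σ * ballIntegral η r (hBr n)
        (timePairing T A V (adjointDensity S T hω (hωs n) f v)) := fun n v V hvV => by
    rw [reducedCost_sub S T γ hω (hωs n) (hB n) f v (hsrc n v),
      integral_restrictTo_resolvent hballr (hB n) (hBr n) hA hvV]
  have hvar₀ := fun n => hvar n (honball hω hωΩ hu₀)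
  have hvar₁ := fun n => hvar n (honball (hωs n) (hωsΩ n) (hu n))
  -- The optimal controls converge, since the cost grows quadratically at its minimiser and the
  -- variation of the cost is of the order of the volume of `B n`.
  have hconv : Tendsto u atTop (𝓝 u₀) := by
    obtain ⟨M, hM⟩ : ∃ M, M = √(‖freeState S T f‖ ^ 2 / γ) := ⟨_, rfl⟩
    have h0 : (0 : Lp (L2 Ω) 2 (timeMeasure T)) ∈ controls T U := zero_mem_controls hU0
    have hle : ∀ n, ∀ v ∈ controls T U, reducedCost S T γ (hωs n) f (u n) ≤
        reducedCost S T γ (hωs n) f v := fun n v hv => by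
      have : 0 ≤ γ / 2 * ‖v - u n‖ ^ 2 := by positivity
      linarith [hgrow n v hv]
    have hle₀ : ∀ v ∈ controls T U, reducedCost S T γ hω f u₀ ≤ reducedCost S T γ hω f v :=
      fun v hv => by
        have : 0 ≤ γ / 2 * ‖v - u₀‖ ^ 2 := by positivity
        linarith [hgrow₀ v hv]
    have hMn : ∀ n, ‖u n‖ ≤ M := fun n =>
      hM ▸ norm_le_of_reducedCost_le S hγ (hωs n) f (hle n 0 h0)
    have hM₀ : ‖u₀‖ ≤ M := hM ▸ norm_le_of_reducedCost_le S hγ hω f (hle₀ 0 h0)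
    obtain ⟨N, hN⟩ := hV.norm.bddAbove_range
    have hVn : ∀ n, ‖R (ub f (ωs n))‖ ≤ N := fun n => hN ⟨n, rfl⟩
    have hVN : ‖R (ub f ω)‖ ≤ N := le_of_tendsto' hV.norm hVn
    obtain ⟨K, hK⟩ : ∃ K, K = CA * N *
      (‖S.adjointPreimage T‖ * (2 * ‖H10.val f‖ + 2 * M)) := ⟨_, rfl⟩
    have hbound : ∀ n (v : Lp (L2 Ω) 2 (timeMeasure T))
        (V : Lp C(Metric.closedBall η r, ℝ) 1 (timeMeasure T)), ‖v‖ ≤ M → ‖V‖ ≤ N →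
        |ballIntegral η r (hBr n) (timePairing T A V (adjointDensity S T hω (hωs n) f v))| ≤
          volume.real (B n) * K := fun n v V hv hVN => by
      have hN0 : 0 ≤ N := (norm_nonneg V).trans hVN
      refine (norm_ballIntegral_le _ _).trans ?_
      gcongr
      refine (hCAle _ _).trans ?_
      rw [hK]
      gcongr
      refine (norm_adjointDensity_le S T hω (hωs n) f v).trans ?_
      gcongr
    have hest : ∀ n, ‖u n - u₀‖ ^ 2 ≤ 2 / γ * (2 * |σ| * K) * volume.real (B n) := fun n => by
      have h1 := hgrow n u₀ hu₀.1
      have h2 := hle₀ (u n) (hu n).1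
      have h3 : |reducedCost S T γ (hωs n) f u₀ - reducedCost S T γ hω f u₀| ≤
          |σ| * (volume.real (B n) * K) := by
        rw [hvar₀ n, abs_mul]
        exact mul_le_mul_of_nonneg_left (hbound n _ _ hM₀ hVN) (abs_nonneg _)
      have h4 : |reducedCost S T γ (hωs n) f (u n) - reducedCost S T γ hω f (u n)| ≤
          |σ| * (volume.real (B n) * K) := by
        rw [hvar₁ n, abs_mul]
        exact mul_le_mul_of_nonneg_left (hbound n _ _ (hMn n) (hVn n)) (abs_nonneg _)
      have h5 : γ / 2 * ‖u n - u₀‖ ^ 2 ≤ 2 * |σ| * K * volume.real (B n) := by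
        rw [norm_sub_rev]
        linarith [(abs_le.1 h3).2, (abs_le.1 h4).1]
      calc ‖u n - u₀‖ ^ 2 = 2 / γ * (γ / 2 * ‖u n - u₀‖ ^ 2) := by field_simp
        _ ≤ 2 / γ * (2 * |σ| * K * volume.real (B n)) := by gcongr
        _ = _ := by ring
    have hvol : Tendsto (fun n => volume.real (B n)) atTop (𝓝 0) :=
      (ENNReal.tendsto_toReal ENNReal.zero_ne_top).comp hlim
    have hsq : Tendsto (fun n => ‖u n - u₀‖ ^ 2) atTop (𝓝 0) := by
      refine squeeze_zero (fun n => sq_nonneg _) hest ?_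
      have := hvol.const_mul (2 / γ * (2 * |σ| * K))
      rwa [mul_zero] at this
    rw [tendsto_iff_norm_sub_tendsto_zero]
    have h6 := (Real.continuous_sqrt.tendsto 0).comp hsq
    rw [Real.sqrt_zero] at h6
    exact h6.congr fun n => Real.sqrt_sq (norm_nonneg _)
  have hquot : ∀ {v : ℕ → Lp (L2 Ω) 2 (timeMeasure T)}
      {V : ℕ → Lp C(Metric.closedBall η r, ℝ) 1 (timeMeasure T)},
      Tendsto v atTop (𝓝 u₀) → Tendsto V atTop (𝓝 (R (ub f ω))) →
      (∀ n, reducedCost S T γ (hωs n) f (v n) - reducedCost S T γ hω f (v n) =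
        σ * ballIntegral η r (hBr n)
          (timePairing T A (V n) (adjointDensity S T hω (hωs n) f (v n)))) →
      Tendsto (fun n => (reducedCost S T γ (hωs n) f (v n) - reducedCost S T γ hω f (v n)) /
        volume.real (B n)) atTop (𝓝 (σ * timePairing T A (R (ub f ω))
          (adjointDensity S T hω hω f u₀) ⟨η, Metric.mem_closedBall_self hr.le⟩)) := by
    intro v V hv hV' heq
    have h1 : Tendsto (fun n => timePairing T A (V n) (adjointDensity S T hω (hωs n) f (v n))) atTop
        (𝓝 (timePairing T A (R (ub f ω)) (adjointDensity S T hω hω f u₀))) :=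
      tendsto_timePairing T A hV' (tendsto_adjointDensity S hω hωs hB f hsrc hlim hv)
    refine ((tendsto_ballIntegral_div hr.le hρ hBρ hB0 hBr h1).const_mul σ).congr fun n => ?_
    rw [heq n, mul_div_assoc]
  -- The optimal control for `ωs n` competes in the problem for `ω` and conversely, so the difference
  -- quotient of the infima lies between those of the costs at these two controls.
  refine tendsto_of_tendsto_of_tendsto_of_le_of_le (hquot hconv hV hvar₁)
    (hquot tendsto_const_nhds tendsto_const_nhds hvar₀) (fun n => ?_) (fun n => ?_)
  · rw [hJ n, hJ₀]
    have h1 : 0 ≤ γ / 2 * ‖u n - u₀‖ ^ 2 := by positivity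
    exact div_le_div_of_nonneg_right (by linarith [hgrow₀ (u n) (hu n).1]) (hpos n).le
  · rw [hJ n, hJ₀]
    have h1 : 0 ≤ γ / 2 * ‖u₀ - u n‖ ^ 2 := by positivity
    exact div_le_div_of_nonneg_right (by linarith [hgrow n u₀ hu₀.1]) (hpos n).le

theorem exists_hasTopologicalDeriv (hd1 : 1 ≤ d) (hd : d ≤ 3) (hΩ : IsOpen Ω) {T γ : ℝ}
    (hT : 0 < T) (hγ : 0 < γ)
    {U : Set (L2 Ω)} (hUc : IsClosed U) (hU : Convex ℝ U) (hU0 : (0 : L2 Ω) ∈ U) {ω : Set (E d)}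
    (hω : MeasurableSet ω) (hωΩ : ω ⊆ Ω) {η : E d} (hη : η ∉ frontier ω) (f : H10 Ω)
    (hreg : ControlRegularity Ω T γ U η) :
    ∃ L, HasTopologicalDeriv (fun ω' => J1 Ω T γ U ω' f) ω η L := by
  obtain ⟨r, hr, hrΩ, L, hL⟩ := exists_tendsto_J1_quotient hd hΩ hT hγ hUc hU hU0 hω hωΩ f hreg
  have hvol0 : Tendsto (fun ε => volume (Metric.closedBall η ε)) (𝓝[>] 0) (𝓝 0) := by
    have h1 : Tendsto (fun ε : ℝ => ENNReal.ofReal (ε ^ d) * volume (Metric.ball (0 : E d) 1))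
        (𝓝[>] 0) (𝓝 0) := by
      have h2 : Tendsto (fun ε : ℝ => ENNReal.ofReal (ε ^ d)) (𝓝[>] 0) (𝓝 0) := by
        have h3 : Continuous fun ε : ℝ => ENNReal.ofReal (ε ^ d) :=
          ENNReal.continuous_ofReal.comp (continuous_pow d)
        have h4 := h3.tendsto 0
        rw [zero_pow (by omega), ENNReal.ofReal_zero] at h4
        exact h4.mono_left nhdsWithin_le_nhds
      have h5 := ENNReal.Tendsto.mul_const (b := volume (Metric.ball (0 : E d) 1)) h2
        (Or.inr measure_ball_lt_top.ne)
      rwa [zero_mul] at h5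
    refine h1.congr' ?_
    filter_upwards [self_mem_nhdsWithin] with ε hε
    rw [Measure.addHaar_closedBall _ _ (le_of_lt hε), finrank_euclideanSpace_fin]
  by_cases hηω : η ∈ ω
  · have hint : η ∈ interior ω := by
      by_contra h
      exact hη ⟨subset_closure hηω, h⟩
    obtain ⟨s, hs, hsω⟩ := Metric.nhds_basis_closedBall.mem_iff.1 (mem_interior_iff_mem_nhds.1 hint)
    -- A small ball around `η` lies in `ω`, so that removing it subtracts its characteristic function:
    -- `σ = -1`. Sequences of radii are shifted to make all of them small.
    refine ⟨-1 * L, fun _ => ?_, fun h => absurd (subset_closure hηω) h⟩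
    refine tendsto_of_seq_tendsto fun ε hε => ?_
    have hev : ∀ᶠ n in atTop, ε n ∈ Ioo 0 (min r s) := hε (Ioo_mem_nhdsGT (lt_min hr hs))
    obtain ⟨N, hN⟩ := eventually_atTop.1 hev
    have hN' : ∀ n, ε (n + N) ∈ Ioo 0 (min r s) := fun n => hN _ (Nat.le_add_left _ _)
    have hε' := hε.comp (tendsto_add_atTop_nat N)
    rw [← tendsto_add_atTop_iff_nat N]
    refine hL (-1) (fun n => ε (n + N)) (fun n => Metric.closedBall η (ε (n + N)))
      (fun n => ω \ Metric.closedBall η (ε (n + N))) (fun n => measurableSet_closedBall)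
      (fun n => hω.diff measurableSet_closedBall) (fun n => sdiff_subset.trans hωΩ) (fun n x _ => ?_)
      (fun n => Subset.rfl) (fun n => (hN' n).2.le.trans (min_le_left _ _))
      (tendsto_nhds_of_tendsto_nhdsWithin hε') (hvol0.comp hε') (fun n => ?_)
    · by_cases hx : x ∈ Metric.closedBall η (ε (n + N))
      · have hxω : x ∈ ω := hsω (Metric.closedBall_subset_closedBall
          ((hN' n).2.le.trans (min_le_right _ _)) hx)
        simp [hx, hxω]
      · by_cases hxω : x ∈ ω <;> simp [hx, hxω]
    · exact (ENNReal.toReal_pos (Metric.measure_closedBall_pos _ _ (hN' n).1).ne'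
        measure_closedBall_lt_top.ne).ne'
  -- If `η` lies outside the closure of `ω`, a small ball is disjoint from `ω`, and `σ = 1`.
  · refine ⟨1 * L, fun h => absurd h hηω, fun hcl => ?_⟩
    obtain ⟨s, hs, hsω⟩ := Metric.nhds_basis_closedBall.mem_iff.1
      (isClosed_closure.isOpen_compl.mem_nhds hcl)
    refine tendsto_of_seq_tendsto fun ε hε => ?_
    have hev : ∀ᶠ n in atTop, ε n ∈ Ioo 0 (min r s) := hε (Ioo_mem_nhdsGT (lt_min hr hs))
    obtain ⟨N, hN⟩ := eventually_atTop.1 hev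
    have hN' : ∀ n, ε (n + N) ∈ Ioo 0 (min r s) := fun n => hN _ (Nat.le_add_left _ _)
    have hε' := hε.comp (tendsto_add_atTop_nat N)
    rw [← tendsto_add_atTop_iff_nat N]
    refine hL 1 (fun n => ε (n + N)) (fun n => Metric.ball η (ε (n + N)))
      (fun n => ω ∪ Metric.ball η (ε (n + N))) (fun n => measurableSet_ball)
      (fun n => hω.union measurableSet_ball) (fun n => union_subset hωΩ
        ((Metric.ball_subset_closedBall.trans (Metric.closedBall_subset_closedBall
          ((hN' n).2.le.trans (min_le_left _ _)))).trans hrΩ)) (fun n x _ => ?_)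
      (fun n => Metric.ball_subset_closedBall) (fun n => (hN' n).2.le.trans (min_le_left _ _))
      (tendsto_nhds_of_tendsto_nhdsWithin hε')
      (tendsto_of_tendsto_of_tendsto_of_le_of_le tendsto_const_nhds (hvol0.comp hε')
        (fun _ => zero_le) fun n => measure_mono Metric.ball_subset_closedBall) (fun n => ?_)
    · by_cases hx : x ∈ Metric.ball η (ε (n + N))
      · have hxω : x ∉ ω := fun h => hsω (Metric.closedBall_subset_closedBall
          ((hN' n).2.le.trans (min_le_right _ _)) (Metric.ball_subset_closedBall hx))
            (subset_closure h)
        simp [hx, hxω]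
      · by_cases hxω : x ∈ ω <;> simp [hx, hxω]
    · exact (ENNReal.toReal_pos (Metric.measure_ball_pos _ _ (hN' n).1).ne'
        measure_ball_lt_top.ne).ne'

end Derivative

/-- The topological derivative only depends on the values of a shape function on measurable sets. -/
theorem hasTopologicalDeriv_congr {d : ℕ} {J J' : Set (E d) → ℝ} {ω : Set (E d)}
    (hω : MeasurableSet ω) (h : ∀ s, MeasurableSet s → J s = J' s) (η : E d) (L : ℝ) :
    HasTopologicalDeriv J ω η L ↔ HasTopologicalDeriv J' ω η L := by
  unfold HasTopologicalDeriv
  simp only [h _ hω, h _ (hω.diff Metric.isClosed_closedBall.measurableSet),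
    h _ (hω.union Metric.isOpen_ball.measurableSet)]

end ActuatorDesign

theorem corollary4p5 {d : ℕ} (hd1 : 1 ≤ d) (hd3 : d ≤ 3)
    (Ω : Set (ActuatorDesign.E d)) (hΩ : IsOpen Ω)
    (T γ : ℝ) (hT : 0 < T) (hγ : 0 < γ)
    (U : Set (ActuatorDesign.L2 Ω)) (hUclosed : IsClosed U) (hUconvex : Convex ℝ U)
    (hU0 : (0 : ActuatorDesign.L2 Ω) ∈ U) (hUneg : ∀ v ∈ U, -v ∈ U)
    (ω : Set (ActuatorDesign.E d)) (hωm : MeasurableSet ω) (hω : ω ⊆ Ω)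
    (η₀ : ActuatorDesign.E d) (hη₀ : η₀ ∈ Ω \ frontier ω)
    (f : ActuatorDesign.H10 Ω) :
    (∀ L : ℝ,
      ActuatorDesign.HasTopologicalDeriv
          (fun ω' => ActuatorDesign.J1 Ω T γ U ω' (-f)) ω η₀ L ↔
        ActuatorDesign.HasTopologicalDeriv
          (fun ω' => ActuatorDesign.J1 Ω T γ U ω' f) ω η₀ L) ∧
    (ActuatorDesign.ControlRegularity Ω T γ U η₀ →
      ∃ L : ℝ,
        ActuatorDesign.HasTopologicalDeriv
            (fun ω' => ActuatorDesign.J1 Ω T γ U ω' (-f)) ω η₀ L ∧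
          ActuatorDesign.HasTopologicalDeriv
            (fun ω' => ActuatorDesign.J1 Ω T γ U ω' f) ω η₀ L) := by
  have hcongr : ∀ L, ActuatorDesign.HasTopologicalDeriv
      (fun ω' => ActuatorDesign.J1 Ω T γ U ω' (-f)) ω η₀ L ↔ ActuatorDesign.HasTopologicalDeriv
        (fun ω' => ActuatorDesign.J1 Ω T γ U ω' f) ω η₀ L :=
    ActuatorDesign.hasTopologicalDeriv_congr hωm
      (fun s hs => ActuatorDesign.J1_neg hΩ hT γ hUneg hs f) η₀
  refine ⟨hcongr, fun hreg => ?_⟩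
  obtain ⟨L, hL⟩ := ActuatorDesign.exists_hasTopologicalDeriv hd1 hd3 hΩ hT hγ hUclosed hUconvex
    hU0 hωm hω hη₀.2 f hreg
  exact ⟨L, (hcongr L).2 hL, hL⟩
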